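/- **Theorem 1.3.** Let $d\ge 3$ and let $\Delta$ be the discrete Laplacian on $\ell^2(\mathbb Z^d)$, $(\Delta f)(n)=\frac12\sum_{j=1}^d\bigl(f_{n+e_j}+f_{n-e_j}\bigr)$, where $e_1,\dots,e_d$ is the standard basis of $\mathbb Z^d$. Let $q\in\mathbb R$ satisfy $$2\le q<\begin{cases}\frac{12}{5}, & d=3,\\[2pt] \frac{6d}{2d+1}, & d\ge 4,\end{cases}$$ and set $$\gamma_{d,q}=\begin{cases}\frac6q-\frac52, & d=3,\\[2pt] \frac{2d}{q}-\frac{2d+1}{3}, & d\ge4.\end{cases}$$ For $\gamma\in[0,1]$ with $\gamma<\gamma_{d,q}$ define $$C_d^\gamma=\begin{cases}\frac{8}{1-2\gamma}+8, & d=3,\\[2pt] \frac{4}{1-\gamma}, & d=4,\\[2pt] \frac{14\cdot 2^{d/4}}{d-4}, & d>4,\end{cases}$$ and, if $q>2$, $$\Gamma(q,d,\gamma)=\begin{cases}\Bigl(3+\frac{12(q-2)}{12-(5+2\gamma)q}\Bigr)^{\frac{3(q-2)}{q}}, & d=3,\\[4pt] \Bigl(3+2\bigl(\frac{5q-2}{8-(3+\gamma)q}\bigr)^{1+\frac{q}{4(q-2)}}\Bigr)^{\frac{4(q-2)}{q}},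 & d=4,\\[4pt] \Bigl(3+\frac{6d(q-2)}{6d-(2d+1+3\gamma)q}\Bigr)^{\frac{d(q-2)}{q}}, & d>4,\end{cases}$$ while $\Gamma(2,d,\gamma)=1$ for $d\ne4$ and $\Gamma(2,4,\gamma)=(1-\gamma)^{-1}$. Let $u,v\in\ell^q(\mathbb Z^d)$ be complex sequences, and denote by $u$, $v$ also the corresponding multiplication operators on $\ell^2(\mathbb Z^d)$. Then $\Delta-z$ is invertible for every $z\in\mathbb C\setminus[-d,d]$, and the function $Y_0(z)=u(\Delta-z)^{-1}v$, from $\mathbb C\setminus[-d,d]$ to the bounded operators on $\ell^2(\mathbb Z^d)$ with the operator norm, is analytic. Moreover: (a) For all $z\in\mathbb C\setminus[-d,d]$, $$\|Y_0(z)\|\le\bigl(1+C_d^0\,\Gamma(q,d,0)\bigr)\|u\|_q\|v\|_q .$$ (b) Let $H$ be one of the closed half-planes $\{\operatorname{Im}z\ge0\}$ and $\{\operatorname{Im}z\le0\}$. For every $\gamma\in[0,1]$ with $\gamma<\gamma_{d,q}$ and all $z,z'\in H\setminus[-d,d]$, $$\|Y_0(z)-Y_0(z')\|\le|z-z'|^\gamma\bigl(1+C_d^\gamma\,\Gamma(q,d,\gamma)\bigr)\|u\|_q\|v\|_q$$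 (with $|z-z'|^0=1$). The restriction of $Y_0$ to $H\setminus[-d,d]$ has a continuous extension to $H$, and the extension satisfies the same estimates for all $z,z'\in H$. In particular, if $d\ge5$ and $q<\frac{6d}{2d+4}$, the extension is Lipschitz continuous on $H$ with constant $\bigl(1+C_d^1\,\Gamma(q,d,1)\bigr)\|u\|_q\|v\|_q$. -/

import Mathlib

/-- The space `ℓ^p(ℤ^d)` of complex sequences. -/
abbrev LatticeLp (d : ℕ) (p : ENNReal) : Type :=
  lp (fun _ : Fin d → ℤ => ℂ) p

/-- The bounded operators on the Hilbert space `ℓ²(ℤ^d)`. -/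
abbrev LatticeOp (d : ℕ) : Type :=
  LatticeLp d 2 →L[ℂ] LatticeLp d 2

theorem memlp_latticeShift {d : ℕ} (a : Fin d → ℤ) (f : LatticeLp d 2) :
    Memℓp (fun n : Fin d → ℤ => (f : ∀ _ : Fin d → ℤ, ℂ) (n + a)) 2 := by
  have h2 : (0 : ℝ) < (2 : ENNReal).toReal := by norm_num
  have h := (memℓp_gen_iff h2).1 (lp.memℓp f)
  exact memℓp_gen ((Equiv.addRight a).summable_iff.2 h)

theorem norm_latticeShift {d : ℕ} (a : Fin d → ℤ) (f : LatticeLp d 2) :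
    ‖(⟨_, memlp_latticeShift a f⟩ : LatticeLp d 2)‖ = ‖f‖ := by
  have h2 : (0 : ℝ) < (2 : ENNReal).toReal := by norm_num
  rw [lp.norm_eq_tsum_rpow h2, lp.norm_eq_tsum_rpow h2]
  congr 1
  exact (Equiv.addRight a).tsum_eq
    (fun n => ‖(f : ∀ _ : Fin d → ℤ, ℂ) n‖ ^ (2 : ENNReal).toReal)

/-- The translation `(S_a f)(n) = f(n + a)` on `ℓ²(ℤ^d)`. -/
noncomputable def latticeShift {d : ℕ} (a : Fin d → ℤ) : LatticeOp d :=
  LinearMap.mkContinuous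
    { toFun := fun f => ⟨_, memlp_latticeShift a f⟩
      map_add' := fun _ _ => rfl
      map_smul' := fun _ _ => rfl }
    1 (fun f => by rw [one_mul]; exact (norm_latticeShift a f).le)

/-- The discrete Laplacian `(Δ f)(n) = ½ ∑_j (f(n + e_j) + f(n - e_j))` on `ℓ²(ℤ^d)`. -/
noncomputable def latticeLaplacian (d : ℕ) : LatticeOp d :=
  (1 / 2 : ℂ) • ∑ j : Fin d,
    (latticeShift (Pi.single j (1 : ℤ)) + latticeShift (-Pi.single j (1 : ℤ)))

theorem latticeLaplacian_apply (d : ℕ) (f : LatticeLp d 2) (n : Fin d → ℤ) :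
    latticeLaplacian d f n =
      (1 / 2 : ℂ) * ∑ j : Fin d, (f (n + Pi.single j 1) + f (n - Pi.single j 1)) := by
  simp only [latticeLaplacian, _root_.smul_apply, _root_.sum_apply,
    _root_.add_apply, lp.coeFn_smul, lp.coeFn_sum, Pi.smul_apply, Finset.sum_apply,
    lp.coeFn_add, Pi.add_apply, smul_eq_mul, sub_eq_add_neg]
  rfl

/-- Elements of `ℓ^p(ℤ^d)` are bounded sequences. -/
noncomputable def latticeToBounded {d : ℕ} {p : ENNReal} (u : LatticeLp d p) :
    LatticeLp d ⊤ :=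
  ⟨u, (lp.memℓp u).of_exponent_ge le_top⟩

/-- The operator on `ℓ²(ℤ^d)` of multiplication by a sequence `u ∈ ℓ^p(ℤ^d)`. -/
noncomputable def latticeMul {d : ℕ} {p : ENNReal} (u : LatticeLp d p) : LatticeOp d :=
  lp.mapCLM 2 (fun n => u n • ContinuousLinearMap.id ℂ ℂ) (K := ‖latticeToBounded u‖)
    (norm_nonneg _) (fun n => by
      rw [norm_smul, ContinuousLinearMap.norm_id, mul_one]
      exact lp.norm_apply_le_norm ENNReal.top_ne_zero (latticeToBounded u) n)

theorem latticeMul_apply {d : ℕ} {p : ENNReal} (u : LatticeLp d p) (f : LatticeLp d 2)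
    (n : Fin d → ℤ) : latticeMul u f n = u n * f n := rfl

/-- The segment `[-d, d]` of the real axis, as a subset of `ℂ`. -/
def latticeCut (d : ℕ) : Set ℂ :=
  (fun x : ℝ => (x : ℂ)) '' Set.Icc (-(d : ℝ)) (d : ℝ)

/-- The weighted resolvent `Y₀(z) = u (Δ - z)⁻¹ v`. (`Ring.inverse` is the two-sided inverse in the
algebra of bounded operators; its value is `0` where `Δ - z` is not invertible.) -/
noncomputable def weightedResolvent {d : ℕ} {p : ENNReal} (u v : LatticeLp d p) (z : ℂ) :
    LatticeOp d :=
  latticeMul u ∘L Ring.inverse (latticeLaplacian d - z • ContinuousLinearMap.id ℂ _) ∘L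
    latticeMul v

/-- The upper bound for `q`: `12/5` if `d = 3`, and `6d/(2d+1)` if `d ≥ 4`. -/
noncomputable def resolventCriticalExponent (d : ℕ) : ℝ :=
  if d = 3 then 12 / 5 else 6 * d / (2 * d + 1)

/-- The bound `γ_{d,q}` for the Hölder exponent (for `d ≥ 3`). -/
noncomputable def resolventHolderBound (d : ℕ) (q : ℝ) : ℝ :=
  if d = 3 then 6 / q - 5 / 2 else 2 * d / q - (2 * d + 1) / 3

/-- The constant `C_d^γ` (for `d ≥ 3` and `d > 2 + 2γ`). -/
noncomputable def resolventC (d : ℕ) (γ : ℝ) : ℝ :=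
  if d = 3 then 8 / (1 - 2 * γ) + 8
  else if d = 4 then 4 / (1 - γ)
  else 14 * (2 : ℝ) ^ ((d : ℝ) / 4) / ((d : ℝ) - 4)

/-- The constant `Γ(q, d, γ)` (for `d ≥ 3`, `q ≥ 2` and `γ < γ_{d,q}`). -/
noncomputable def resolventGamma (q : ℝ) (d : ℕ) (γ : ℝ) : ℝ :=
  if q = 2 then (if d = 4 then (1 - γ)⁻¹ else 1)
  else if d = 3 then
    (3 + 12 * (q - 2) / (12 - (5 + 2 * γ) * q)) ^ (3 * (q - 2) / q)
  else if d = 4 then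
    (3 + 2 * ((5 * q - 2) / (8 - (3 + γ) * q)) ^ (1 + q / (4 * (q - 2)))) ^ (4 * (q - 2) / q)
  else
    (3 + 6 * d * (q - 2) / (6 * d - (2 * d + 1 + 3 * γ) * q)) ^ ((d : ℝ) * (q - 2) / q)

/-! For `Im z > 0` the resolvent is the Laplace transform `i ∫₀^∞ e^{izt} e^{-itΔ} dt`
(`inverse_latticeLaplacian_sub`), and the matrix entries of `e^{-itΔ}` are, up to unimodular
factors, the products `∏ⱼ J_{nⱼ-mⱼ}(t)` (`latticeEntry_latticePropagator`). So one has to bound `∫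
φ(t) u e^{-itΔ} v dt`, where `φ` is `e^{izt}`, or a difference of two such exponentials, which is at
most `(2-γ)|z-z'|^γ t^γ`.

Times `t ≤ 1` cost only sup norms of `u` and `v`. For `t > 1` Stein interpolation is used
(`norm_bilinear_integral_le`). At one end the weights are bounded, the group is a contraction, and
the time weight `t^{-1-ε}` is integrable. At the other end the weights are in `ℓ²`, and a
Hilbert-Schmidt bound needs only an upper bound `B`, uniform over the entries, for `∫₁^∞ t^γ'
|kernel| dt`. At the parameter `2/q` the two ends give `γ = (2/q)γ' - (1-2/q)(1+ε)` and the constant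
`B^{2/q} ε^{-(1-2/q)}`.

By the arithmetic-geometric inequality `B` follows from bounds, uniform in the order, for `∫₁^∞ t^γ
|J_n|³` when `d = 3` and `∫₁^∞ t^γ |J_n|⁴` when `d ≥ 4`, together with `|J_n(t)| ≤ 1.7 t^{-1/3}` for
the factors beyond the fourth. These come from monotone quadratic forms in `J_n` and `x J_n'`. The
energy of `√x J_n` starts from `0` when `n ≠ 0`, and its growth controls `∫ (J_n/t)²` through the
turning region. Past the turning region `besselLyap` increases and is at most `2/π` in the limit,
which gives `J_n² √(t²-n²) ≤ 0.91`. The value `2/π` comes from a bound for `∫ (J₁/x)²`, and the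
recurrence carries it to all orders.

Then the interpolation constant is compared with `1 + C Γ` (`isHolderConstant_resolvent`). Hölder
bounds uniform in the open upper half-plane yield the boundary values, and taking adjoints gives the
lower half-plane. -/

open MeasureTheory Set Filter Topology

/-! ### Bessel functions of integer order: recurrences, elementary bounds, Bessel's equation. -/

/-- The Bessel function `J_n` of integer order, by Bessel's integral. -/
noncomputable def besselJ (n : ℤ) (x : ℝ) : ℝ :=
  (2 * Real.pi)⁻¹ * ∫ θ in (-Real.pi)..Real.pi, Real.cos (n * θ - x * Real.sin θ)

theorem abs_besselJ_le_one (n : ℤ) (x : ℝ) : |besselJ n x| ≤ 1 := by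
  have hpi := Real.pi_pos
  have h : ‖∫ θ in (-Real.pi)..Real.pi, Real.cos (n * θ - x * Real.sin θ)‖ ≤
      1 * |Real.pi - (-Real.pi)| :=
    intervalIntegral.norm_integral_le_of_norm_le_const fun θ _ => Real.abs_cos_le_one _
  rw [Real.norm_eq_abs, one_mul, sub_neg_eq_add, ← two_mul, abs_of_pos (by positivity :
    0 < 2 * Real.pi)] at h
  rw [besselJ, abs_mul, abs_of_pos (by positivity : 0 < (2 * Real.pi)⁻¹), inv_mul_le_iff₀
    (by positivity), mul_one]
  exact h

theorem cos_order_sub_one (n : ℤ) (x θ : ℝ) :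
    Real.cos ((n - 1 : ℤ) * θ - x * Real.sin θ) =
      Real.cos (n * θ - x * Real.sin θ) * Real.cos θ +
        Real.sin (n * θ - x * Real.sin θ) * Real.sin θ := by
  rw [← Real.cos_sub]
  congr 1
  push_cast
  ring

theorem cos_order_add_one (n : ℤ) (x θ : ℝ) :
    Real.cos ((n + 1 : ℤ) * θ - x * Real.sin θ) =
      Real.cos (n * θ - x * Real.sin θ) * Real.cos θ -
        Real.sin (n * θ - x * Real.sin θ) * Real.sin θ := by
  rw [← Real.cos_add]
  congr 1
  push_cast
  ring

theorem hasDerivAt_besselJ (n : ℤ) (x : ℝ) :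
    HasDerivAt (besselJ n) ((besselJ (n - 1) x - besselJ (n + 1) x) / 2) x := by
  have hd : HasDerivAt (fun y : ℝ => ∫ θ in (-Real.pi)..Real.pi,
      Real.cos (n * θ - y * Real.sin θ))
      (∫ θ in (-Real.pi)..Real.pi, Real.sin (n * θ - x * Real.sin θ) * Real.sin θ) x := by
    refine (intervalIntegral.hasDerivAt_integral_of_dominated_loc_of_deriv_le
      (F' := fun y θ => Real.sin (n * θ - y * Real.sin θ) * Real.sin θ) (bound := fun _ => 1)
      (s := univ) Filter.univ_mem ?_ ?_ ?_ ?_ ?_ ?_).2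
    · exact Eventually.of_forall fun y => (by fun_prop : Continuous fun θ : ℝ =>
        Real.cos (n * θ - y * Real.sin θ)).aestronglyMeasurable
    · exact (by fun_prop : Continuous fun θ : ℝ =>
        Real.cos (n * θ - x * Real.sin θ)).intervalIntegrable _ _
    · exact (by fun_prop : Continuous fun θ : ℝ =>
        Real.sin (n * θ - x * Real.sin θ) * Real.sin θ).aestronglyMeasurable
    · refine Eventually.of_forall fun θ _ y _ => ?_
      rw [norm_mul]
      exact mul_le_one₀ (Real.abs_sin_le_one _) (norm_nonneg _) (Real.abs_sin_le_one _)
    · exact intervalIntegrable_const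
    · refine Eventually.of_forall fun θ _ y _ => ?_
      have h : HasDerivAt (fun y : ℝ => Real.cos (n * θ - y * Real.sin θ)) _ y :=
        ((hasDerivAt_const y ((n : ℝ) * θ)).sub ((hasDerivAt_id y).mul_const (Real.sin θ))).cos
      exact h.congr_deriv (by simp)
  have h2 : HasDerivAt (besselJ n) _ x := hd.const_mul (2 * Real.pi)⁻¹
  refine h2.congr_deriv (Eq.symm ?_)
  simp only [besselJ]
  rw [← mul_sub, ← intervalIntegral.integral_sub, mul_div_assoc, ← intervalIntegral.integral_div]
  · congr 2
    ext θ
    rw [cos_order_sub_one, cos_order_add_one]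
    ring
  all_goals exact Continuous.intervalIntegrable (by fun_prop) _ _

/-- The integrand in `h0` is the derivative of `sin(nθ - x sin θ)`, which vanishes at both ends of
the period. -/
theorem besselJ_recurrence (n : ℤ) (x : ℝ) :
    2 * n * besselJ n x = x * (besselJ (n - 1) x + besselJ (n + 1) x) := by
  have h0 : ∫ θ in (-Real.pi)..Real.pi,
      Real.cos (n * θ - x * Real.sin θ) * (n - x * Real.cos θ) = 0 := by
    rw [intervalIntegral.integral_eq_sub_of_hasDerivAt
      (f := fun θ => Real.sin (n * θ - x * Real.sin θ))]
    · simp [Real.sin_int_mul_pi]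
    · intro θ _
      have h := (((hasDerivAt_id θ).const_mul (n : ℝ)).sub
        ((Real.hasDerivAt_sin θ).const_mul x)).sin
      simpa using h
    · exact Continuous.intervalIntegrable (by fun_prop) _ _
  simp only [besselJ]
  rw [← mul_add, ← intervalIntegral.integral_add]
  · rw [← sub_eq_zero, show 2 * (n : ℝ) * ((2 * Real.pi)⁻¹ * ∫ θ in (-Real.pi)..Real.pi,
      Real.cos (n * θ - x * Real.sin θ)) - x * ((2 * Real.pi)⁻¹ * ∫ θ in (-Real.pi)..Real.pi,
      (Real.cos ((n - 1 : ℤ) * θ - x * Real.sin θ) + Real.cos ((n + 1 : ℤ) * θ - x * Real.sin θ))) =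
      (2 * Real.pi)⁻¹ * (2 * n * (∫ θ in (-Real.pi)..Real.pi, Real.cos (n * θ - x * Real.sin θ)) -
        x * ∫ θ in (-Real.pi)..Real.pi,
      (Real.cos ((n - 1 : ℤ) * θ - x * Real.sin θ) + Real.cos ((n + 1 : ℤ) * θ - x * Real.sin θ)))
      by ring, ← intervalIntegral.integral_const_mul, ← intervalIntegral.integral_const_mul,
      ← intervalIntegral.integral_sub]
    · convert mul_zero _ using 2
      rw [← mul_zero (2 : ℝ), ← h0, ← intervalIntegral.integral_const_mul]
      congr 1
      ext θ
      rw [cos_order_sub_one, cos_order_add_one]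
      ring
    all_goals exact Continuous.intervalIntegrable (by fun_prop) _ _
  all_goals exact Continuous.intervalIntegrable (by fun_prop) _ _

theorem continuous_besselJ (n : ℤ) : Continuous (besselJ n) :=
  continuous_iff_continuousAt.2 fun x => (hasDerivAt_besselJ n x).continuousAt

theorem besselJ_zero_right (n : ℤ) : besselJ n 0 = if n = 0 then 1 else 0 := by
  have hpi := Real.pi_pos
  split_ifs with h
  · subst h
    simp [besselJ]
    field_simp
    ring
  · have h' : (n : ℝ) ≠ 0 := by exact_mod_cast h
    simp only [besselJ, zero_mul, sub_zero]
    rw [intervalIntegral.integral_comp_mul_left (fun t => Real.cos t) h', integral_cos]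
    simp [Real.sin_int_mul_pi]

/-- Reflection of the order. -/
theorem besselJ_neg (n : ℤ) (x : ℝ) : besselJ (-n) x = (-1) ^ n * besselJ n x := by
  simp only [besselJ]
  have h1 : ∫ θ in (-Real.pi)..Real.pi, Real.cos ((-n : ℤ) * θ - x * Real.sin θ) =
      ∫ θ in (-Real.pi)..Real.pi, (-1) ^ n * Real.cos (n * θ - x * Real.sin θ) := by
    have hper : Function.Periodic
        (fun θ : ℝ => (-1 : ℝ) ^ n * Real.cos (n * θ - x * Real.sin θ)) (2 * Real.pi) := by
      intro θ
      simp only [Real.sin_add_two_pi]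
      rw [show (n : ℝ) * (θ + 2 * Real.pi) - x * Real.sin θ =
        (n * θ - x * Real.sin θ) + n * (2 * Real.pi) by ring, Real.cos_add_int_mul_two_pi]
    -- Moving the period by `π` reverses the sign of `sin θ` and produces the factor `(-1)^n`.
    have h2 := hper.intervalIntegral_add_eq (-Real.pi) (-Real.pi + Real.pi)
    rw [show -Real.pi + 2 * Real.pi = Real.pi by ring,
      show -Real.pi + Real.pi + 2 * Real.pi = Real.pi + Real.pi by ring] at h2
    rw [h2, ← intervalIntegral.integral_comp_add_right]
    congr 1
    ext θ
    rw [Real.sin_add_pi, show (n : ℝ) * (θ + Real.pi) - x * -Real.sin θ =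
      (n * θ + x * Real.sin θ) + n * Real.pi by ring, Real.cos_add_int_mul_pi, ← mul_assoc,
      ← mul_zpow, neg_one_mul, neg_neg, one_zpow, one_mul, ← Real.cos_neg]
    congr 1
    push_cast
    ring
  rw [h1, intervalIntegral.integral_const_mul]
  ring

theorem abs_besselJ_neg (n : ℤ) (x : ℝ) : |besselJ (-n) x| = |besselJ n x| := by
  rw [besselJ_neg, abs_mul, abs_zpow, abs_neg, abs_one, one_zpow, one_mul]

theorem abs_besselJ_natAbs (n : ℤ) (x : ℝ) : |besselJ (n.natAbs : ℤ) x| = |besselJ n x| := by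
  rcases Int.natAbs_eq n with h | h
  · rw [← h]
  · nth_rewrite 2 [h]
    rw [abs_besselJ_neg]

theorem integral_cos_two_mul_int {n : ℤ} (hn : n ≠ 0) :
    ∫ θ in (-Real.pi)..Real.pi, Real.cos (2 * (n * θ)) = 0 := by
  have h' : (2 * n : ℝ) ≠ 0 := by
    have : (n : ℝ) ≠ 0 := by exact_mod_cast hn
    simpa using this
  simp only [← mul_assoc]
  rw [intervalIntegral.integral_comp_mul_left (fun t => Real.cos t) h', integral_cos]
  have : Real.sin (2 * n * Real.pi) = 0 := by
    have := Real.sin_int_mul_pi (2 * n)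
    push_cast at this
    exact this
  simp [this]

/-- Bessel's inequality for the unimodular function `e^{ix sin θ}`: its Fourier coefficients at `n`
and `-n` are distinct and have the same modulus. The integrand of `hpos` is the squared distance to
the projection `J(e^{inθ} + ε e^{-inθ})`. -/
theorem two_mul_besselJ_sq_le_one {n : ℤ} (hn : n ≠ 0) (x : ℝ) : 2 * besselJ n x ^ 2 ≤ 1 := by
  have hpi := Real.pi_pos
  set ε : ℝ := (-1) ^ n with hε
  have hε2 : ε * ε = 1 := by rw [hε, ← mul_zpow]; simp
  set J := besselJ n x with hJ
  have hJi (m : ℤ) : ∫ θ in (-Real.pi)..Real.pi, Real.cos (m * θ - x * Real.sin θ) =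
      2 * Real.pi * besselJ m x := by
    rw [besselJ]
    field_simp
  have hpos : 0 ≤ ∫ θ in (-Real.pi)..Real.pi,
      ((Real.cos (x * Real.sin θ) - J * (1 + ε) * Real.cos (n * θ)) ^ 2 +
        (Real.sin (x * Real.sin θ) - J * (1 - ε) * Real.sin (n * θ)) ^ 2) :=
    intervalIntegral.integral_nonneg (by linarith) fun θ _ => by positivity
  have hexp (θ : ℝ) : (Real.cos (x * Real.sin θ) - J * (1 + ε) * Real.cos (n * θ)) ^ 2 +
        (Real.sin (x * Real.sin θ) - J * (1 - ε) * Real.sin (n * θ)) ^ 2 =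
      (1 + 2 * J ^ 2) + 2 * J ^ 2 * ε * Real.cos (2 * (n * θ)) -
        2 * J * Real.cos (n * θ - x * Real.sin θ) -
        2 * J * ε * Real.cos ((-n : ℤ) * θ - x * Real.sin θ) := by
    rw [show ((-n : ℤ) : ℝ) * θ - x * Real.sin θ = -(n * θ + x * Real.sin θ) by push_cast; ring,
      Real.cos_neg, Real.cos_sub, Real.cos_add, Real.cos_two_mul]
    have h1 := Real.sin_sq_add_cos_sq (x * Real.sin θ)
    have h2 := Real.sin_sq_add_cos_sq (n * θ)
    linear_combination h1 + J ^ 2 * (1 - ε) ^ 2 * h2 + J ^ 2 * hε2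
  simp only [hexp] at hpos
  rw [intervalIntegral.integral_sub, intervalIntegral.integral_sub, intervalIntegral.integral_add,
    intervalIntegral.integral_const_mul, intervalIntegral.integral_const_mul,
    intervalIntegral.integral_const_mul, integral_cos_two_mul_int hn, hJi, hJi, besselJ_neg,
    ← hJ, ← hε, intervalIntegral.integral_const, smul_eq_mul] at hpos
  · have : (Real.pi - -Real.pi) * (1 + 2 * J ^ 2) + 2 * J ^ 2 * ε * 0 -
      2 * J * (2 * Real.pi * J) - 2 * J * ε * (2 * Real.pi * (ε * J)) =
      2 * Real.pi * (1 - 2 * J ^ 2) := by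
      linear_combination - 4 * Real.pi * J ^ 2 * hε2
    rw [this] at hpos
    have := nonneg_of_mul_nonneg_right hpos (by positivity)
    linarith
  all_goals exact Continuous.intervalIntegrable (by fun_prop) _ _

/-- The derivative in terms of one neighbour. -/
theorem mul_deriv_besselJ (n : ℤ) (x : ℝ) :
    x * ((besselJ (n - 1) x - besselJ (n + 1) x) / 2) = n * besselJ n x - x * besselJ (n + 1) x := by
  linear_combination (-1 / 2) * besselJ_recurrence n x

/-- The function `x J_n'(x)`. -/
noncomputable def besselP (n : ℤ) (x : ℝ) : ℝ := n * besselJ n x - x * besselJ (n + 1) x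

theorem hasDerivAt_besselJ_of_ne (n : ℤ) {x : ℝ} (hx : x ≠ 0) :
    HasDerivAt (besselJ n) (besselP n x / x) x := by
  convert hasDerivAt_besselJ n x using 1
  rw [besselP, ← mul_deriv_besselJ]
  field_simp

/-- Bessel's equation `(x d/dx)² J = (n² - x²) J`. -/
theorem hasDerivAt_besselP (n : ℤ) {x : ℝ} (hx : x ≠ 0) :
    HasDerivAt (besselP n) ((n ^ 2 - x ^ 2) * besselJ n x / x) x := by
  have h1 := (hasDerivAt_besselJ_of_ne n hx).const_mul (n : ℝ)
  have h2 := (hasDerivAt_id x).mul (hasDerivAt_besselJ_of_ne (n + 1) hx)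
  have h : HasDerivAt (besselP n) _ x := h1.sub h2
  refine h.congr_deriv (Eq.symm ?_)
  have h3 := besselJ_recurrence (n + 1) x
  rw [add_sub_cancel_right] at h3
  push_cast at h3
  simp only [besselP, id]
  push_cast
  field_simp
  linear_combination x * h3

theorem continuous_besselP (n : ℤ) : Continuous (besselP n) := by
  have := continuous_besselJ n
  have := continuous_besselJ (n + 1)
  unfold besselP
  fun_prop

/-! ### The square integral of `J₁(x)/x`, via Poisson kernels. -/

/-- The entire function `J₁(x) / x`, by Poisson's integral. -/
noncomputable def besselPoisson (x : ℝ) : ℝ :=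
  Real.pi⁻¹ * ∫ θ in (-(Real.pi / 2))..(Real.pi / 2), Real.cos θ ^ 2 * Real.cos (x * Real.sin θ)

/-- The recurrence reads `2 J₁ = x (J₀ + J₂)`, and folding the period by `θ ↦ π - θ` turns `J₀ + J₂`
into twice Poisson's integral. -/
theorem besselJ_one_eq (x : ℝ) : besselJ 1 x = x * besselPoisson x := by
  have hpi := Real.pi_pos
  have hrec := besselJ_recurrence 1 x
  have hsum : besselJ (1 - 1) x + besselJ (1 + 1) x = 2 * besselPoisson x := by
    set h : ℝ → ℝ := fun θ => Real.cos (θ - x * Real.sin θ) * Real.cos θ with hh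
    have hper : Function.Periodic h (2 * Real.pi) := by
      intro θ
      simp only [hh, Real.sin_add_two_pi, Real.cos_add_two_pi]
      rw [show θ + 2 * Real.pi - x * Real.sin θ = (θ - x * Real.sin θ) + 2 * Real.pi by ring,
        Real.cos_add_two_pi]
    have hc : Continuous h := by fun_prop
    have e1 : ∫ θ in (-Real.pi)..Real.pi, h θ =
        ∫ θ in (-(Real.pi / 2))..(Real.pi / 2), (h θ + h (Real.pi - θ)) := by
      have h2 := hper.intervalIntegral_add_eq (-Real.pi) (-(Real.pi / 2))
      rw [show -Real.pi + 2 * Real.pi = Real.pi by ring] at h2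
      rw [h2, intervalIntegral.integral_add (hc.intervalIntegrable _ _)
        (Continuous.intervalIntegrable (by fun_prop) _ _),
        intervalIntegral.integral_comp_sub_left h, show Real.pi - Real.pi / 2 = Real.pi / 2 by ring,
        show Real.pi - -(Real.pi / 2) = -(Real.pi / 2) + 2 * Real.pi by ring,
        intervalIntegral.integral_add_adjacent_intervals (hc.intervalIntegrable _ _)
          (hc.intervalIntegrable _ _)]
    have e2 (θ : ℝ) : h θ + h (Real.pi - θ) =
        2 * (Real.cos θ ^ 2 * Real.cos (x * Real.sin θ)) := by
      simp only [hh, Real.sin_pi_sub, Real.cos_pi_sub]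
      rw [show Real.pi - θ - x * Real.sin θ = Real.pi - (θ + x * Real.sin θ) by ring,
        Real.cos_pi_sub, Real.cos_add, Real.cos_sub]
      ring
    simp only [e2, intervalIntegral.integral_const_mul] at e1
    simp only [besselJ]
    rw [← mul_add, ← intervalIntegral.integral_add]
    · have e3 (θ : ℝ) : Real.cos ((1 - 1 : ℤ) * θ - x * Real.sin θ) +
          Real.cos ((1 + 1 : ℤ) * θ - x * Real.sin θ) = 2 * h θ := by
        rw [cos_order_sub_one, cos_order_add_one]
        simp only [hh]
        push_cast
        rw [one_mul]
        ring
      simp only [e3, intervalIntegral.integral_const_mul]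
      rw [e1, besselPoisson]
      field_simp
    all_goals exact Continuous.intervalIntegrable (by fun_prop) _ _
  rw [hsum] at hrec
  push_cast at hrec
  linarith

theorem continuous_besselPoisson : Continuous besselPoisson := by
  unfold besselPoisson
  refine continuous_const.mul ?_
  exact intervalIntegral.continuous_parametric_intervalIntegral_of_continuous' (by fun_prop) _ _

/-- The Poisson kernel. -/
noncomputable def poissonKer (ε u : ℝ) : ℝ := ε / (ε ^ 2 + u ^ 2)

theorem poissonKer_neg (ε u : ℝ) : poissonKer ε (-u) = poissonKer ε u := by
  simp [poissonKer]

theorem continuous_poissonKer {ε : ℝ} (hε : 0 < ε) : Continuous (poissonKer ε) := by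
  unfold poissonKer
  exact continuous_const.div (by fun_prop) fun u => by positivity

theorem poissonKer_nonneg {ε : ℝ} (hε : 0 < ε) (u : ℝ) : 0 ≤ poissonKer ε u := by
  unfold poissonKer
  positivity

theorem integral_exp_neg_mul_cos {ε : ℝ} (hε : 0 < ε) (u : ℝ) :
    ∫ x in Ioi (0 : ℝ), Real.exp (-ε * x) * Real.cos (x * u) = poissonKer ε u := by
  have ha : ((-ε : ℂ) + u * Complex.I).re < 0 := by simpa using hε
  have h1 := integral_exp_mul_complex_Ioi ha 0
  have h2 := integral_re (integrableOn_exp_mul_complex_Ioi ha 0)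
  rw [h1] at h2
  have h3 (x : ℝ) : RCLike.re (Complex.exp (((-ε : ℂ) + u * Complex.I) * x)) =
      Real.exp (-ε * x) * Real.cos (x * u) := by
    change (Complex.exp _).re = _
    rw [Complex.exp_re]
    simp [mul_comm]
  simp only [h3] at h2
  rw [h2]
  change (-Complex.exp _ / _ : ℂ).re = _
  simp [Complex.div_re, Complex.normSq_apply, poissonKer]
  ring

/-- The factor `cos θ` makes the integrand an exact derivative, of `arctan((sin θ + s)/ε)`, so the
bound depends on neither `ε` nor `s`. -/
theorem integral_cos_mul_poissonKer_le {ε : ℝ} (hε : 0 < ε) (s : ℝ) :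
    ∫ θ in (-(Real.pi / 2))..(Real.pi / 2), Real.cos θ * poissonKer ε (Real.sin θ + s) ≤
      Real.pi := by
  rw [intervalIntegral.integral_eq_sub_of_hasDerivAt
    (f := fun θ => Real.arctan ((Real.sin θ + s) / ε))]
  · have h1 := Real.arctan_lt_pi_div_two ((Real.sin (Real.pi / 2) + s) / ε)
    have h2 := Real.neg_pi_div_two_lt_arctan ((Real.sin (-(Real.pi / 2)) + s) / ε)
    linarith
  · intro θ _
    have h := (((Real.hasDerivAt_sin θ).add_const s).div_const ε).arctan
    refine h.congr_deriv ?_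
    unfold poissonKer
    field_simp
  · have := continuous_poissonKer hε
    exact Continuous.intervalIntegrable (by fun_prop) _ _

/-- The quadratic form of the symmetrised Poisson kernel, on the density of Poisson's integral. -/
theorem integral_poissonKer_le {ε : ℝ} (hε : 0 < ε) :
    ∫ z, Real.cos z.1 ^ 2 * Real.cos z.2 ^ 2 *
      (poissonKer ε (Real.sin z.1 - Real.sin z.2) + poissonKer ε (Real.sin z.1 + Real.sin z.2))
      ∂((volume.restrict (Ioc (-(Real.pi / 2)) (Real.pi / 2))).prod
        (volume.restrict (Ioc (-(Real.pi / 2)) (Real.pi / 2)))) ≤ 8 * Real.pi / 3 := by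
  have hpi := Real.pi_pos
  set μ : Measure ℝ := volume.restrict (Ioc (-(Real.pi / 2)) (Real.pi / 2)) with hμ
  have hk := continuous_poissonKer hε
  set κ : ℝ × ℝ → ℝ := fun z => poissonKer ε (Real.sin z.1 - Real.sin z.2) +
    poissonKer ε (Real.sin z.1 + Real.sin z.2) with hκ
  have hκc : Continuous κ := by fun_prop
  have hκ0 (z) : 0 ≤ κ z := add_nonneg (poissonKer_nonneg hε _) (poissonKer_nonneg hε _)
  have hκs (z) : κ z.swap = κ z := by
    simp only [hκ, Prod.fst_swap, Prod.snd_swap]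
    rw [← poissonKer_neg, neg_sub, add_comm (Real.sin z.2)]
  have hmeas : μ.prod μ = (volume : Measure (ℝ × ℝ)).restrict
      (Ioc (-(Real.pi / 2)) (Real.pi / 2) ×ˢ Ioc (-(Real.pi / 2)) (Real.pi / 2)) := by
    rw [hμ, Measure.prod_restrict, Measure.volume_eq_prod]
  have hint (g : ℝ × ℝ → ℝ) (hg : Continuous g) : Integrable g (μ.prod μ) := by
    rw [hmeas]
    refine IntegrableOn.mono_set (t := Icc (-(Real.pi / 2)) (Real.pi / 2) ×ˢ
      Icc (-(Real.pi / 2)) (Real.pi / 2)) ?_ (prod_mono Ioc_subset_Icc_self Ioc_subset_Icc_self)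
    exact hg.continuousOn.integrableOn_compact (isCompact_Icc.prod isCompact_Icc)
  have hcos : ∀ᵐ z ∂(μ.prod μ), 0 ≤ Real.cos z.1 ∧ 0 ≤ Real.cos z.2 := by
    rw [hmeas]
    refine (ae_restrict_iff' (measurableSet_Ioc.prod measurableSet_Ioc)).2 (.of_forall ?_)
    rintro ⟨a, b⟩ ⟨ha, hb⟩
    exact ⟨Real.cos_nonneg_of_mem_Icc (Ioc_subset_Icc_self ha),
      Real.cos_nonneg_of_mem_Icc (Ioc_subset_Icc_self hb)⟩
  -- A single cosine in `z.2` permits exact integration: two kernels give `2π`, and `∫ cos³ = 4/3`.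
  have hone : ∫ z, Real.cos z.1 ^ 3 * Real.cos z.2 * κ z ∂(μ.prod μ) ≤ 8 * Real.pi / 3 := by
    rw [integral_prod _ (hint _ (by fun_prop))]
    have hin (a : ℝ) : ∫ b, Real.cos a ^ 3 * Real.cos b * κ (a, b) ∂μ =
        Real.cos a ^ 3 * ∫ b, Real.cos b * κ (a, b) ∂μ := by
      rw [← integral_const_mul]
      simp only [mul_assoc]
    have hin2 (a : ℝ) : ∫ b, Real.cos b * κ (a, b) ∂μ ≤ 2 * Real.pi := by
      have e (b : ℝ) : Real.cos b * κ (a, b) = Real.cos b * poissonKer ε (Real.sin b + - Real.sin a)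
          + Real.cos b * poissonKer ε (Real.sin b + Real.sin a) := by
        simp only [hκ]
        rw [← poissonKer_neg ε (Real.sin a - Real.sin b), neg_sub, mul_add,
          add_comm (Real.sin a), sub_eq_add_neg]
      have h := add_le_add (integral_cos_mul_poissonKer_le hε (-Real.sin a))
        (integral_cos_mul_poissonKer_le hε (Real.sin a))
      rw [← intervalIntegral.integral_add] at h
      · rw [intervalIntegral.integral_of_le (by linarith)] at h
        simp only [e]
        linarith
      all_goals exact Continuous.intervalIntegrable (by fun_prop) _ _
    simp only [hin]
    have hcub : ∫ a, Real.cos a ^ 3 * (2 * Real.pi) ∂μ = 8 * Real.pi / 3 := by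
      rw [integral_mul_const, hμ, ← intervalIntegral.integral_of_le (by linarith),
        integral_cos_pow_three]
      simp
      ring
    rw [← hcub]
    refine integral_mono_ae ?_ ?_ ?_
    · have := (hint (fun z => Real.cos z.1 ^ 3 * Real.cos z.2 * κ z) (by fun_prop)).integral_prod_left
      simpa only [hin] using this
    · exact (Continuous.integrableOn_Ioc (by fun_prop))
    · refine (ae_restrict_iff' measurableSet_Ioc).2 (.of_forall fun a ha => ?_)
      have := Real.cos_nonneg_of_mem_Icc (Ioc_subset_Icc_self ha)
      exact mul_le_mul_of_nonneg_left (hin2 a) (by positivity)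
  have htwo : ∫ z, Real.cos z.2 ^ 3 * Real.cos z.1 * κ z ∂(μ.prod μ) ≤ 8 * Real.pi / 3 := by
    rw [← integral_prod_swap] at hone
    simpa only [hκs, Prod.fst_swap, Prod.snd_swap] using hone
  calc ∫ z, Real.cos z.1 ^ 2 * Real.cos z.2 ^ 2 * κ z ∂(μ.prod μ)
      ≤ ∫ z, (1 / 2 : ℝ) * (Real.cos z.1 ^ 3 * Real.cos z.2 * κ z +
          Real.cos z.2 ^ 3 * Real.cos z.1 * κ z) ∂(μ.prod μ) := by
        refine integral_mono_ae (hint _ (by fun_prop)) (hint _ (by fun_prop)) ?_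
        filter_upwards [hcos] with z hz
        have h1 : 0 ≤ Real.cos z.1 * Real.cos z.2 * κ z :=
          mul_nonneg (mul_nonneg hz.1 hz.2) (hκ0 z)
        -- With both cosines nonnegative, `a²b² ≤ (a³b + b³a)/2`.
        nlinarith [mul_nonneg h1 (sq_nonneg (Real.cos z.1 - Real.cos z.2))]
    _ ≤ 8 * Real.pi / 3 := by
        rw [integral_const_mul, integral_add (hint _ (by fun_prop)) (hint _ (by fun_prop))]
        linarith

/-- The damping makes Fubini's theorem applicable. Integrating in `x` first, the product of the two
cosines splits into a sum and a difference frequency, each yielding a Poisson kernel. -/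
theorem integral_exp_mul_besselPoisson_sq_le {ε : ℝ} (hε : 0 < ε) :
    IntegrableOn (fun x => Real.exp (-ε * x) * besselPoisson x ^ 2) (Ioi 0) ∧
    ∫ x in Ioi (0 : ℝ), Real.exp (-ε * x) * besselPoisson x ^ 2 ≤ 4 / (3 * Real.pi) := by
  have hpi := Real.pi_pos
  set μ : Measure ℝ := volume.restrict (Ioc (-(Real.pi / 2)) (Real.pi / 2)) with hμ
  set ρ : Measure ℝ := volume.restrict (Ioi (0 : ℝ)) with hρ
  have hF (x : ℝ) : besselPoisson x ^ 2 = (Real.pi ^ 2)⁻¹ *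
      ∫ z, (Real.cos z.1 ^ 2 * Real.cos (x * Real.sin z.1)) *
        (Real.cos z.2 ^ 2 * Real.cos (x * Real.sin z.2)) ∂(μ.prod μ) := by
    rw [integral_prod_mul (fun a => Real.cos a ^ 2 * Real.cos (x * Real.sin a))
      (fun a => Real.cos a ^ 2 * Real.cos (x * Real.sin a)), besselPoisson,
      intervalIntegral.integral_of_le (by linarith)]
    ring
  set Φ : ℝ → ℝ × ℝ → ℝ := fun x z => Real.exp (-ε * x) *
    ((Real.cos z.1 ^ 2 * Real.cos (x * Real.sin z.1)) *
        (Real.cos z.2 ^ 2 * Real.cos (x * Real.sin z.2))) with hΦ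
  have hexp : Integrable (fun x => Real.exp (-ε * x)) ρ :=
    integrableOn_exp_mul_Ioi (by linarith) 0
  have hint : Integrable (Function.uncurry Φ) (ρ.prod (μ.prod μ)) := by
    refine Integrable.mono' (hexp.mul_prod (integrable_const (1 : ℝ)))
      (Continuous.aestronglyMeasurable (by fun_prop)) (.of_forall ?_)
    rintro ⟨x, a, b⟩
    simp only [hΦ, Function.uncurry_apply_pair]
    rw [Real.norm_eq_abs, abs_mul, Real.abs_exp]
    refine mul_le_mul_of_nonneg_left ?_ (Real.exp_pos _).le
    have h (a : ℝ) : |Real.cos a ^ 2 * Real.cos (x * Real.sin a)| ≤ 1 := by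
      rw [abs_mul, abs_pow]
      exact mul_le_one₀ (pow_le_one₀ (abs_nonneg _) (Real.abs_cos_le_one _)) (abs_nonneg _)
        (Real.abs_cos_le_one _)
    rw [abs_mul]
    exact mul_le_one₀ (h a) (abs_nonneg _) (h b)
  have hFe (x : ℝ) : Real.exp (-ε * x) * besselPoisson x ^ 2 =
      (Real.pi ^ 2)⁻¹ * ∫ z, Φ x z ∂(μ.prod μ) := by
    rw [hF, hΦ, integral_const_mul]
    ring
  simp only [hFe]
  refine ⟨hint.integral_prod_left.const_mul _, ?_⟩
  rw [integral_const_mul, integral_integral_swap hint]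
  have hz (z : ℝ × ℝ) : ∫ x, Φ x z ∂ρ = 1 / 2 * (Real.cos z.1 ^ 2 * Real.cos z.2 ^ 2 *
      (poissonKer ε (Real.sin z.1 - Real.sin z.2) +
        poissonKer ε (Real.sin z.1 + Real.sin z.2))) := by
    have hi (u : ℝ) : Integrable (fun x => Real.exp (-ε * x) * Real.cos (x * u)) ρ := by
      refine hexp.mono' (Continuous.aestronglyMeasurable (by fun_prop)) (.of_forall fun x => ?_)
      rw [Real.norm_eq_abs, abs_mul, Real.abs_exp]
      exact mul_le_of_le_one_right (Real.exp_pos _).le (Real.abs_cos_le_one _)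
    rw [← integral_exp_neg_mul_cos hε, ← integral_exp_neg_mul_cos hε, ← integral_add (hi _) (hi _),
      ← integral_const_mul, ← integral_const_mul]
    congr 1
    ext x
    simp only [hΦ]
    rw [mul_sub x, mul_add x, Real.cos_sub, Real.cos_add]
    ring
  simp only [hz]
  rw [integral_const_mul]
  have h := integral_poissonKer_le hε
  calc (Real.pi ^ 2)⁻¹ * (1 / 2 * ∫ z, Real.cos z.1 ^ 2 * Real.cos z.2 ^ 2 *
      (poissonKer ε (Real.sin z.1 - Real.sin z.2) +
        poissonKer ε (Real.sin z.1 + Real.sin z.2)) ∂(μ.prod μ))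
      ≤ (Real.pi ^ 2)⁻¹ * (1 / 2 * (8 * Real.pi / 3)) := by gcongr
    _ = 4 / (3 * Real.pi) := by
      field_simp
      ring

/-- The damping is removed by letting `ε → 0` on a bounded interval. The constant is the value of
the integral over the half-line, so the later limit `2/π` is sharp. -/
theorem integral_besselPoisson_sq_le {X : ℝ} (hX : 0 ≤ X) :
    ∫ x in (0 : ℝ)..X, besselPoisson x ^ 2 ≤ 4 / (3 * Real.pi) := by
  have hpi := Real.pi_pos
  have hc := continuous_besselPoisson
  have key (ε : ℝ) (hε : 0 < ε) : ∫ x in (0 : ℝ)..X, besselPoisson x ^ 2 ≤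
      Real.exp (ε * X) * (4 / (3 * Real.pi)) := by
    obtain ⟨h1, h2⟩ := integral_exp_mul_besselPoisson_sq_le hε
    calc ∫ x in (0 : ℝ)..X, besselPoisson x ^ 2
        ≤ ∫ x in (0 : ℝ)..X, Real.exp (ε * X) * (Real.exp (-ε * x) * besselPoisson x ^ 2) := by
          refine intervalIntegral.integral_mono_on hX
            (Continuous.intervalIntegrable (by fun_prop) _ _)
            (Continuous.intervalIntegrable (by fun_prop) _ _) fun x hx => ?_
          rw [← mul_assoc, ← Real.exp_add]
          refine le_mul_of_one_le_left (sq_nonneg _) (Real.one_le_exp ?_)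
          nlinarith [hx.2]
      _ = Real.exp (ε * X) * ∫ x in Ioc 0 X, Real.exp (-ε * x) * besselPoisson x ^ 2 := by
          rw [intervalIntegral.integral_const_mul, intervalIntegral.integral_of_le hX]
      _ ≤ Real.exp (ε * X) * ∫ x in Ioi (0 : ℝ), Real.exp (-ε * x) * besselPoisson x ^ 2 := by
          refine mul_le_mul_of_nonneg_left ?_ (Real.exp_pos _).le
          exact setIntegral_mono_set h1 (.of_forall fun x => by positivity)
            (Ioc_subset_Ioi_self).eventuallyLE
      _ ≤ _ := by gcongr
  have hlim : Tendsto (fun ε : ℝ => Real.exp (ε * X) * (4 / (3 * Real.pi))) (𝓝[>] 0)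
      (𝓝 (4 / (3 * Real.pi))) := by
    have : Continuous fun ε : ℝ => Real.exp (ε * X) * (4 / (3 * Real.pi)) := by fun_prop
    have := this.tendsto 0
    simp only [zero_mul, Real.exp_zero, one_mul] at this
    exact this.mono_left nhdsWithin_le_nhds
  exact ge_of_tendsto hlim (by filter_upwards [self_mem_nhdsWithin] with ε hε using key ε hε)

/-! ### The energy of `√x J_n` and the asymptotic size of `J_n`. -/

/-- The energy of `√x J_n(x)`, as a solution of `w'' + (1 - (n² - 1/4) / x²) w = 0`. -/
noncomputable def besselEnergy (n : ℤ) (x : ℝ) : ℝ :=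
  ((x ^ 2 - n ^ 2 + 1 / 2) * besselJ n x ^ 2 + besselJ n x * besselP n x + besselP n x ^ 2) / x

/-- For `n ≠ 0` the derivative is nonnegative, so the energy is nondecreasing and its growth
measures `∫ (J_n/x)²`. -/
theorem hasDerivAt_besselEnergy (n : ℤ) {x : ℝ} (hx : x ≠ 0) :
    HasDerivAt (besselEnergy n) ((2 * n ^ 2 - 1 / 2) * (besselJ n x / x) ^ 2) x := by
  have hJ := hasDerivAt_besselJ_of_ne n hx
  have hP := hasDerivAt_besselP n hx
  have h1 := (((((hasDerivAt_id x).pow 2).sub_const ((n : ℝ) ^ 2)).add_const (1 / 2)).mul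
    (hJ.pow 2)).add (hJ.mul hP)
  have h : HasDerivAt (besselEnergy n) _ x := (h1.add (hP.pow 2)).div (hasDerivAt_id x) hx
  refine h.congr_deriv ?_
  simp
  field_simp
  ring

theorem besselEnergy_sub {n : ℤ} {a b : ℝ} (ha : 0 < a) (hab : a ≤ b) :
    ∫ x in a..b, (2 * n ^ 2 - 1 / 2) * (besselJ n x / x) ^ 2 =
      besselEnergy n b - besselEnergy n a := by
  refine intervalIntegral.integral_eq_sub_of_hasDerivAt (fun x hx => ?_) ?_
  · rw [uIcc_of_le hab] at hx
    exact hasDerivAt_besselEnergy n (by linarith [hx.1])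
  · refine ContinuousOn.intervalIntegrable fun x hx => ?_
    rw [uIcc_of_le hab] at hx
    have hx0 : x ≠ 0 := by linarith [hx.1]
    have := (continuous_besselJ n).continuousAt (x := x)
    exact ContinuousAt.continuousWithinAt (by fun_prop (disch := exact hx0))

/-- For `n ≠ 0` the recurrence writes `J_n` as `x` times a continuous function, and the energy
becomes `x` times a continuous function. -/
theorem tendsto_besselEnergy_zero {n : ℤ} (hn : n ≠ 0) :
    Tendsto (besselEnergy n) (𝓝[>] 0) (𝓝 0) := by
  have hn' : (n : ℝ) ≠ 0 := by exact_mod_cast hn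
  set j : ℝ → ℝ := fun x => (besselJ (n - 1) x + besselJ (n + 1) x) / (2 * n) with hj
  set r : ℝ → ℝ := fun x => (besselJ (n - 1) x - besselJ (n + 1) x) / 2 with hr
  have hcont : Continuous fun x : ℝ =>
      x * ((x ^ 2 - n ^ 2 + 1 / 2) * j x ^ 2 + j x * r x + r x ^ 2) := by
    have := continuous_besselJ (n - 1)
    have := continuous_besselJ (n + 1)
    fun_prop
  have h0 := hcont.tendsto 0
  rw [zero_mul] at h0
  refine (h0.mono_left nhdsWithin_le_nhds).congr' ?_
  filter_upwards [self_mem_nhdsWithin] with x hx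
  have hx0 : x ≠ 0 := ne_of_gt hx
  have h1 : besselJ n x = x * j x := by
    have := besselJ_recurrence n x
    simp only [hj]
    field_simp
    linarith
  have h2 : besselP n x = x * r x := by
    rw [besselP, ← mul_deriv_besselJ]
  rw [besselEnergy, h1, h2]
  field_simp

/-- Starting from `0` at the origin, the energy gains at most `3/2 · 4/(3π)`. -/
theorem besselEnergy_one_le {X : ℝ} (hX : 0 < X) : besselEnergy 1 X ≤ 2 / Real.pi := by
  have hpi := Real.pi_pos
  have hc := continuous_besselPoisson
  have key : ∀ a ∈ Ioc 0 X, besselEnergy 1 X ≤ 2 / Real.pi + besselEnergy 1 a := by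
    intro a ha
    have h1 := besselEnergy_sub (n := 1) ha.1 ha.2
    have h2 : ∫ x in a..X, (2 * ((1 : ℤ) : ℝ) ^ 2 - 1 / 2) * (besselJ 1 x / x) ^ 2 =
        3 / 2 * ∫ x in a..X, besselPoisson x ^ 2 := by
      rw [← intervalIntegral.integral_const_mul]
      refine intervalIntegral.integral_congr fun x hx => ?_
      rw [uIcc_of_le ha.2] at hx
      have hx0 : x ≠ 0 := by linarith [hx.1, ha.1]
      simp only [besselJ_one_eq]
      field_simp
      norm_num
      ring
    have h3 : ∫ x in a..X, besselPoisson x ^ 2 ≤ ∫ x in (0 : ℝ)..X, besselPoisson x ^ 2 := by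
      refine intervalIntegral.integral_mono_interval ha.1.le ha.2 le_rfl
        (.of_forall fun x => sq_nonneg _) (Continuous.intervalIntegrable (by fun_prop) _ _)
    have h4 := integral_besselPoisson_sq_le hX.le
    have h5 : 3 / 2 * (4 / (3 * Real.pi)) = 2 / Real.pi := by
      field_simp
      norm_num
    rw [h2] at h1
    linarith
  have hlim := (tendsto_besselEnergy_zero one_ne_zero).const_add (2 / Real.pi)
  rw [add_zero] at hlim
  refine ge_of_tendsto hlim ?_
  filter_upwards [Ioc_mem_nhdsGT hX] with a ha using key a ha

/-- Monotonicity and the limit `0` at the origin give the sign; dropping the energy at `a` then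
turns the energy at `X` into an `L²` bound on `[a, X]`. -/
theorem besselEnergy_nonneg {n : ℤ} (hn : n ≠ 0) {X : ℝ} (hX : 0 < X) :
    0 ≤ besselEnergy n X ∧ ∀ a ∈ Ioc 0 X, ∫ x in a..X, (besselJ n x / x) ^ 2 ≤
      besselEnergy n X / (2 * n ^ 2 - 1 / 2) := by
  have hn2 : (1 : ℝ) ≤ (n : ℝ) ^ 2 := by
    have : (1 : ℤ) ≤ n ^ 2 := by
      have : 0 < n ^ 2 := by positivity
      omega
    exact_mod_cast this
  have hmono : ∀ a b : ℝ, 0 < a → a ≤ b → besselEnergy n a ≤ besselEnergy n b := by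
    intro a b ha hab
    have h1 := besselEnergy_sub (n := n) ha hab
    have h2 : 0 ≤ ∫ x in a..b, (2 * (n : ℝ) ^ 2 - 1 / 2) * (besselJ n x / x) ^ 2 :=
      intervalIntegral.integral_nonneg hab fun x _ =>
        mul_nonneg (by linarith) (sq_nonneg _)
    linarith
  have hnn : ∀ b : ℝ, 0 < b → 0 ≤ besselEnergy n b := by
    intro b hb
    refine le_of_tendsto (tendsto_besselEnergy_zero hn) ?_
    filter_upwards [Ioc_mem_nhdsGT hb] with a ha using hmono a b ha.1 ha.2
  refine ⟨hnn X hX, fun a ha => ?_⟩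
  have h1 := besselEnergy_sub (n := n) ha.1 ha.2
  rw [intervalIntegral.integral_const_mul] at h1
  rw [le_div_iff₀ (by linarith), mul_comm, h1]
  linarith [hnn a ha.1]

/-- The asymptotic size of `J_n`. -/
theorem eventually_besselJ_sq_add_sq_le (n : ℕ) {δ : ℝ} (hδ : 0 < δ) :
    ∀ᶠ x in atTop, x * (besselJ n x ^ 2 + besselJ (n + 1) x ^ 2) ≤ 2 / Real.pi + δ := by
  have hpi := Real.pi_pos
  have hpi3 := Real.pi_gt_three
  have h2pi : 2 / Real.pi < 1 := by rw [div_lt_one hpi]; linarith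
  induction n generalizing δ with
  | zero =>
    have hev : ∀ᶠ x : ℝ in atTop, (2 / Real.pi) * (1 + 2 / x) < 2 / Real.pi + δ := by
      have : Tendsto (fun x : ℝ => (2 / Real.pi) * (1 + 2 / x)) atTop
          (𝓝 ((2 / Real.pi) * (1 + 0))) :=
        ((tendsto_const_nhds.div_atTop tendsto_id).const_add 1).const_mul _
      exact this.eventually (gt_mem_nhds (by linarith))
    filter_upwards [hev, eventually_ge_atTop 4] with x hx h4
    have hT := besselEnergy_one_le (show 0 < x by linarith)
    have hP : besselP 1 x = x * besselJ 0 x - besselJ 1 x := by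
      have := besselJ_recurrence 1 x
      rw [besselP]
      norm_num at this ⊢
      linarith
    simp only [besselEnergy, hP, Int.cast_one] at hT
    rw [div_le_iff₀ (by linarith)] at hT
    simp only [CharP.cast_eq_zero, zero_add]
    set a := besselJ 0 x
    set b := besselJ 1 x
    -- The left side is `x` times the energy of order one, written in `J₀` and `J₁`; its last two
    -- terms are of lower order.
    have e : x ^ 2 * (a ^ 2 + b ^ 2) - x * (a * b) - b ^ 2 / 2 ≤ 2 / Real.pi * x := by
      linarith
    have e1 : (x ^ 2 - x / 2 - 1 / 2) * (a ^ 2 + b ^ 2) ≤ 2 / Real.pi * x := by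
      nlinarith [mul_nonneg (show 0 ≤ x by linarith) (sq_nonneg (a - b)), sq_nonneg a]
    have e2 : x * (a ^ 2 + b ^ 2) ≤ (2 / Real.pi) * (1 + 2 / x) := by
      have hx2 : 0 < x ^ 2 - x / 2 - 1 / 2 := by nlinarith
      rw [← mul_le_mul_iff_right₀ hx2]
      calc (x ^ 2 - x / 2 - 1 / 2) * (x * (a ^ 2 + b ^ 2))
          = x * ((x ^ 2 - x / 2 - 1 / 2) * (a ^ 2 + b ^ 2)) := by ring
        _ ≤ x * (2 / Real.pi * x) := by gcongr
        _ = (2 / Real.pi) * x ^ 2 := by ring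
        _ ≤ (2 / Real.pi) * ((x ^ 2 - x / 2 - 1 / 2) * (1 + 2 / x)) := by
          gcongr
          have : (x ^ 2 - x / 2 - 1 / 2) * (1 + 2 / x) = x ^ 2 + (3 / 2) * x - 3 / 2 - 1 / x := by
            field_simp
            ring
          rw [this]
          have : 1 / x ≤ 1 := by rw [div_le_one] <;> linarith
          linarith
        _ = _ := by ring
    linarith
  | succ n ih =>
    -- By the recurrence `J_{n+2} = (C/x) J_{n+1} - J_n`, so raising the order costs a factor `1 +
    -- O(1/x)`, paid for by half of `δ`.
    set C : ℝ := 2 * (n + 1) with hC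
    have hev : ∀ᶠ x : ℝ in atTop, (2 / Real.pi + δ / 2) * (1 + (C + C ^ 2) / x) <
        2 / Real.pi + δ := by
      have : Tendsto (fun x : ℝ => (2 / Real.pi + δ / 2) * (1 + (C + C ^ 2) / x)) atTop
          (𝓝 ((2 / Real.pi + δ / 2) * (1 + 0))) :=
        ((tendsto_const_nhds.div_atTop tendsto_id).const_add 1).const_mul _
      exact this.eventually (gt_mem_nhds (by linarith))
    filter_upwards [hev, ih (half_pos hδ), eventually_ge_atTop 1] with x hx hi h1
    have hrec := besselJ_recurrence (n + 1) x
    rw [add_sub_cancel_right] at hrec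
    push_cast at hrec ⊢
    set a := besselJ n x
    set b := besselJ (n + 1) x
    set c := besselJ (n + 1 + 1) x
    have hc : c = C / x * b - a := by
      field_simp
      linarith
    have hC0 : 0 ≤ C := by positivity
    refine le_trans ?_ hx.le
    refine le_trans ?_ (mul_le_mul_of_nonneg_right hi (by positivity))
    have hu : 0 ≤ C / x := by positivity
    have hu2 : (C / x) ^ 2 ≤ C ^ 2 / x := by
      rw [div_pow]
      gcongr
      nlinarith
    have : b ^ 2 + c ^ 2 ≤ (a ^ 2 + b ^ 2) * (1 + (C + C ^ 2) / x) := by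
      rw [hc, add_div]
      have e3 : 0 ≤ C ^ 2 / x := by positivity
      nlinarith [mul_nonneg hu (sq_nonneg (a + b)), mul_nonneg hu (sq_nonneg a),
        mul_nonneg hu (sq_nonneg b), mul_nonneg e3 (sq_nonneg a),
        mul_nonneg (sub_nonneg.2 hu2) (sq_nonneg b)]
    calc x * (b ^ 2 + c ^ 2) ≤ x * ((a ^ 2 + b ^ 2) * (1 + (C + C ^ 2) / x)) := by gcongr
      _ = _ := by ring

/-! ### A Lyapunov function beyond the turning point. -/

/-- The coefficient `(x² - b)^{-1/2}` of the Lyapunov function `besselLyap`. -/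
noncomputable def lyapWeight (b x : ℝ) : ℝ := (Real.sqrt (x ^ 2 - b))⁻¹

theorem lyapWeight_sq {b x : ℝ} (h : b < x ^ 2) : lyapWeight b x ^ 2 * (x ^ 2 - b) = 1 := by
  have h' : 0 < x ^ 2 - b := by linarith
  rw [lyapWeight, inv_pow, Real.sq_sqrt h'.le, inv_mul_cancel₀ h'.ne']

theorem lyapWeight_pos {b x : ℝ} (h : b < x ^ 2) : 0 < lyapWeight b x :=
  inv_pos.2 (Real.sqrt_pos.2 (by linarith))

theorem hasDerivAt_lyapWeight {b x : ℝ} (h : b < x ^ 2) :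
    HasDerivAt (lyapWeight b) (-x * lyapWeight b x ^ 3) x := by
  have h' : 0 < x ^ 2 - b := by linarith
  have h1 : HasDerivAt (fun x : ℝ => x ^ 2 - b) (2 * x) x := by
    simpa using ((hasDerivAt_id x).pow 2).sub_const b
  have h2 : HasDerivAt (lyapWeight b) _ x := (h1.sqrt h'.ne').inv (Real.sqrt_pos.2 h').ne'
  refine h2.congr_deriv ?_
  have h3 := (Real.sqrt_pos.2 h').ne'
  rw [lyapWeight]
  field_simp

/-- A quadratic form in `J_n` and `x J_n'` that is monotone where `(x² - b)^{-1/2}` is a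
subsolution of the equation of `J_n² + Y_n²`. -/
noncomputable def besselLyap (n : ℤ) (b x : ℝ) : ℝ :=
  ((x ^ 2 - n ^ 2) * lyapWeight b x - x ^ 2 * lyapWeight b x ^ 3 +
    3 / 2 * x ^ 4 * lyapWeight b x ^ 5) * besselJ n x ^ 2 +
  x ^ 2 * lyapWeight b x ^ 3 * (besselJ n x * besselP n x) + lyapWeight b x * besselP n x ^ 2

/-- Given the coefficient `s` of `P²`, the coefficients of `J P` and `J²` are the ones that cancel
`P²` and `J P` in the derivative: `-x s'` for the first, `B` say, and `(x² - n²) s - x B'/2` for the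
second. Only a multiple of `J²` survives. -/
theorem hasDerivAt_besselLyap (n : ℤ) {b x : ℝ} (hx : x ≠ 0) (h : b < x ^ 2) :
    HasDerivAt (besselLyap n b) (x / 2 * lyapWeight b x ^ 7 *
      (4 * (n ^ 2 - b) * (x ^ 2 - b) ^ 2 - (x ^ 4 + 10 * b * x ^ 2 + 4 * b ^ 2)) *
      besselJ n x ^ 2) x := by
  have hJ := hasDerivAt_besselJ_of_ne n hx
  have hP := hasDerivAt_besselP n hx
  have hs := hasDerivAt_lyapWeight h
  have h2 := (hasDerivAt_id x).pow 2
  have h4 := ((hasDerivAt_id x).pow 4).const_mul (3 / 2)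
  have hA := (((h2.sub_const ((n : ℝ) ^ 2)).mul hs).sub (h2.mul (hs.pow 3))).add
    (h4.mul (hs.pow 5))
  have hd : HasDerivAt (besselLyap n b) _ x :=
    ((hA.mul (hJ.pow 2)).add ((h2.mul (hs.pow 3)).mul (hJ.mul hP))).add (hs.mul (hP.pow 2))
  refine hd.congr_deriv ?_
  have hq := lyapWeight_sq h
  simp
  set s := lyapWeight b x
  set J := besselJ n x
  set P := besselP n x
  have key : 2 * x * s - 2 * x * (x ^ 2 - n ^ 2) * s ^ 3 - 2 * x * s ^ 3 + 9 * x ^ 3 * s ^ 5 -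
      15 / 2 * x ^ 5 * s ^ 7 = x / 2 * s ^ 7 *
      (4 * (n ^ 2 - b) * (x ^ 2 - b) ^ 2 - (x ^ 4 + 10 * b * x ^ 2 + 4 * b ^ 2)) := by
    linear_combination (-2 * x * s - 2 * x * (n ^ 2 - b) * s ^ 3 * ((x ^ 2 - b) * s ^ 2 + 1) +
      2 * x * s ^ 3 * ((x ^ 2 - b) * s ^ 2 + 1) - 9 * x ^ 3 * s ^ 5) * hq
  rw [← key]
  field_simp
  ring

/-- Asymptotically the Lyapunov function is `x (J_n² + J_{n+1}²)`. -/
theorem eventually_besselLyap_le (n : ℕ) (b : ℝ) {δ : ℝ} (hδ : 0 < δ) :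
    ∀ᶠ x in atTop, besselLyap n b x ≤ 2 / Real.pi + δ := by
  have hpi := Real.pi_pos
  -- After division by `x`, the form in `J_n, J_{n+1}` has coefficients `α → 1`, `-β → 0`, `u → 1`.
  set u : ℝ → ℝ := fun x => (Real.sqrt (1 - b * (x⁻¹) ^ 2))⁻¹ with hu
  have hinv : Tendsto (fun x : ℝ => x⁻¹) atTop (𝓝 0) := tendsto_inv_atTop_zero
  have hulim : Tendsto u atTop (𝓝 1) := by
    have h1 : Tendsto (fun x : ℝ => 1 - b * (x⁻¹) ^ 2) atTop (𝓝 (1 - b * 0 ^ 2)) :=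
      ((hinv.pow 2).const_mul b).const_sub 1
    have h2 := (h1.sqrt).inv₀ (by norm_num)
    simpa [hu] using h2
  set β : ℝ → ℝ := fun x => u x ^ 3 * x⁻¹ + 2 * n * u x * x⁻¹ with hβ
  set α : ℝ → ℝ := fun x => (1 - n ^ 2 * x⁻¹ ^ 2) * u x - u x ^ 3 * x⁻¹ ^ 2 +
    3 / 2 * u x ^ 5 * x⁻¹ ^ 2 + n * u x ^ 3 * x⁻¹ ^ 2 + n ^ 2 * u x * x⁻¹ ^ 2 with hα
  have hβlim : Tendsto β atTop (𝓝 0) := by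
    have := ((hulim.pow 3).mul hinv).add (((hulim.const_mul (2 * (n : ℝ))).mul hinv))
    simpa using this
  have hαlim : Tendsto α atTop (𝓝 1) := by
    have h1 := (((hinv.pow 2).const_mul ((n : ℝ) ^ 2)).const_sub 1).mul hulim
    have h2 := h1.sub ((hulim.pow 3).mul (hinv.pow 2))
    have h3 := h2.add (((hulim.pow 5).const_mul (3 / 2)).mul (hinv.pow 2))
    have h4 := h3.add (((hulim.pow 3).const_mul (n : ℝ)).mul (hinv.pow 2))
    have h5 := h4.add ((hulim.const_mul ((n : ℝ) ^ 2)).mul (hinv.pow 2))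
    simpa [hα] using h5
  obtain ⟨η, hη, hηδ⟩ : ∃ η > 0, (1 + η) * (2 / Real.pi + δ / 2) ≤ 2 / Real.pi + δ := by
    refine ⟨(δ / 2) / (2 / Real.pi + δ / 2), by positivity, le_of_eq ?_⟩
    field_simp
    ring
  have hα1 : ∀ᶠ x in atTop, α x + |β x| / 2 < 1 + η := by
    have := hαlim.add (hβlim.abs.div_const 2)
    exact this.eventually (gt_mem_nhds (by simpa using hη))
  have hu1 : ∀ᶠ x in atTop, u x + |β x| / 2 < 1 + η := by
    have := hulim.add (hβlim.abs.div_const 2)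
    exact this.eventually (gt_mem_nhds (by simpa using hη))
  filter_upwards [hα1, hu1, eventually_besselJ_sq_add_sq_le n (half_pos hδ),
    eventually_gt_atTop 0] with x h1 h2 h3 hx
  have hs : lyapWeight b x = u x * x⁻¹ := by
    rw [lyapWeight, hu, ← mul_inv, inv_inj, ← Real.sqrt_sq hx.le, ← Real.sqrt_mul' _ (sq_nonneg _),
      Real.sqrt_sq hx.le]
    congr 1
    field_simp
  have hE : besselLyap n b x = x * (α x * besselJ n x ^ 2 -
      β x * (besselJ n x * besselJ (n + 1) x) + u x * besselJ (n + 1) x ^ 2) := by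
    rw [besselLyap, hs, besselP, hα, hβ]
    push_cast
    field_simp
    ring
  rw [hE]
  set J := besselJ n x
  set K := besselJ (n + 1) x
  have h4 : -(β x * (J * K)) ≤ |β x| / 2 * (J ^ 2 + K ^ 2) := by
    have h5 : |J * K| ≤ (J ^ 2 + K ^ 2) / 2 := by
      rw [abs_le]
      constructor <;> nlinarith [sq_nonneg (J - K), sq_nonneg (J + K)]
    calc -(β x * (J * K)) ≤ |β x * (J * K)| := neg_le_abs _
      _ = |β x| * |J * K| := abs_mul _ _
      _ ≤ |β x| * ((J ^ 2 + K ^ 2) / 2) := by gcongr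
      _ = _ := by ring
  calc x * (α x * J ^ 2 - β x * (J * K) + u x * K ^ 2)
      ≤ x * ((1 + η) * (J ^ 2 + K ^ 2)) := by
        refine mul_le_mul_of_nonneg_left ?_ hx.le
        nlinarith [sq_nonneg J, sq_nonneg K, mul_nonneg (sub_nonneg.2 h1.le) (sq_nonneg J),
          mul_nonneg (sub_nonneg.2 h2.le) (sq_nonneg K)]
    _ = (1 + η) * (x * (J ^ 2 + K ^ 2)) := by ring
    _ ≤ (1 + η) * (2 / Real.pi + δ / 2) := by gcongr
    _ ≤ _ := hηδ

/-- Condition `hL` is the sign of the derivative on `[x, ∞)`, so the value at `x` is bounded by the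
values at infinity. -/
theorem besselLyap_le (n : ℕ) {b x : ℝ} (hx : 0 < x) (hb : b < x ^ 2)
    (hL : ∀ y, x ≤ y → y ^ 4 + 10 * b * y ^ 2 + 4 * b ^ 2 ≤ 4 * (n ^ 2 - b) * (y ^ 2 - b) ^ 2) :
    besselLyap n b x ≤ 2 / Real.pi := by
  have hmono : ∀ y, x ≤ y → besselLyap n b x ≤ besselLyap n b y := by
    have hy (y : ℝ) (hy : x ≤ y) : b < y ^ 2 := by nlinarith
    have hm : MonotoneOn (besselLyap n b) (Ici x) := by
      refine monotoneOn_of_hasDerivWithinAt_nonneg (convex_Ici x)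
        (f' := fun y => y / 2 * lyapWeight b y ^ 7 * (4 * ((n : ℤ) ^ 2 - b) * (y ^ 2 - b) ^ 2 -
          (y ^ 4 + 10 * b * y ^ 2 + 4 * b ^ 2)) * besselJ n y ^ 2) ?_ ?_ ?_
      · intro y hxy
        exact (hasDerivAt_besselLyap n (hx.trans_le hxy).ne' (hy y hxy)).continuousAt
          |>.continuousWithinAt
      · intro y hxy
        rw [interior_Ici] at hxy
        exact (hasDerivAt_besselLyap n (hx.trans hxy).ne' (hy y hxy.le)).hasDerivWithinAt
      · intro y hxy
        rw [interior_Ici] at hxy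
        have h1 := lyapWeight_pos (hy y hxy.le)
        have h2 := hL y hxy.le
        have h3 : (0 : ℝ) < y := hx.trans hxy
        push_cast
        have h4 : 0 ≤ 4 * ((n : ℝ) ^ 2 - b) * (y ^ 2 - b) ^ 2 -
          (y ^ 4 + 10 * b * y ^ 2 + 4 * b ^ 2) := by linarith
        positivity
    exact fun y hxy => hm self_mem_Ici hxy hxy
  refine le_of_forall_pos_le_add fun δ hδ => ?_
  obtain ⟨y, h1, h2⟩ := ((eventually_besselLyap_le n b hδ).and (eventually_ge_atTop x)).exists
  exact (hmono y h2).trans h1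

/-- In terms of `p = x J_n'` and `ξ = x² / (x² - b)`. -/
theorem besselLyap_eq (n : ℤ) {b x : ℝ} (hb : b < x ^ 2) :
    Real.sqrt (x ^ 2 - b) * besselLyap n b x =
      (x ^ 2 - n ^ 2 + 5 / 4 * (x ^ 2 / (x ^ 2 - b)) ^ 2 - x ^ 2 / (x ^ 2 - b)) * besselJ n x ^ 2 +
        (besselP n x + x ^ 2 / (x ^ 2 - b) / 2 * besselJ n x) ^ 2 := by
  have h' : 0 < x ^ 2 - b := by linarith
  have hs := Real.sqrt_pos.2 h'
  have hs2 := Real.sq_sqrt h'.le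
  rw [besselLyap, lyapWeight]
  set s := Real.sqrt (x ^ 2 - b)
  rw [← hs2]
  field_simp
  ring

theorem two_div_pi_le : 2 / Real.pi ≤ (63696 / 100000) := by
  rw [div_le_iff₀ Real.pi_pos]
  nlinarith [Real.pi_gt_d2]

theorem sqrt_two_le : Real.sqrt 2 ≤ (141422 / 100000) := by
  rw [Real.sqrt_le_left (by norm_num)]
  norm_num

theorem sqrt_two_mul_two_div_pi_le : Real.sqrt 2 * (2 / Real.pi) ≤ (901 / 1000) := by
  calc Real.sqrt 2 * (2 / Real.pi) ≤ (141422 / 100000) * (63696 / 100000) :=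
        mul_le_mul sqrt_two_le two_div_pi_le (by positivity) (by norm_num)
    _ ≤ (901 / 1000) := by norm_num

/-- Order zero has no turning point. The choice `b = -1/4` gives `4(n² - b) = 1`, which balances the
leading terms of the monotonicity condition; `x² + 1/4 ≤ 2x²` costs the factor `√2`. -/
theorem besselJ_zero_sq_mul_le {x : ℝ} (hx : 1 ≤ x) : besselJ 0 x ^ 2 * x ≤ (91 / 100) := by
  have hb : (-1 / 4 : ℝ) < x ^ 2 := by nlinarith
  have hE := besselLyap_le 0 (by linarith) hb (fun y hy => by
    have : 1 ≤ y ^ 2 := by nlinarith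
    norm_num
    nlinarith)
  have heq := besselLyap_eq 0 hb
  norm_num at heq hE
  have hx2 : 1 ≤ x ^ 2 := by nlinarith
  set ξ := x ^ 2 / (x ^ 2 + 1 / 4) with hξ
  have h1 : 4 / 5 ≤ ξ := by
    rw [hξ, le_div_iff₀ (by linarith)]
    linarith
  have h2 : x ^ 2 * besselJ 0 x ^ 2 ≤ Real.sqrt (x ^ 2 + 1 / 4) * (2 / Real.pi) := by
    refine le_trans ?_ (mul_le_mul_of_nonneg_left hE (Real.sqrt_nonneg _))
    rw [heq]
    have : 0 ≤ (5 / 4 * ξ ^ 2 - ξ) * besselJ 0 x ^ 2 :=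
      mul_nonneg (by nlinarith) (sq_nonneg _)
    nlinarith [sq_nonneg (besselP 0 x + ξ / 2 * besselJ 0 x)]
  have h3 : Real.sqrt (x ^ 2 + 1 / 4) ≤ Real.sqrt 2 * x := by
    rw [← Real.sqrt_sq (show 0 ≤ x by linarith), ← Real.sqrt_mul (by norm_num),
      Real.sqrt_sq (show 0 ≤ x by linarith)]
    exact Real.sqrt_le_sqrt (by linarith)
  have h4 : x ^ 2 * besselJ 0 x ^ 2 ≤ (901 / 1000) * x := by
    have h5 : 0 ≤ 2 / Real.pi := by positivity
    calc x ^ 2 * besselJ 0 x ^ 2 ≤ (Real.sqrt 2 * x) * (2 / Real.pi) :=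
          h2.trans (by gcongr)
      _ = (Real.sqrt 2 * (2 / Real.pi)) * x := by ring
      _ ≤ _ := mul_le_mul_of_nonneg_right sqrt_two_mul_two_div_pi_le (by linarith)
  have h5 : x * (besselJ 0 x ^ 2 * x) ≤ x * (901 / 1000) := by linarith
  have := le_of_mul_le_mul_left h5 (by linarith)
  linarith

/-! ### The turning region, on the scale `k = n^{2/3}`. -/

section Turning

variable {n : ℕ} {k : ℝ}

/-- This is the hypothesis of `besselLyap_le` for `n² = k³`, `b = n² - k²` and `Y = y²`: the form is
monotone from `x² = n² + k²` on. -/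
theorem turning_lyap_condition (hk : 1 ≤ k) {Y : ℝ} (hY : k ^ 3 + k ^ 2 ≤ Y) :
    Y ^ 2 + 10 * (k ^ 3 - k ^ 2) * Y + 4 * (k ^ 3 - k ^ 2) ^ 2 ≤
      4 * k ^ 2 * (Y - (k ^ 3 - k ^ 2)) ^ 2 := by
  obtain ⟨t, ht, rfl⟩ : ∃ t, 0 ≤ t ∧ Y = k ^ 3 + k ^ 2 + t := ⟨Y - (k ^ 3 + k ^ 2), by linarith,
    by ring⟩
  have h1 : 0 ≤ t * (k ^ 2 * (16 * k ^ 2 - 12 * k + 8)) :=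
    mul_nonneg ht (mul_nonneg (sq_nonneg k) (by nlinarith))
  have h2 : 0 ≤ (4 * k ^ 2 - 1) * t ^ 2 := mul_nonneg (by nlinarith) (sq_nonneg t)
  have h3 : 0 ≤ k ^ 6 + 6 * k ^ 5 + 5 * k ^ 4 := by positivity
  nlinarith

theorem turning_lyap_le (hk : 1 ≤ k) (hkn : k ^ 3 = n ^ 2) {x : ℝ} (hx0 : 0 < x)
    (hx : k ^ 3 + k ^ 2 ≤ x ^ 2) : besselLyap n (k ^ 3 - k ^ 2) x ≤ 2 / Real.pi := by
  refine besselLyap_le n hx0 (by nlinarith) fun y hy => ?_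
  have h := turning_lyap_condition hk (Y := y ^ 2) (by nlinarith)
  rw [← hkn]
  calc y ^ 4 + 10 * (k ^ 3 - k ^ 2) * y ^ 2 + 4 * (k ^ 3 - k ^ 2) ^ 2
      = (y ^ 2) ^ 2 + 10 * (k ^ 3 - k ^ 2) * y ^ 2 + 4 * (k ^ 3 - k ^ 2) ^ 2 := by ring
    _ ≤ _ := h
    _ = _ := by ring

/-- In `besselLyap_eq` the terms beyond `(x² - n²) J²` are nonnegative because `ξ ≥ 1`. Since `x² -
b = (x² - n²) + k² ≤ 2(x² - n²)`, the loss against `2/π` is `√2`. -/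
theorem turning_besselJ_sq_le (hk : 1 ≤ k) (hkn : k ^ 3 = n ^ 2) {x : ℝ} (hx0 : 0 < x)
    (hx : k ^ 3 + k ^ 2 ≤ x ^ 2) : besselJ n x ^ 2 * Real.sqrt (x ^ 2 - n ^ 2) ≤ (901 / 1000) := by
  have hk2 : 1 ≤ k ^ 2 := by nlinarith
  have hb : k ^ 3 - k ^ 2 < x ^ 2 := by nlinarith
  have hb0 : 0 ≤ k ^ 3 - k ^ 2 := by nlinarith
  have hE := turning_lyap_le hk hkn hx0 hx
  have heq := besselLyap_eq n hb
  push_cast at heq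
  set f := x ^ 2 - (n : ℝ) ^ 2 with hf
  have hfk : k ^ 2 ≤ f := by rw [hf, ← hkn]; linarith
  have hg : x ^ 2 - (k ^ 3 - k ^ 2) = f + k ^ 2 := by rw [hf, ← hkn]; ring
  set ξ := x ^ 2 / (x ^ 2 - (k ^ 3 - k ^ 2)) with hξ
  have h1 : 1 ≤ ξ := by
    rw [hξ, le_div_iff₀ (by linarith)]
    linarith
  have h2 : f * besselJ n x ^ 2 ≤ Real.sqrt (2 * f) * (2 / Real.pi) := by
    have h3 : f * besselJ n x ^ 2 ≤ Real.sqrt (x ^ 2 - (k ^ 3 - k ^ 2)) * (2 / Real.pi) := by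
      refine le_trans ?_ (mul_le_mul_of_nonneg_left hE (Real.sqrt_nonneg _))
      rw [heq]
      have : 0 ≤ (5 / 4 * ξ ^ 2 - ξ) * besselJ n x ^ 2 :=
        mul_nonneg (by nlinarith) (sq_nonneg _)
      nlinarith [sq_nonneg (besselP n x + ξ / 2 * besselJ n x)]
    refine h3.trans (mul_le_mul_of_nonneg_right (Real.sqrt_le_sqrt ?_) (by positivity))
    rw [hg]
    linarith
  have hf0 : 0 < f := by linarith
  have hsf := Real.sqrt_pos.2 hf0
  have h4 : Real.sqrt f * (besselJ n x ^ 2 * Real.sqrt f) ≤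
      Real.sqrt f * (Real.sqrt 2 * (2 / Real.pi)) := by
    calc Real.sqrt f * (besselJ n x ^ 2 * Real.sqrt f)
        = (Real.sqrt f * Real.sqrt f) * besselJ n x ^ 2 := by ring
      _ = f * besselJ n x ^ 2 := by rw [Real.mul_self_sqrt hf0.le]
      _ ≤ Real.sqrt (2 * f) * (2 / Real.pi) := h2
      _ = _ := by rw [Real.sqrt_mul (by norm_num)]; ring
  exact (le_of_mul_le_mul_left h4 hsf).trans sqrt_two_mul_two_div_pi_le

/-- The Lyapunov bound at the point `X = √(k³ + k²)` past the turning point `n = √(k³)`. -/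
theorem turning_form_le (hk : 1 ≤ k) (hkn : k ^ 3 = n ^ 2) {X : ℝ} (hX0 : 0 < X)
    (hX : X ^ 2 = k ^ 3 + k ^ 2) :
    (k ^ 2 + 5 / 4 * ((k + 1) / 2) ^ 2 - (k + 1) / 2) * besselJ n X ^ 2 +
        (besselP n X + (k + 1) / 2 / 2 * besselJ n X) ^ 2 ≤ (901 / 1000) * k := by
  have hb : k ^ 3 - k ^ 2 < X ^ 2 := by nlinarith
  have hE := turning_lyap_le hk hkn hX0 hX.ge
  have heq := besselLyap_eq n hb
  have hk0 : 0 < k := by linarith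
  have h1 : X ^ 2 - (k ^ 3 - k ^ 2) = 2 * k ^ 2 := by rw [hX]; ring
  have h2 : X ^ 2 / (2 * k ^ 2) = (k + 1) / 2 := by
    rw [hX]
    field_simp
  have h3 : X ^ 2 - ((n : ℤ) : ℝ) ^ 2 = k ^ 2 := by
    push_cast
    rw [hX, ← hkn]
    ring
  rw [h1, h2, h3] at heq
  rw [← heq, Real.sqrt_mul (by norm_num), Real.sqrt_sq hk0.le]
  calc Real.sqrt 2 * k * besselLyap n (k ^ 3 - k ^ 2) X
      ≤ Real.sqrt 2 * k * (2 / Real.pi) := by gcongr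
    _ = (Real.sqrt 2 * (2 / Real.pi)) * k := by ring
    _ ≤ _ := mul_le_mul_of_nonneg_right sqrt_two_mul_two_div_pi_le hk0.le

/-- Two quadratic forms in `J` and `P` are compared at `X`: the energy form is at most `61/50` times
that of `turning_form_le`, and `61/50 · 0.901 < 1.1`. With `r` the square completed there, `h2` and
`h3` sum to the difference. -/
theorem turning_energy_le (hk : 1 ≤ k) (hkn : k ^ 3 = n ^ 2) {X : ℝ} (hX0 : 0 < X)
    (hX : X ^ 2 = k ^ 3 + k ^ 2) : besselEnergy n X ≤ (11 / 10) * k / X := by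
  have h := turning_form_le hk hkn hX0 hX
  rw [besselEnergy]
  gcongr
  push_cast
  rw [hX, ← hkn]
  set J := besselJ n X
  obtain ⟨r, hr⟩ : ∃ r, r = besselP n X + (k + 1) / 2 / 2 * J := ⟨_, rfl⟩
  rw [← hr] at h
  rw [show besselP n X = r - (k + 1) / 2 / 2 * J by rw [hr]; ring]
  have h2 : 0 ≤ (11 / 50) * (r - (1 - (k + 1) / 2) / (11 / 25) * J) ^ 2 := by positivity
  have h3 : 0 ≤ ((61 / 50) * (k ^ 2 + 5 / 4 * ((k + 1) / 2) ^ 2 - (k + 1) / 2) -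
      (k ^ 2 + 1 / 2 - (k + 1) / 4 + ((k + 1) / 4) ^ 2) - (1 - (k + 1) / 2) ^ 2 / (22 / 25)) * J ^ 2 :=
    mul_nonneg (by nlinarith) (sq_nonneg J)
  nlinarith

/-- The same comparison for the form of `monotoneOn_restoring`, where `k² = X² - n²`. -/
theorem turning_restoring_le (hk : 4 ≤ k) (hkn : k ^ 3 = n ^ 2) {X : ℝ} (hX0 : 0 < X)
    (hX : X ^ 2 = k ^ 3 + k ^ 2) : k ^ 2 * besselJ n X ^ 2 + besselP n X ^ 2 ≤ (11 / 10) * k := by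
  have h := turning_form_le (by linarith) hkn hX0 hX
  set J := besselJ n X
  obtain ⟨r, hr⟩ : ∃ r, r = besselP n X + (k + 1) / 2 / 2 * J := ⟨_, rfl⟩
  rw [← hr] at h
  rw [show besselP n X = r - (k + 1) / 2 / 2 * J by rw [hr]; ring]
  have h2 : 0 ≤ (11 / 50) * (r + (k + 1) / 2 / (11 / 25) * J) ^ 2 := by positivity
  have h3 : 0 ≤ ((61 / 50) * (k ^ 2 + 5 / 4 * ((k + 1) / 2) ^ 2 - (k + 1) / 2) -
      (k ^ 2 + ((k + 1) / 4) ^ 2) - ((k + 1) / 2) ^ 2 / (22 / 25)) * J ^ 2 :=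
    mul_nonneg (by nlinarith) (sq_nonneg J)
  nlinarith

end Turning

/-- Below the turning point `J_n²` is nondecreasing. -/
theorem monotoneOn_besselJ_sq (n : ℕ) : MonotoneOn (fun x => besselJ n x ^ 2) (Icc 0 (n : ℝ)) := by
  rcases Nat.eq_zero_or_pos n with rfl | hn
  · intro a ha b hb _
    simp only [CharP.cast_eq_zero, Icc_self, mem_singleton_iff] at ha hb
    simp [ha, hb]
  have hcJ := continuous_besselJ n
  have hcP := continuous_besselP n
  have hprod : MonotoneOn (fun x => besselJ n x * besselP n x) (Icc 0 (n : ℝ)) := by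
    refine monotoneOn_of_hasDerivWithinAt_nonneg (convex_Icc _ _)
      (f' := fun x => (besselP n x ^ 2 + (n ^ 2 - x ^ 2) * besselJ n x ^ 2) / x)
      (by fun_prop) (fun x hx => ?_) (fun x hx => ?_)
    · rw [interior_Icc] at hx
      have h : HasDerivAt (fun x => besselJ n x * besselP n x) _ x :=
        (hasDerivAt_besselJ_of_ne n hx.1.ne').mul (hasDerivAt_besselP n hx.1.ne')
      refine (h.congr_deriv ?_).hasDerivWithinAt
      push_cast
      ring
    · rw [interior_Icc] at hx
      have h1 := hx.1
      have h2 : 0 ≤ (n : ℝ) ^ 2 - x ^ 2 := by nlinarith [hx.2]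
      positivity
  have hprod0 : ∀ x ∈ Icc 0 (n : ℝ), 0 ≤ besselJ n x * besselP n x := by
    intro x hx
    have h := hprod (left_mem_Icc.2 (Nat.cast_nonneg n)) hx hx.1
    have h0 : besselJ n 0 = 0 := by
      rw [besselJ_zero_right, if_neg (by exact_mod_cast hn.ne')]
    simpa only [h0, zero_mul] using h
  refine monotoneOn_of_hasDerivWithinAt_nonneg (convex_Icc _ _)
    (f' := fun x => 2 * (besselJ n x * besselP n x) / x) (by fun_prop) (fun x hx => ?_)
    (fun x hx => ?_)
  · rw [interior_Icc] at hx
    have h := (hasDerivAt_besselJ_of_ne n hx.1.ne').pow 2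
    refine (h.congr_deriv ?_).hasDerivWithinAt
    push_cast
    ring
  · rw [interior_Icc] at hx
    have h1 := hx.1
    have h2 := hprod0 x ⟨hx.1.le, hx.2.le⟩
    positivity

/-- Carries the bound on `x J_n'` from `X` back to the turning point. -/
theorem monotoneOn_restoring (n : ℕ) : MonotoneOn
    (fun x => (x ^ 2 - n ^ 2) * besselJ n x ^ 2 + besselP n x ^ 2) (Ici 0) := by
  have hcJ := continuous_besselJ n
  have hcP := continuous_besselP n
  refine monotoneOn_of_hasDerivWithinAt_nonneg (convex_Ici _)
    (f' := fun x => 2 * x * besselJ n x ^ 2)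
    (by fun_prop) (fun x hx => ?_) (fun x hx => ?_)
  · rw [interior_Ici] at hx
    have hx' : x ≠ 0 := ne_of_gt hx
    have h : HasDerivAt (fun x => (x ^ 2 - n ^ 2) * besselJ n x ^ 2 + besselP n x ^ 2) _ x :=
      ((((hasDerivAt_id x).pow 2).sub_const ((n : ℝ) ^ 2)).mul
      ((hasDerivAt_besselJ_of_ne n hx').pow 2)).add ((hasDerivAt_besselP n hx').pow 2)
    refine (h.congr_deriv ?_).hasDerivWithinAt
    simp
    field_simp
    ring
  · rw [interior_Ici] at hx
    have hx' : 0 < x := hx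
    positivity

/-- For `k ≤ 9/2` the bound `J² ≤ 1/2` suffices. Otherwise `J_n` is small at `X`, changes little on
`[n, X]` by the mean value inequality, as that interval has length at most `k²/(2n)`, and `J_n²` is
nondecreasing below `n`. -/
theorem turning_besselJ_sq_mul_le {n : ℕ} (hn : n ≠ 0) {k : ℝ} (hk : 1 ≤ k) (hkn : k ^ 3 = n ^ 2)
    {X : ℝ} (hX0 : 0 < X) (hX : X ^ 2 = k ^ 3 + k ^ 2) {x : ℝ} (hx0 : 0 ≤ x) (hx : x ≤ X) :
    besselJ n x ^ 2 * k ≤ 9 / 4 := by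
  have hk0 : 0 < k := by linarith
  rcases le_total k (9 / 2) with h | h
  · have := two_mul_besselJ_sq_le_one (by exact_mod_cast hn : (n : ℤ) ≠ 0) x
    nlinarith [sq_nonneg (besselJ n x)]
  have hn0 : (0 : ℝ) < n := by positivity
  have hnX : (n : ℝ) < X := by
    refine lt_of_pow_lt_pow_left₀ 2 hX0.le ?_
    rw [hX, ← hkn]
    nlinarith
  have key : ∀ y ∈ Icc (n : ℝ) X, besselJ n y ^ 2 * k ≤ 9 / 4 := by
    intro y hy
    have hR := turning_restoring_le (by linarith) hkn hX0 hX
    have hder : ∀ z ∈ Icc y X, ‖besselP n z / z‖ ≤ Real.sqrt ((11 / 10) * k) / n := by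
      intro z hz
      have hz0 : (n : ℝ) ≤ z := hy.1.trans hz.1
      have hm := monotoneOn_restoring n (show z ∈ Ici 0 from hn0.le.trans hz0)
        (show X ∈ Ici 0 from hX0.le) hz.2
      simp only at hm
      rw [show X ^ 2 - (n : ℝ) ^ 2 = k ^ 2 by rw [hX, ← hkn]; ring] at hm
      have h1 : besselP n z ^ 2 ≤ (11 / 10) * k := by
        have : 0 ≤ (z ^ 2 - (n : ℝ) ^ 2) * besselJ n z ^ 2 :=
          mul_nonneg (by nlinarith) (sq_nonneg _)
        linarith
      rw [norm_div, Real.norm_eq_abs, Real.norm_eq_abs, abs_of_pos (hn0.trans_le hz0)]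
      exact div_le_div₀ (Real.sqrt_nonneg _) (Real.abs_le_sqrt h1) hn0 hz0
    have hmvt := (convex_Icc y X).norm_image_sub_le_of_norm_hasDerivWithin_le
      (f := besselJ n) (f' := fun z => besselP n z / z)
      (fun z hz => (hasDerivAt_besselJ_of_ne n
        (hn0.trans_le (hy.1.trans hz.1)).ne').hasDerivWithinAt) hder
      (right_mem_Icc.2 hy.2) (left_mem_Icc.2 hy.2)
    rw [Real.norm_eq_abs, Real.norm_eq_abs, abs_sub_comm y X,
      abs_of_nonneg (sub_nonneg.2 hy.2)] at hmvt
    have hlen : X - y ≤ k ^ 2 / (2 * n) := by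
      rw [le_div_iff₀ (by positivity)]
      have h1 : (X - n) * (X + n) = k ^ 2 := by
        have h0 : (X - n) * (X + n) = X ^ 2 - n ^ 2 := by ring
        rw [h0, hX, ← hkn]
        ring
      nlinarith [hy.1, mul_nonneg (sub_nonneg.2 hnX.le) (sub_nonneg.2 hnX.le)]
    have h2 : |besselJ n y - besselJ n X| ≤ Real.sqrt ((11 / 10) * k) / (2 * k) := by
      refine hmvt.trans ?_
      calc Real.sqrt ((11 / 10) * k) / n * (X - y) ≤ Real.sqrt ((11 / 10) * k) / n * (k ^ 2 / (2 * n)) := by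
            gcongr
        _ = Real.sqrt ((11 / 10) * k) * k ^ 2 / (2 * n ^ 2) := by field_simp
        _ = Real.sqrt ((11 / 10) * k) / (2 * k) := by rw [← hkn]; field_simp
    have h3 := turning_besselJ_sq_le hk hkn hX0 hX.ge
    rw [show X ^ 2 - (n : ℝ) ^ 2 = k ^ 2 by rw [hX, ← hkn]; ring, Real.sqrt_sq hk0.le] at h3
    set a := besselJ n y
    set c := besselJ n X
    set S := Real.sqrt ((11 / 10) * k) with hS
    have hS2 : S ^ 2 = (11 / 10) * k := Real.sq_sqrt (by positivity)
    obtain ⟨e, he⟩ : ∃ e, e = a - c := ⟨_, rfl⟩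
    have he2 : e ^ 2 * k ≤ 11 / 40 := by
      rw [← he] at h2
      have h4 : e ^ 2 ≤ (S / (2 * k)) ^ 2 := sq_le_sq' (by linarith [neg_le_abs e])
        ((le_abs_self e).trans h2)
      calc e ^ 2 * k ≤ (S / (2 * k)) ^ 2 * k := by gcongr
        _ = S ^ 2 / (4 * k) := by field_simp; norm_num
        _ = 11 / 40 := by rw [hS2]; field_simp; norm_num
    rw [show a = c + e by rw [he]; ring]
    -- The weights keep `31/20 · 0.901 + 31/11 · 11/40` below `9/4`.
    have h5 : (c + e) ^ 2 ≤ (31 / 20) * c ^ 2 + (1 + 1 / (11 / 20)) * e ^ 2 := by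
      nlinarith [sq_nonneg ((11 / 20) * c - e)]
    nlinarith [mul_le_mul_of_nonneg_right h5 hk0.le]
  rcases le_total x n with h1 | h1
  · have h2 := monotoneOn_besselJ_sq n ⟨hx0, h1⟩ (right_mem_Icc.2 hn0.le) h1
    have h3 := key n (left_mem_Icc.2 hnX.le)
    simp only at h2
    nlinarith
  · exact key x ⟨h1, hx⟩

/-! ### Bounds for powers of `J_n`, uniform in the order. -/

/-- The cut is `X = √(n² + k²)` with `k³ = n²`. Past `X` the Lyapunov bound holds. Before `X`, two
factors of `J_n` are kept for `∫ (J_n/t)²`, bounded by the energy at `X`, and the other powers of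
`J_n` and `t` are replaced by their suprema. -/
theorem exists_turning_besselJ_bounds {n : ℕ} (hn : n ≠ 0) :
    ∃ X : ℝ, 1 ≤ X ∧ 1 ≤ X ^ 2 - n ^ 2 ∧
      (∀ t, X ≤ t → besselJ n t ^ 2 * Real.sqrt (t ^ 2 - n ^ 2) ≤ 91 / 100) ∧
      (∀ t, X ≤ t → t ^ 2 ≤ 2 * (t ^ 2 - n ^ 2) * Real.sqrt (t ^ 2 - n ^ 2)) ∧
      (∀ t ∈ Icc 1 X, |besselJ n t| ^ 3 * t ≤ 49 / 10) ∧
      ∫ t in (1 : ℝ)..X, |besselJ n t| ^ 4 ≤ 11 / 20 ∧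
      ∫ t in (1 : ℝ)..X, t * |besselJ n t| ^ 4 ≤ 31 / 20 ∧
      ∫ t in (1 : ℝ)..X, Real.sqrt t * |besselJ n t| ^ 3 ≤ 93 / 50 := by
  have hn1 : (1 : ℝ) ≤ n := by exact_mod_cast Nat.one_le_iff_ne_zero.2 hn
  obtain ⟨k, hk, hkn⟩ : ∃ k : ℝ, 1 ≤ k ∧ k ^ 3 = n ^ 2 := by
    refine ⟨((n : ℝ) ^ 2) ^ (1 / 3 : ℝ), Real.one_le_rpow (by nlinarith) (by norm_num), ?_⟩
    rw [← Real.rpow_natCast, ← Real.rpow_mul (by positivity)]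
    norm_num
  have hk0 : 0 < k := by linarith
  obtain ⟨X, hX0, hX⟩ : ∃ X : ℝ, 0 < X ∧ X ^ 2 = k ^ 3 + k ^ 2 :=
    ⟨Real.sqrt (k ^ 3 + k ^ 2), Real.sqrt_pos.2 (by positivity), Real.sq_sqrt (by positivity)⟩
  have hk2 : 1 ≤ k ^ 2 := by nlinarith
  have hk3 : k ^ 2 ≤ k ^ 3 := by nlinarith
  have hX1 : 1 ≤ X := by nlinarith
  have hX2 : X ^ 2 ≤ 2 * k ^ 3 := by linarith
  have hcJ := continuous_besselJ n
  have hD : 0 < 2 * k ^ 3 - 1 / 2 := by linarith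
  have hL2 : ∫ t in (1 : ℝ)..X, (besselJ n t / t) ^ 2 ≤
      11 / 10 * k / (X * (2 * k ^ 3 - 1 / 2)) := by
    have h1 := (besselEnergy_nonneg (by exact_mod_cast hn : (n : ℤ) ≠ 0) hX0).2 1 ⟨one_pos, hX1⟩
    have h2 := turning_energy_le hk hkn hX0 hX
    push_cast at h1
    rw [← hkn] at h1
    calc _ ≤ _ := h1
      _ ≤ 11 / 10 * k / X / (2 * k ^ 3 - 1 / 2) := by gcongr
      _ = _ := by rw [div_div]
  have hL2nn : 0 ≤ ∫ t in (1 : ℝ)..X, (besselJ n t / t) ^ 2 :=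
    intervalIntegral.integral_nonneg hX1 fun t _ => sq_nonneg _
  have hstep (F : ℝ → ℝ) (hF : Continuous F) (M : ℝ) (hM : 0 ≤ M)
      (h : ∀ t ∈ Icc 1 X, F t ≤ M * (besselJ n t / t) ^ 2) :
      ∫ t in (1 : ℝ)..X, F t ≤ M * (11 / 10 * k / (X * (2 * k ^ 3 - 1 / 2))) := by
    calc ∫ t in (1 : ℝ)..X, F t ≤ ∫ t in (1 : ℝ)..X, M * (besselJ n t / t) ^ 2 := by
          refine intervalIntegral.integral_mono_on hX1 (hF.intervalIntegrable _ _) ?_ h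
          refine ContinuousOn.intervalIntegrable fun x hx => ?_
          rw [uIcc_of_le hX1] at hx
          have hx0 : x ≠ 0 := by linarith [hx.1]
          have := hcJ.continuousAt (x := x)
          exact ContinuousAt.continuousWithinAt (by fun_prop (disch := exact hx0))
      _ = M * ∫ t in (1 : ℝ)..X, (besselJ n t / t) ^ 2 :=
          intervalIntegral.integral_const_mul _ _
      _ ≤ _ := by gcongr
  have hhalf (t : ℝ) : besselJ n t ^ 2 ≤ 1 / 2 := by
    have := two_mul_besselJ_sq_le_one (by exact_mod_cast hn : (n : ℤ) ≠ 0) t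
    linarith
  have hdecay : ∀ t ∈ Icc 1 X, besselJ n t ^ 2 ≤ 9 / 4 / k := by
    intro t ht
    rw [le_div_iff₀ hk0]
    exact turning_besselJ_sq_mul_le hn hk hkn hX0 hX (by linarith [ht.1]) ht.2
  have hpow4 (t : ℝ) (ht : 1 ≤ t) : |besselJ n t| ^ 4 =
      (t ^ 2 * besselJ n t ^ 2) * (besselJ n t / t) ^ 2 := by
    have : t ≠ 0 := by linarith
    rw [Even.pow_abs (by decide)]
    field_simp
  refine ⟨X, hX1, by rw [hX, ← hkn]; linarith, fun t ht => ?_, fun t ht => ?_, fun t ht => ?_,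
    ?_, ?_, ?_⟩
  · have := turning_besselJ_sq_le hk hkn (hX0.trans_le ht) (by rw [← hX]; gcongr)
    linarith
  · have hf : k ^ 2 ≤ t ^ 2 - n ^ 2 := by
      rw [← hkn]
      nlinarith
    set f := t ^ 2 - (n : ℝ) ^ 2 with hf'
    have hs : k ≤ Real.sqrt f := Real.le_sqrt_of_sq_le hf
    have hs2 : Real.sqrt f ^ 2 = f := Real.sq_sqrt (by linarith)
    have h1 : k ^ 3 ≤ f * Real.sqrt f := by
      rw [show k ^ 3 = k ^ 2 * k by ring]
      gcongr
      linarith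
    have h2 : f ≤ f * Real.sqrt f := by
      have : 0 ≤ f := by linarith
      nlinarith
    have h3 : t ^ 2 = f + k ^ 3 := by rw [hf', hkn]; ring
    linarith
  · have h1 := hdecay t ht
    have ht0 : 0 < t := by linarith [ht.1]
    refine le_of_sq_le_sq ?_ (by norm_num)
    calc (|besselJ n t| ^ 3 * t) ^ 2 = (besselJ n t ^ 2) ^ 3 * t ^ 2 := by
          rw [mul_pow, ← pow_mul, ← pow_mul, Even.pow_abs (by decide)]
      _ ≤ (9 / 4 / k) ^ 3 * (2 * k ^ 3) := by
          have : t ^ 2 ≤ 2 * k ^ 3 := le_trans (by nlinarith [ht.2]) hX2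
          gcongr
      _ = 729 / 32 := by
          field_simp
          norm_num
      _ ≤ (49 / 10) ^ 2 := by norm_num
  · refine (hstep _ (by fun_prop) (X ^ 2 * (1 / 2)) (by positivity) fun t ht => ?_).trans ?_
    · rw [hpow4 t ht.1]
      have := hhalf t
      have := ht.1
      have := ht.2
      gcongr
    · have h1 : k * X ≤ 2 * k ^ 3 - 1 / 2 := by
        refine le_of_sq_le_sq ?_ hD.le
        rw [mul_pow, hX]
        nlinarith [mul_nonneg (sub_nonneg.2 hk) (sub_nonneg.2 hk), pow_pos hk0 5, pow_pos hk0 4]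
      rw [← mul_div_assoc, div_le_iff₀ (by positivity)]
      nlinarith
  · refine (hstep _ (by fun_prop) (X ^ 3 * min (1 / 2) (9 / 4 / k)) (by positivity)
      fun t ht => ?_).trans ?_
    · rw [hpow4 t ht.1]
      have h1 := hhalf t
      have h2 := hdecay t ht
      have h3 := ht.1
      have h4 := ht.2
      calc t * (t ^ 2 * besselJ n t ^ 2 * (besselJ n t / t) ^ 2)
          = (t ^ 3 * besselJ n t ^ 2) * (besselJ n t / t) ^ 2 := by ring
        _ ≤ (X ^ 3 * min (1 / 2) (9 / 4 / k)) * (besselJ n t / t) ^ 2 := by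
          have h5 := le_min h1 h2
          gcongr
    · have e : X ^ 3 * min (1 / 2) (9 / 4 / k) * (11 / 10 * k / (X * (2 * k ^ 3 - 1 / 2))) =
          (k ^ 3 + k ^ 2) * min (1 / 2) (9 / 4 / k) * (11 / 10 * k) / (2 * k ^ 3 - 1 / 2) := by
        rw [← hX]
        field_simp
      rw [e, div_le_iff₀ hD]
      -- The two suprema `1/2` and `9/(4k)` for `J_n²` agree at `k = 9/2`.
      rcases le_total k (9 / 2) with h | h
      · calc (k ^ 3 + k ^ 2) * min (1 / 2) (9 / 4 / k) * (11 / 10 * k)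
            ≤ (k ^ 3 + k ^ 2) * (1 / 2) * (11 / 10 * k) := by
              gcongr
              exact min_le_left _ _
          _ ≤ _ := by
              have : 0 ≤ k ^ 2 * ((k - 1) * (9 / 2 - k)) :=
                mul_nonneg (by positivity) (mul_nonneg (by linarith) (by linarith))
              nlinarith [mul_nonneg this hk0.le]
      · calc (k ^ 3 + k ^ 2) * min (1 / 2) (9 / 4 / k) * (11 / 10 * k)
            ≤ (k ^ 3 + k ^ 2) * (9 / 4 / k) * (11 / 10 * k) := by
              gcongr
              exact min_le_right _ _
          _ = 99 / 40 * (k ^ 3 + k ^ 2) := by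
              field_simp
              norm_num
          _ ≤ _ := by nlinarith
  · have hXX : X * Real.sqrt (X * k) ≤ 1682 / 1000 * k ^ 3 := by
      refine le_of_sq_le_sq ?_ (by positivity)
      rw [mul_pow, Real.sq_sqrt (by positivity)]
      have h1 : X ≤ 14143 / 10000 * k ^ 2 := by
        refine le_of_sq_le_sq ?_ (by positivity)
        nlinarith [mul_nonneg (pow_pos hk0 3).le (sub_nonneg.2 hk), pow_pos hk0 3]
      calc X ^ 2 * (X * k) ≤ (2 * k ^ 3) * (14143 / 10000 * k ^ 2 * k) := by gcongr
        _ = 28286 / 10000 * k ^ 6 := by ring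
        _ ≤ 2829124 / 1000000 * k ^ 6 := by
            exact mul_le_mul_of_nonneg_right (by norm_num) (by positivity)
        _ = _ := by ring
    have habs : ∀ t ∈ Icc 1 X, |besselJ n t| ≤ 3 / 2 / Real.sqrt k := by
      intro t ht
      refine le_of_sq_le_sq ?_ (by positivity)
      rw [sq_abs, div_pow, Real.sq_sqrt hk0.le]
      refine (hdecay t ht).trans (le_of_eq ?_)
      norm_num
    refine (hstep _ (by fun_prop) (Real.sqrt X * (X ^ 2 * (3 / 2 / Real.sqrt k))) (by positivity)
      fun t ht => ?_).trans ?_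
    · have h1 := habs t ht
      have h3 := ht.1
      have h4 := ht.2
      have ht0 : t ≠ 0 := by linarith
      calc Real.sqrt t * |besselJ n t| ^ 3
          = (Real.sqrt t * (t ^ 2 * |besselJ n t|)) * (besselJ n t / t) ^ 2 := by
            rw [pow_succ, sq_abs]
            field_simp
        _ ≤ _ := by gcongr
    · have hsk := Real.sqrt_pos.2 hk0
      have hsk2 := Real.mul_self_sqrt hk0.le
      have e : Real.sqrt X * (X ^ 2 * (3 / 2 / Real.sqrt k)) *
          (11 / 10 * k / (X * (2 * k ^ 3 - 1 / 2))) =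
          33 / 20 * (X * Real.sqrt (X * k)) / (2 * k ^ 3 - 1 / 2) := by
        rw [Real.sqrt_mul hX0.le]
        nth_rewrite 2 [← hsk2]
        field_simp
        norm_num
      rw [e, div_le_iff₀ hD]
      nlinarith

theorem exists_besselJ_bounds (n : ℕ) :
    ∃ X : ℝ, 1 ≤ X ∧ 1 ≤ X ^ 2 - n ^ 2 ∧
      (∀ t, X ≤ t → besselJ n t ^ 2 * Real.sqrt (t ^ 2 - n ^ 2) ≤ 91 / 100) ∧
      (∀ t, X ≤ t → t ^ 2 ≤ 2 * (t ^ 2 - n ^ 2) * Real.sqrt (t ^ 2 - n ^ 2)) ∧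
      (∀ t ∈ Icc 1 X, |besselJ n t| ^ 3 * t ≤ 49 / 10) ∧
      ∫ t in (1 : ℝ)..X, |besselJ n t| ^ 4 ≤ 11 / 20 ∧
      ∫ t in (1 : ℝ)..X, t * |besselJ n t| ^ 4 ≤ 31 / 20 ∧
      ∫ t in (1 : ℝ)..X, Real.sqrt t * |besselJ n t| ^ 3 ≤ 93 / 50 := by
  rcases eq_or_ne n 0 with rfl | hn
  -- Order zero has no turning region: `X = 1` makes the three integrals empty.
  · refine ⟨1, le_rfl, by norm_num, fun t ht => ?_, fun t ht => ?_, fun t ht => ?_,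
      by norm_num, by norm_num, by norm_num⟩
    · have h := besselJ_zero_sq_mul_le ht
      simpa [Real.sqrt_sq (show 0 ≤ t by linarith)] using h
    · have : t ^ 2 ≤ t ^ 2 * t := le_mul_of_one_le_right (by positivity) ht
      simp only [CharP.cast_eq_zero, ne_eq, OfNat.ofNat_ne_zero, not_false_eq_true, zero_pow,
        sub_zero, Real.sqrt_sq (show 0 ≤ t by linarith)]
      nlinarith
    · obtain rfl : t = 1 := le_antisymm ht.2 ht.1
      rw [mul_one]
      exact (pow_le_one₀ (abs_nonneg _) (abs_besselJ_le_one _ _)).trans (by norm_num)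
  · exact exists_turning_besselJ_bounds hn

/-- Uniform decay `t^{-1/3}`, stated without roots. Past `X` it follows from `t² ≤ 2 f^{3/2}` and
`J_n² √f ≤ 0.91`, where `f = t² - n²`. -/
theorem abs_besselJ_pow_three_mul_le (n : ℕ) {t : ℝ} (ht : 1 ≤ t) :
    |besselJ n t| ^ 3 * t ≤ 49 / 10 := by
  obtain ⟨X, hX1, hX2, h1, h2, h3, -⟩ := exists_besselJ_bounds n
  rcases le_total t X with h | h
  · exact h3 t ⟨ht, h⟩
  have h4 := h1 t h
  have h5 := h2 t h
  have hf : 0 ≤ t ^ 2 - (n : ℝ) ^ 2 := by nlinarith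
  set f := t ^ 2 - (n : ℝ) ^ 2
  have hs2 : Real.sqrt f ^ 2 = f := Real.sq_sqrt hf
  set s := Real.sqrt f
  have hs0 : 0 ≤ s := Real.sqrt_nonneg _
  refine le_of_sq_le_sq ?_ (by norm_num)
  calc (|besselJ n t| ^ 3 * t) ^ 2 = (besselJ n t ^ 2) ^ 3 * t ^ 2 := by
        rw [mul_pow, ← pow_mul, ← pow_mul, Even.pow_abs (by decide)]
    _ ≤ (besselJ n t ^ 2) ^ 3 * (2 * f * s) := by gcongr
    _ = 2 * (besselJ n t ^ 2 * s) ^ 3 := by rw [← hs2]; ring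
    _ ≤ 2 * (91 / 100) ^ 3 := by gcongr
    _ ≤ _ := by norm_num

/-- The tail of the weighted integral of a function bounded by `C (t² - n²)^{-σ}`. -/
theorem integral_tail_le {X N σ γ C : ℝ} (hX : 1 ≤ X) (hXN : 1 ≤ X ^ 2 - N ^ 2) (hγ : γ ≤ 1)
    (hσ : 1 + γ < 2 * σ) (hC : 0 ≤ C) {h : ℝ → ℝ} (hc : Continuous h) (h0 : ∀ t, 0 ≤ h t)
    (hb : ∀ t, X ≤ t → h t * (t ^ 2 - N ^ 2) ^ σ ≤ C) :
    IntegrableOn (fun t => t ^ γ * h t) (Ioi X) ∧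
      ∫ t in Ioi X, t ^ γ * h t ≤ C / (2 * σ - 1 - γ) := by
  have hv (t : ℝ) (ht : X ≤ t) : 1 ≤ t ^ 2 - N ^ 2 := by nlinarith
  set p : ℝ := (1 + γ) / 2 - σ with hp
  have hp0 : p < 0 := by rw [hp]; linarith
  set G : ℝ → ℝ := fun t => (2 * p)⁻¹ * (t ^ 2 - N ^ 2) ^ p with hG
  have hGd : ∀ t, X ≤ t → HasDerivAt G (t * (t ^ 2 - N ^ 2) ^ (p - 1)) t := by
    intro t ht
    have h1 : HasDerivAt (fun t : ℝ => t ^ 2 - N ^ 2) (2 * t) t := by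
      simpa using ((hasDerivAt_id t).pow 2).sub_const (N ^ 2)
    have h2 := (h1.rpow_const (p := p) (Or.inl (by linarith [hv t ht]))).const_mul (2 * p)⁻¹
    refine h2.congr_deriv ?_
    have : p ≠ 0 := hp0.ne
    field_simp
  have hlim : Tendsto G atTop (𝓝 0) := by
    have h1 : Tendsto (fun t : ℝ => t ^ 2 - N ^ 2) atTop atTop :=
      tendsto_atTop_add_const_right _ _ (tendsto_pow_atTop (by norm_num))
    have h2 := ((tendsto_rpow_neg_atTop (y := -p) (by linarith)).comp h1).const_mul (2 * p)⁻¹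
    simpa only [neg_neg, mul_zero, Function.comp_def] using h2
  have hpos : ∀ t ∈ Ioi X, 0 ≤ t * (t ^ 2 - N ^ 2) ^ (p - 1) := fun t ht =>
    mul_nonneg (by linarith [show X < t from ht])
      (Real.rpow_nonneg (by linarith [hv t (le_of_lt ht)]) _)
  have hGc : ContinuousWithinAt G (Ici X) X := (hGd X le_rfl).continuousAt.continuousWithinAt
  have hGi := integrableOn_Ioi_deriv_of_nonneg hGc (fun t ht => hGd t (le_of_lt ht)) hpos hlim
  have hGv := integral_Ioi_of_hasDerivAt_of_nonneg hGc (fun t ht => hGd t (le_of_lt ht)) hpos hlim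
  have hle : ∀ t ∈ Ioi X, t ^ γ * h t ≤ C * (t * (t ^ 2 - N ^ 2) ^ (p - 1)) := by
    intro t ht
    have ht' : X < t := ht
    have hv1 := hv t ht'.le
    have ht0 : 0 < t := by linarith
    set v := t ^ 2 - N ^ 2 with hv'
    have hv0 : 0 < v := by linarith
    -- Since `γ ≤ 1`, a power of `t` may be traded for one of `v ≤ t²`, leaving the single factor
    -- `t` that makes `t v^{p-1}` an exact derivative.
    have h1 : t ^ (γ - 1) ≤ v ^ ((γ - 1) / 2) := by
      have h2 : t ^ (γ - 1) = (t ^ 2) ^ ((γ - 1) / 2) := by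
        rw [← Real.rpow_natCast, ← Real.rpow_mul ht0.le]
        congr 1
        push_cast
        ring
      rw [h2]
      refine Real.rpow_le_rpow_of_nonpos hv0 ?_ (by linarith)
      rw [hv']
      nlinarith [sq_nonneg N]
    have h3 : h t ≤ C * v ^ (-σ) := by
      rw [Real.rpow_neg hv0.le, ← div_eq_mul_inv, le_div_iff₀ (by positivity)]
      exact hb t ht'.le
    calc t ^ γ * h t = t * t ^ (γ - 1) * h t := by
          rw [Real.rpow_sub_one ht0.ne']
          field_simp
      _ ≤ t * v ^ ((γ - 1) / 2) * (C * v ^ (-σ)) := by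
          have := h0 t
          gcongr
      _ = C * (t * (v ^ ((γ - 1) / 2) * v ^ (-σ))) := by ring
      _ = _ := by
          rw [← Real.rpow_add hv0]
          congr 3
          rw [hp]
          ring
  have hmeas : AEStronglyMeasurable (fun t => t ^ γ * h t) (volume.restrict (Ioi X)) := by
    refine ContinuousOn.aestronglyMeasurable (fun t ht => ?_) measurableSet_Ioi
    have ht0 : t ≠ 0 := by linarith [show X < t from ht]
    exact ((Real.continuousAt_rpow_const _ _ (Or.inl ht0)).mul hc.continuousAt).continuousWithinAt
  have hint : IntegrableOn (fun t => t ^ γ * h t) (Ioi X) := by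
    refine Integrable.mono' (hGi.const_mul C) hmeas ?_
    refine (ae_restrict_iff' measurableSet_Ioi).2 (.of_forall fun t ht => ?_)
    rw [Real.norm_of_nonneg (mul_nonneg (Real.rpow_nonneg (by linarith [show X < t from ht]) _)
      (h0 t))]
    exact hle t ht
  refine ⟨hint, ?_⟩
  calc ∫ t in Ioi X, t ^ γ * h t ≤ ∫ t in Ioi X, C * (t * (t ^ 2 - N ^ 2) ^ (p - 1)) :=
        setIntegral_mono_on hint (hGi.const_mul C) measurableSet_Ioi hle
    _ = C * ((X ^ 2 - N ^ 2) ^ p / (-(2 * p))) := by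
        rw [integral_const_mul, hGv, hG]
        rw [div_neg, zero_sub, mul_neg, mul_neg, div_eq_inv_mul]
    _ ≤ C * (1 / (-(2 * p))) := by
        have : (X ^ 2 - N ^ 2) ^ p ≤ 1 := Real.rpow_le_one_of_one_le_of_nonpos hXN hp0.le
        have : 0 < -(2 * p) := by linarith
        gcongr
    _ = C / (2 * σ - 1 - γ) := by
        rw [mul_one_div, hp]
        congr 1
        ring

theorem integrableOn_and_integral_le_of_split {X : ℝ} (hX : 1 ≤ X) {F : ℝ → ℝ} {a b : ℝ}
    (hF : ContinuousOn F (Icc 1 X)) (ha : ∫ t in (1 : ℝ)..X, F t ≤ a)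
    (hi : IntegrableOn F (Ioi X)) (hb : ∫ t in Ioi X, F t ≤ b) :
    IntegrableOn F (Ioi 1) ∧ ∫ t in Ioi 1, F t ≤ a + b := by
  have h1 : IntegrableOn F (Ioc 1 X) :=
    (hF.integrableOn_compact isCompact_Icc).mono_set Ioc_subset_Icc_self
  rw [← Ioc_union_Ioi_eq_Ioi hX]
  refine ⟨h1.union hi, ?_⟩
  rw [setIntegral_union (Ioc_disjoint_Ioi le_rfl) measurableSet_Ioi h1 hi,
    ← intervalIntegral.integral_of_le hX]
  exact add_le_add ha hb

theorem continuousOn_rpow_mul (γ X : ℝ) {h : ℝ → ℝ} (hc : Continuous h) :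
    ContinuousOn (fun t => t ^ γ * h t) (Icc 1 X) := by
  intro t ht
  have ht0 : t ≠ 0 := by linarith [ht.1]
  exact ((Real.continuousAt_rpow_const _ _ (Or.inl ht0)).mul hc.continuousAt).continuousWithinAt

/-- Past `X`, `J_n⁴ (t² - n²) ≤ 0.91²` is the tail lemma with `σ = 1`; before `X`, `t^γ ≤ (1-γ) + γ
t` interpolates between the two known moments. -/
theorem integral_besselJ_pow_four_le (n : ℕ) {γ : ℝ} (hγ0 : 0 ≤ γ) (hγ : γ < 1) :
    IntegrableOn (fun t => t ^ γ * |besselJ n t| ^ 4) (Ioi 1) ∧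
      ∫ t in Ioi 1, t ^ γ * |besselJ n t| ^ 4 ≤ 11 / 20 + γ + 83 / 100 / (1 - γ) := by
  obtain ⟨X, hX1, hX2, h1, -, -, h4, h5, -⟩ := exists_besselJ_bounds n
  have hc : Continuous fun t => |besselJ n t| ^ 4 := (continuous_besselJ n).abs.pow 4
  obtain ⟨ht1, ht2⟩ := integral_tail_le (σ := 1) (γ := γ) (C := 83 / 100) hX1 hX2 hγ.le
    (by linarith) (by norm_num) hc (fun t => by positivity) (fun t ht => by
      have hf : 0 ≤ t ^ 2 - (n : ℝ) ^ 2 := by nlinarith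
      have h := h1 t ht
      rw [Real.rpow_one, Even.pow_abs (by decide), ← Real.sq_sqrt hf]
      calc besselJ n t ^ 4 * Real.sqrt (t ^ 2 - n ^ 2) ^ 2
          = (besselJ n t ^ 2 * Real.sqrt (t ^ 2 - n ^ 2)) ^ 2 := by ring
        _ ≤ (91 / 100) ^ 2 := by gcongr
        _ ≤ 83 / 100 := by norm_num)
  refine integrableOn_and_integral_le_of_split hX1 (continuousOn_rpow_mul γ X hc) ?_ ht1
    (ht2.trans (le_of_eq (by norm_num)))
  calc ∫ t in (1 : ℝ)..X, t ^ γ * |besselJ n t| ^ 4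
      ≤ ∫ t in (1 : ℝ)..X, ((1 - γ) * |besselJ n t| ^ 4 + γ * (t * |besselJ n t| ^ 4)) := by
        refine intervalIntegral.integral_mono_on hX1 ?_ ?_ fun t ht => ?_
        · exact ContinuousOn.intervalIntegrable_of_Icc hX1 (continuousOn_rpow_mul γ X hc)
        · exact Continuous.intervalIntegrable (by fun_prop) _ _
        · have h := Real.geom_mean_le_arith_mean2_weighted (w₁ := 1 - γ) (w₂ := γ) (p₁ := 1)
            (p₂ := t) (by linarith) hγ0 zero_le_one (by linarith [ht.1]) (by ring)
          rw [Real.one_rpow, one_mul, mul_one] at h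
          have := mul_le_mul_of_nonneg_right h (show 0 ≤ |besselJ n t| ^ 4 by positivity)
          linarith
    _ = (1 - γ) * (∫ t in (1 : ℝ)..X, |besselJ n t| ^ 4) +
          γ * ∫ t in (1 : ℝ)..X, t * |besselJ n t| ^ 4 := by
        rw [intervalIntegral.integral_add, intervalIntegral.integral_const_mul,
          intervalIntegral.integral_const_mul]
        all_goals exact Continuous.intervalIntegrable (by fun_prop) _ _
    _ ≤ (1 - γ) * (11 / 20) + γ * (31 / 20) := by
        have : 0 ≤ 1 - γ := by linarith
        gcongr
    _ = 11 / 20 + γ := by ring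

/-- Here `σ = 3/4`: the cube decays like `t^{-3/2}`, whence `γ < 1/2`. Before `X`, `t^γ ≤ √t`. -/
theorem integral_besselJ_pow_three_le (n : ℕ) {γ : ℝ} (hγ : γ < 1 / 2) :
    IntegrableOn (fun t => t ^ γ * |besselJ n t| ^ 3) (Ioi 1) ∧
      ∫ t in Ioi 1, t ^ γ * |besselJ n t| ^ 3 ≤ 93 / 50 + 7 / 4 / (1 - 2 * γ) := by
  obtain ⟨X, hX1, hX2, h1, -, -, -, -, h4⟩ := exists_besselJ_bounds n
  have hc : Continuous fun t => |besselJ n t| ^ 3 := (continuous_besselJ n).abs.pow 3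
  obtain ⟨ht1, ht2⟩ := integral_tail_le (σ := 3 / 4) (γ := γ) (C := 7 / 8) hX1 hX2 (by linarith)
    (by linarith) (by norm_num) hc (fun t => by positivity) (fun t ht => by
      have hf : 0 ≤ t ^ 2 - (n : ℝ) ^ 2 := by nlinarith
      have h := h1 t ht
      have hs : ((t ^ 2 - (n : ℝ) ^ 2) ^ (3 / 4 : ℝ)) ^ 2 =
          Real.sqrt (t ^ 2 - (n : ℝ) ^ 2) ^ 3 := by
        generalize t ^ 2 - (n : ℝ) ^ 2 = f at hf
        rw [Real.sqrt_eq_rpow, ← Real.rpow_natCast, ← Real.rpow_natCast, ← Real.rpow_mul hf,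
          ← Real.rpow_mul hf]
        norm_num
      refine le_of_sq_le_sq ?_ (by norm_num)
      rw [mul_pow, hs, ← pow_mul, Even.pow_abs (by decide)]
      calc besselJ n t ^ (3 * 2) * Real.sqrt (t ^ 2 - n ^ 2) ^ 3
          = (besselJ n t ^ 2 * Real.sqrt (t ^ 2 - n ^ 2)) ^ 3 := by ring
        _ ≤ (91 / 100) ^ 3 := by gcongr
        _ ≤ (7 / 8) ^ 2 := by norm_num)
  refine integrableOn_and_integral_le_of_split hX1 (continuousOn_rpow_mul γ X hc) ?_ ht1
    (ht2.trans (le_of_eq ?_))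
  · refine le_trans ?_ h4
    refine intervalIntegral.integral_mono_on hX1 ?_ ?_ fun t ht => ?_
    · exact ContinuousOn.intervalIntegrable_of_Icc hX1 (continuousOn_rpow_mul γ X hc)
    · have := continuous_besselJ n
      exact Continuous.intervalIntegrable (by fun_prop) _ _
    · rw [Real.sqrt_eq_rpow]
      gcongr
      exact ht.1
  · have : 1 - 2 * γ ≠ 0 := by linarith
    rw [show 2 * (3 / 4 : ℝ) - 1 - γ = (1 - 2 * γ) / 2 by ring]
    field_simp
    norm_num

/-! ### The Laplacian, its unitary group and the Bessel kernel. -/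

section Lattice

variable {d : ℕ}

theorem norm_latticeShift_le (a : Fin d → ℤ) : ‖latticeShift a‖ ≤ 1 :=
  LinearMap.mkContinuous_norm_le _ zero_le_one _

theorem latticeShift_apply (a : Fin d → ℤ) (f : LatticeLp d 2) (n : Fin d → ℤ) :
    latticeShift a f n = f (n + a) := rfl

theorem star_latticeShift (a : Fin d → ℤ) : star (latticeShift a) = latticeShift (-a) := by
  rw [ContinuousLinearMap.star_eq_adjoint]
  symm
  rw [ContinuousLinearMap.eq_adjoint_iff]
  intro f g
  rw [lp.inner_eq_tsum, lp.inner_eq_tsum, ← (Equiv.addRight a).tsum_eq]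
  refine tsum_congr fun n => ?_
  rw [latticeShift_apply, latticeShift_apply, Equiv.coe_addRight, add_neg_cancel_right]

theorem isSelfAdjoint_latticeLaplacian (d : ℕ) : IsSelfAdjoint (latticeLaplacian d) := by
  rw [IsSelfAdjoint, latticeLaplacian, star_smul, star_sum]
  congr 1
  · simp
  · refine Finset.sum_congr rfl fun j _ => ?_
    rw [star_add, star_latticeShift, star_latticeShift, neg_neg, add_comm]

theorem norm_latticeLaplacian_le (d : ℕ) : ‖latticeLaplacian d‖ ≤ d := by
  rw [latticeLaplacian, norm_smul]
  calc ‖(1 / 2 : ℂ)‖ * ‖∑ j : Fin d, (latticeShift (Pi.single j (1 : ℤ)) +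
        latticeShift (-Pi.single j (1 : ℤ)))‖ ≤ ‖(1 / 2 : ℂ)‖ * ∑ j : Fin d, (2 : ℝ) := by
        gcongr
        refine norm_sum_le_of_le _ fun j _ => (norm_add_le _ _).trans ?_
        linarith [norm_latticeShift_le (d := d) (Pi.single j 1),
          norm_latticeShift_le (d := d) (-Pi.single j 1)]
    _ = d := by
        norm_num
        ring

/-- The resolvent set contains the complement of `[-d, d]`. -/
theorem isUnit_latticeLaplacian_sub {z : ℂ} (hz : z ∉ latticeCut d) :
    IsUnit (latticeLaplacian d - z • ContinuousLinearMap.id ℂ _) := by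
  by_contra h
  have hspec : z ∈ spectrum ℂ (latticeLaplacian d) := by
    rw [spectrum.mem_iff, Algebra.algebraMap_eq_smul_one]
    intro h'
    have h2 := h'.neg
    rw [neg_sub] at h2
    exact h h2
  have hre := (isSelfAdjoint_latticeLaplacian d).mem_spectrum_eq_re hspec
  have hn := spectrum.norm_le_norm_mul_of_mem hspec
  have h1 : ‖(1 : LatticeOp d)‖ ≤ 1 := ContinuousLinearMap.norm_id_le
  have h2 : ‖z‖ ≤ d := by
    refine hn.trans ?_
    calc _ ≤ (d : ℝ) * 1 := by
          gcongr
          exact norm_latticeLaplacian_le d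
      _ = d := mul_one _
  refine hz ⟨z.re, ?_, hre.symm⟩
  rw [hre, Complex.norm_real] at h2
  exact abs_le.1 h2

/-- The unitary group `exp (-itΔ)`. -/
noncomputable def latticePropagator (d : ℕ) (t : ℝ) : LatticeOp d :=
  NormedSpace.exp ((t : ℂ) • (-Complex.I • latticeLaplacian d))

theorem latticePropagator_zero : latticePropagator d 0 = 1 := by
  simp [latticePropagator]

theorem norm_latticePropagator_le (t : ℝ) : ‖latticePropagator d t‖ ≤ 1 := by
  have hs : (t : ℂ) • (-Complex.I • latticeLaplacian d) ∈ skewAdjoint (LatticeOp d) := by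
    rw [skewAdjoint.mem_iff, star_smul, star_smul, (isSelfAdjoint_latticeLaplacian d).star_eq]
    simp
  let _ : NormedAlgebra ℚ (LatticeOp d) := .restrictScalars ℚ ℂ _
  have hu := NormedSpace.exp_mem_unitary_of_mem_skewAdjoint hs
  rcases subsingleton_or_nontrivial (LatticeOp d) with h | h
  · rw [Subsingleton.elim (latticePropagator d t) 0, norm_zero]
    exact zero_le_one
  · exact (CStarRing.norm_of_mem_unitary hu).le

theorem hasDerivAt_latticePropagator (t : ℝ) : HasDerivAt (latticePropagator d)
    ((-Complex.I • latticeLaplacian d) * latticePropagator d t) t := by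
  have h := (hasDerivAt_exp_smul_const' (-Complex.I • latticeLaplacian d) (t : ℂ)).scomp t
    (hasDerivAt_id t).ofReal_comp
  rw [Complex.ofReal_one, one_smul] at h
  exact h

/-- The unit vector at a lattice point. -/
noncomputable def latticeDelta (m : Fin d → ℤ) : LatticeLp d 2 := lp.single 2 m (1 : ℂ)

theorem norm_latticeDelta (m : Fin d → ℤ) : ‖latticeDelta m‖ = 1 := by
  rw [latticeDelta, lp.norm_single (by norm_num), norm_one]

theorem latticeDelta_apply (m n : Fin d → ℤ) :
    latticeDelta m n = if n = m then (1 : ℂ) else 0 := by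
  rw [latticeDelta, lp.single_apply, Pi.single_apply]

/-- The matrix entries of a bounded operator. -/
noncomputable def latticeEntry (n m : Fin d → ℤ) : LatticeOp d →L[ℂ] ℂ :=
  (lp.evalCLM ℂ (fun _ : Fin d → ℤ => ℂ) 2 n).comp
    (ContinuousLinearMap.apply ℂ (LatticeLp d 2) (latticeDelta m))

theorem latticeEntry_apply (n m : Fin d → ℤ) (T : LatticeOp d) :
    latticeEntry n m T = T (latticeDelta m) n := rfl

theorem norm_latticeEntry_le (n m : Fin d → ℤ) (T : LatticeOp d) :
    ‖latticeEntry n m T‖ ≤ ‖T‖ := by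
  rw [latticeEntry_apply]
  refine (lp.norm_apply_le_norm (by norm_num) _ n).trans ?_
  simpa [norm_latticeDelta] using T.le_opNorm (latticeDelta m)

/-- The product of Bessel functions that is the kernel of `exp (-itΔ)`. -/
noncomputable def besselKernel (k : Fin d → ℤ) (t : ℝ) : ℂ :=
  ∏ j, (-Complex.I) ^ k j * (besselJ (k j) t : ℂ)

theorem norm_besselKernel (k : Fin d → ℤ) (t : ℝ) :
    ‖besselKernel k t‖ = ∏ j, |besselJ (k j) t| := by
  rw [besselKernel, norm_prod]
  refine Finset.prod_congr rfl fun j _ => ?_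
  rw [norm_mul, norm_zpow, norm_neg, Complex.norm_I, one_zpow, one_mul, Complex.norm_real,
    Real.norm_eq_abs]

theorem besselKernel_zero (k : Fin d → ℤ) : besselKernel k 0 = if k = 0 then 1 else 0 := by
  split_ifs with h
  · subst h
    simp [besselKernel, besselJ_zero_right]
  · obtain ⟨j, hj⟩ := Function.ne_iff.1 h
    refine Finset.prod_eq_zero (Finset.mem_univ j) ?_
    rw [besselJ_zero_right, if_neg (by simpa using hj)]
    simp

/-- The powers of `-i` turn the difference `J_{k-1} - J_{k+1}` into the sum over neighbours in the
one-dimensional Laplacian. -/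
theorem hasDerivAt_besselKernel_factor (k : ℤ) (t : ℝ) :
    HasDerivAt (fun t : ℝ => (-Complex.I) ^ k * (besselJ k t : ℂ))
      (-Complex.I * (1 / 2) * ((-Complex.I) ^ (k + 1) * (besselJ (k + 1) t : ℂ) +
        (-Complex.I) ^ (k - 1) * (besselJ (k - 1) t : ℂ))) t := by
  refine ((hasDerivAt_besselJ k t).ofReal_comp.const_mul ((-Complex.I) ^ k)).congr_deriv ?_
  have h0 : (-Complex.I) ≠ 0 := neg_ne_zero.2 Complex.I_ne_zero
  rw [zpow_add_one₀ h0, zpow_sub_one₀ h0, inv_neg, Complex.inv_I]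
  push_cast
  linear_combination (-(-Complex.I) ^ k * ((besselJ (k + 1) t : ℂ) - besselJ (k - 1) t) / 2) *
    Complex.I_sq

theorem hasDerivAt_besselKernel (k : Fin d → ℤ) (t : ℝ) :
    HasDerivAt (besselKernel k) (-Complex.I * ((1 / 2) * ∑ j : Fin d,
      (besselKernel (k + Pi.single j 1) t + besselKernel (k - Pi.single j 1) t))) t := by
  have h := HasDerivAt.fun_finsetProd (u := Finset.univ)
    (f := fun (j : Fin d) (t : ℝ) => (-Complex.I) ^ k j * (besselJ (k j) t : ℂ))
    (fun j _ => hasDerivAt_besselKernel_factor (k j) t)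
  refine HasDerivAt.congr_deriv (f := besselKernel k) h ?_
  rw [Finset.mul_sum, Finset.mul_sum]
  refine Finset.sum_congr rfl fun j _ => ?_
  have hs (e : ℤ) : besselKernel (k + Pi.single j e) t =
      ((-Complex.I) ^ (k j + e) * (besselJ (k j + e) t : ℂ)) *
      ∏ i ∈ Finset.univ.erase j, (-Complex.I) ^ k i * (besselJ (k i) t : ℂ) := by
    rw [besselKernel, ← Finset.mul_prod_erase _ _ (Finset.mem_univ j)]
    congr 1
    · simp
    · refine Finset.prod_congr rfl fun i hi => ?_
      rw [Pi.add_apply, Pi.single_eq_of_ne (Finset.ne_of_mem_erase hi), add_zero]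
  have hm : k - Pi.single j (1 : ℤ) = k + Pi.single j (-1) := by
    rw [Pi.single_neg, sub_eq_add_neg]
  rw [hm, hs, hs, smul_eq_mul, ← sub_eq_add_neg]
  ring

theorem norm_besselKernel_le_one (k : Fin d → ℤ) (t : ℝ) : ‖besselKernel k t‖ ≤ 1 := by
  rw [norm_besselKernel]
  exact Finset.prod_le_one (fun _ _ => abs_nonneg _) fun _ _ => abs_besselJ_le_one _ _

theorem continuous_besselKernel (k : Fin d → ℤ) : Continuous (besselKernel k) :=
  continuous_iff_continuousAt.2 fun t => (hasDerivAt_besselKernel k t).continuousAt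

/-- A bounded solution of `w' = -iΔw` that vanishes at time `0` vanishes. -/
theorem eq_zero_of_hasDerivAt_lattice {w : (Fin d → ℤ) → ℝ → ℂ} {C : ℝ}
    (hC : ∀ n t, ‖w n t‖ ≤ C) (h0 : ∀ n, w n 0 = 0)
    (hw : ∀ n t, HasDerivAt (w n) (-Complex.I * ((1 / 2) * ∑ j : Fin d,
      (w (n + Pi.single j 1) t + w (n - Pi.single j 1) t))) t) (n : Fin d → ℤ) {t : ℝ}
    (ht : 0 ≤ t) : w n t = 0 := by
  -- Each integration of the equation in time gains one factor `d t / k`, as the Laplacian has sup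
  -- norm at most `d`.
  have key (k : ℕ) : ∀ n, ∀ t, 0 ≤ t → ‖w n t‖ ≤ C * ((d * t) ^ k / k.factorial) := by
    induction k with
    | zero => intro n t _; simpa using hC n t
    | succ k ih =>
      intro n t ht
      refine image_norm_le_of_norm_deriv_right_le_deriv_boundary (a := 0) (b := t)
        (B := fun t => C * ((d * t) ^ (k + 1) / (k + 1).factorial))
        (B' := fun t => d * (C * ((d * t) ^ k / k.factorial)))
        (fun s _ => (hw n s).continuousAt.continuousWithinAt)
        (fun s _ => (hw n s).hasDerivWithinAt) (by simp [h0]) (fun s => ?_) (fun s hs => ?_)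
        (right_mem_Icc.2 ht)
      · have h := ((((hasDerivAt_id s).const_mul (d : ℝ)).pow (k + 1)).div_const
          ((k + 1).factorial : ℝ)).const_mul C
        refine h.congr_deriv ?_
        rw [Nat.factorial_succ]
        push_cast
        simp
        field_simp
      · rw [norm_mul, norm_neg, Complex.norm_I, one_mul, norm_mul]
        calc ‖(1 / 2 : ℂ)‖ * ‖∑ j : Fin d, (w (n + Pi.single j 1) s + w (n - Pi.single j 1) s)‖
            ≤ ‖(1 / 2 : ℂ)‖ * ∑ j : Fin d, 2 * (C * ((d * s) ^ k / k.factorial)) := by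
              gcongr
              refine norm_sum_le_of_le _ fun j _ => (norm_add_le _ _).trans ?_
              linarith [ih (n + Pi.single j 1) s hs.1, ih (n - Pi.single j 1) s hs.1]
          _ = _ := by
              simp
              ring
  have hlim : Tendsto (fun k : ℕ => C * ((d * t) ^ k / k.factorial)) atTop (𝓝 (C * 0)) :=
    (FloorSemiring.tendsto_pow_div_factorial_atTop _).const_mul C
  rw [mul_zero] at hlim
  exact norm_le_zero_iff.1 (ge_of_tendsto' hlim fun k => key k n t ht)

/-- The kernel of `exp (-itΔ)`. -/
theorem latticeEntry_latticePropagator (n m : Fin d → ℤ) {t : ℝ} (ht : 0 ≤ t) :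
    latticeEntry n m (latticePropagator d t) = besselKernel (n - m) t := by
  rw [← sub_eq_zero]
  refine eq_zero_of_hasDerivAt_lattice (C := 2) (w := fun n t =>
    latticeEntry n m (latticePropagator d t) - besselKernel (n - m) t) (fun n t => ?_) (fun n => ?_)
    (fun n t => ?_) n ht
  · refine (norm_sub_le _ _).trans ?_
    linarith [(norm_latticeEntry_le n m (latticePropagator d t)).trans
      (norm_latticePropagator_le t), norm_besselKernel_le_one (n - m) t]
  · simp only [latticePropagator_zero, besselKernel_zero, latticeEntry_apply, sub_eq_zero]
    exact latticeDelta_apply m n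
  · have h1 := ((latticeEntry n m).restrictScalars ℝ).hasFDerivAt.comp_hasDerivAt t
      (hasDerivAt_latticePropagator (d := d) t)
    refine (h1.sub (hasDerivAt_besselKernel (n - m) t)).congr_deriv ?_
    have h2 : (latticeEntry n m).restrictScalars ℝ ((-Complex.I • latticeLaplacian d) * latticePropagator d t) =
        -Complex.I * latticeLaplacian d (latticePropagator d t (latticeDelta m)) n := rfl
    rw [h2, latticeLaplacian_apply, ← mul_sub, ← mul_sub, ← Finset.sum_sub_distrib]
    congr 2
    refine Finset.sum_congr rfl fun j _ => ?_
    rw [add_sub_right_comm n, sub_right_comm n, latticeEntry_apply, latticeEntry_apply]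
    ring

end Lattice

/-! ### The resolvent as a Laplace transform; analyticity and adjoints. -/

section LatticeResolvent

variable {d : ℕ}

theorem not_mem_latticeCut_of_im_ne_zero {z : ℂ} (hz : z.im ≠ 0) : z ∉ latticeCut d := by
  rintro ⟨x, -, rfl⟩
  exact hz (Complex.ofReal_im x)

theorem norm_exp_I_mul_le_one {z : ℂ} (hz : 0 ≤ z.im) {t : ℝ} (ht : 0 ≤ t) :
    ‖Complex.exp (Complex.I * z * t)‖ ≤ 1 := by
  rw [Complex.norm_exp, Real.exp_le_one_iff]
  simp only [Complex.mul_re, Complex.mul_im, Complex.I_re, Complex.I_im, Complex.ofReal_re,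
    Complex.ofReal_im]
  nlinarith [mul_nonneg hz ht]

theorem norm_exp_I_mul (z : ℂ) (t : ℝ) :
    ‖Complex.exp (Complex.I * z * t)‖ = Real.exp (-z.im * t) := by
  rw [Complex.norm_exp]
  simp

theorem hasDerivAt_exp_smul_latticePropagator (z : ℂ) (t : ℝ) :
    HasDerivAt (fun t : ℝ => Complex.exp (Complex.I * z * t) • latticePropagator d t)
      ((-Complex.I • (latticeLaplacian d - z • ContinuousLinearMap.id ℂ _)) *
        (Complex.exp (Complex.I * z * t) • latticePropagator d t)) t := by
  have h1 : HasDerivAt (fun t : ℝ => Complex.exp (Complex.I * z * t))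
      (Complex.exp (Complex.I * z * t) * (Complex.I * z * 1)) t :=
    ((hasDerivAt_id t).ofReal_comp.const_mul (Complex.I * z)).cexp
  refine (h1.smul (hasDerivAt_latticePropagator t)).congr_deriv ?_
  have h2 : (ContinuousLinearMap.id ℂ (LatticeLp d 2)) * latticePropagator d t =
    latticePropagator d t := rfl
  rw [mul_smul_comm, smul_mul_assoc, smul_mul_assoc, sub_mul, smul_mul_assoc, h2, smul_sub]
  module

theorem integrableOn_exp_smul_latticePropagator {z : ℂ} (hz : 0 < z.im) :
    IntegrableOn (fun t : ℝ => Complex.exp (Complex.I * z * t) • latticePropagator d t)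
      (Ioi 0) := by
  have hi : IntegrableOn (fun t => Real.exp (-z.im * t)) (Ioi (0 : ℝ)) :=
    integrableOn_exp_mul_Ioi (neg_neg_of_pos hz) 0
  refine hi.mono' (Continuous.aestronglyMeasurable (continuous_iff_continuousAt.2 fun t =>
    (hasDerivAt_exp_smul_latticePropagator z t).continuousAt)) (ae_of_all _ fun t => ?_)
  rw [norm_smul, norm_exp_I_mul]
  exact mul_le_of_le_one_right (Real.exp_pos _).le (norm_latticePropagator_le t)

/-- Integrate the derivative of `e^{-it(Δ-z)}` over the half-line; the boundary term at infinity
vanishes because `Im z > 0`. -/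
theorem inverse_latticeLaplacian_sub {z : ℂ} (hz : 0 < z.im) :
    Ring.inverse (latticeLaplacian d - z • ContinuousLinearMap.id ℂ _) =
      Complex.I • ∫ t in Ioi (0 : ℝ), Complex.exp (Complex.I * z * t) • latticePropagator d t := by
  have hint := integrableOn_exp_smul_latticePropagator (d := d) hz
  set A := latticeLaplacian d - z • ContinuousLinearMap.id ℂ (LatticeLp d 2) with hA
  have hunit : IsUnit A := isUnit_latticeLaplacian_sub (not_mem_latticeCut_of_im_ne_zero hz.ne')
  have hcomm := ((ContinuousLinearMap.mul ℂ (LatticeOp d)) (-Complex.I • A)).integral_comp_comm hint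
  have hlim : Tendsto (fun t : ℝ => Complex.exp (Complex.I * z * t) • latticePropagator d t)
      atTop (𝓝 0) := by
    refine squeeze_zero_norm (a := fun t => Real.exp (-z.im * t)) (fun t => ?_) ?_
    · rw [norm_smul, norm_exp_I_mul]
      exact mul_le_of_le_one_right (Real.exp_pos _).le (norm_latticePropagator_le t)
    · exact Real.tendsto_exp_atBot.comp
        (tendsto_id.const_mul_atTop_of_neg (neg_neg_of_pos hz))
  have hftc := integral_Ioi_of_hasDerivAt_of_tendsto
    (hasDerivAt_exp_smul_latticePropagator (d := d) z 0).continuousAt.continuousWithinAt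
    (fun t _ => hasDerivAt_exp_smul_latticePropagator z t)
    (((ContinuousLinearMap.mul ℂ (LatticeOp d)) (-Complex.I • A)).integrable_comp hint) hlim
  have hmul : A * (Complex.I • ∫ t in Ioi (0 : ℝ),
      Complex.exp (Complex.I * z * t) • latticePropagator d t) = 1 := by
    rw [← hA, latticePropagator_zero] at hftc
    simp only [ContinuousLinearMap.mul_apply'] at hcomm
    rw [hcomm] at hftc
    rw [mul_smul_comm, ← neg_inj, ← neg_smul, ← smul_mul_assoc, hftc]
    simp
  -- A right inverse is enough, since `A` is already known to be invertible.
  rw [← mul_one (Ring.inverse A), ← hmul, ← mul_assoc, Ring.inverse_mul_cancel A hunit, one_mul]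

theorem integrableOn_exp_mul_besselKernel {z : ℂ} (hz : 0 < z.im) (k : Fin d → ℤ) :
    IntegrableOn (fun t : ℝ => Complex.exp (Complex.I * z * t) * besselKernel k t) (Ioi 0) := by
  have hi : IntegrableOn (fun t => Real.exp (-z.im * t)) (Ioi (0 : ℝ)) :=
    integrableOn_exp_mul_Ioi (neg_neg_of_pos hz) 0
  refine hi.mono' (Continuous.aestronglyMeasurable ?_) (ae_of_all _ fun t => ?_)
  · have := continuous_besselKernel k
    fun_prop
  · rw [norm_mul, norm_exp_I_mul]
    exact mul_le_of_le_one_right (Real.exp_pos _).le (norm_besselKernel_le_one k t)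

theorem latticeEntry_inverse {z : ℂ} (hz : 0 < z.im) (n m : Fin d → ℤ) :
    latticeEntry n m (Ring.inverse (latticeLaplacian d - z • ContinuousLinearMap.id ℂ _)) =
      Complex.I * ∫ t in Ioi (0 : ℝ), Complex.exp (Complex.I * z * t) * besselKernel (n - m) t := by
  rw [inverse_latticeLaplacian_sub hz, map_smul, smul_eq_mul,
    ← (latticeEntry n m).integral_comp_comm (integrableOn_exp_smul_latticePropagator hz)]
  congr 1
  refine setIntegral_congr_fun measurableSet_Ioi fun t ht => ?_
  simp only [map_smul, smul_eq_mul, latticeEntry_latticePropagator n m (mem_Ioi.1 ht).le]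

theorem latticeEntry_weightedResolvent {p : ENNReal} (u v : LatticeLp d p) (z : ℂ)
    (n m : Fin d → ℤ) :
    latticeEntry n m (weightedResolvent u v z) = u n * v m *
      latticeEntry n m (Ring.inverse (latticeLaplacian d - z • ContinuousLinearMap.id ℂ _)) := by
  have h : latticeMul v (latticeDelta m) = v m • latticeDelta m := by
    ext k
    rw [latticeMul_apply, lp.coeFn_smul, Pi.smul_apply, smul_eq_mul, latticeDelta_apply]
    split_ifs with hk
    · rw [hk]
    · simp
  rw [latticeEntry_apply, latticeEntry_apply, weightedResolvent, ContinuousLinearMap.comp_apply,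
    ContinuousLinearMap.comp_apply, h, latticeMul_apply, map_smul, lp.coeFn_smul, Pi.smul_apply,
    smul_eq_mul, mul_assoc]

theorem isCompact_latticeCut (d : ℕ) : IsCompact (latticeCut d) :=
  isCompact_Icc.image Complex.continuous_ofReal

theorem analyticOnNhd_weightedResolvent {p : ENNReal} (u v : LatticeLp d p) :
    AnalyticOnNhd ℂ (weightedResolvent u v) (latticeCut d)ᶜ := by
  refine DifferentiableOn.analyticOnNhd (fun z hz => ?_) (isCompact_latticeCut d).isClosed.isOpen_compl
  have hu := isUnit_latticeLaplacian_sub hz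
  have h1 : DifferentiableAt ℂ (fun z : ℂ =>
      latticeLaplacian d - z • ContinuousLinearMap.id ℂ (LatticeLp d 2)) z := by fun_prop
  have h2 : DifferentiableAt ℂ (fun z : ℂ => Ring.inverse
      (latticeLaplacian d - z • ContinuousLinearMap.id ℂ (LatticeLp d 2))) z :=
    DifferentiableAt.comp (𝕜 := ℂ) z (g := Ring.inverse) (differentiableAt_inverse hu) h1
  have h3 : DifferentiableAt ℂ (weightedResolvent u v) z := by
    unfold weightedResolvent
    exact (differentiableAt_const _).clm_comp (h2.clm_comp (differentiableAt_const _))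
  exact h3.differentiableWithinAt

theorem star_latticeMul {p : ENNReal} (u : LatticeLp d p) :
    star (latticeMul u) = latticeMul (star u) := by
  rw [ContinuousLinearMap.star_eq_adjoint]
  symm
  rw [ContinuousLinearMap.eq_adjoint_iff]
  intro f g
  rw [lp.inner_eq_tsum, lp.inner_eq_tsum]
  refine tsum_congr fun n => ?_
  rw [latticeMul_apply, latticeMul_apply]
  simp only [lp.star_apply, RCLike.inner_apply, map_mul, starRingEnd_apply, star_star]
  ring

/-- This symmetry exchanges the half-planes, so estimates for `Im z > 0` suffice. -/
theorem star_weightedResolvent {p : ENNReal} (u v : LatticeLp d p) (z : ℂ) :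
    star (weightedResolvent u v z) = weightedResolvent (star v) (star u) (star z) := by
  have h : star (Ring.inverse (latticeLaplacian d - z • ContinuousLinearMap.id ℂ _)) =
      Ring.inverse (latticeLaplacian d - star z • ContinuousLinearMap.id ℂ _) := by
    rw [← Ring.inverse_star]
    congr 1
    rw [star_sub, star_smul, (isSelfAdjoint_latticeLaplacian d).star_eq]
    congr 2
    exact star_one (LatticeOp d)
  have hd (u v : LatticeLp d p) (z : ℂ) : weightedResolvent u v z = latticeMul u *
    (Ring.inverse (latticeLaplacian d - z • ContinuousLinearMap.id ℂ _) * latticeMul v) := rfl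
  rw [hd, hd, star_mul, star_mul, h, star_latticeMul, star_latticeMul, mul_assoc]

/-- An operator is bounded by any bound for its finite bilinear forms. -/
theorem norm_le_of_latticeEntry_bilinear {T : LatticeOp d} {C : ℝ} (hC : 0 ≤ C)
    (h : ∀ (F : Finset (Fin d → ℤ)) (a b : (Fin d → ℤ) → ℂ),
      ‖∑ n ∈ F, ∑ m ∈ F, a n * b m * latticeEntry n m T‖ ≤
        C * √(∑ n ∈ F, ‖a n‖ ^ 2) * √(∑ m ∈ F, ‖b m‖ ^ 2)) : ‖T‖ ≤ C := by
  classical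
  have hfin (F : Finset (Fin d → ℤ)) (b : (Fin d → ℤ) → ℂ) :
      ‖T (∑ m ∈ F, b m • latticeDelta m)‖ ≤ C * √(∑ m ∈ F, ‖b m‖ ^ 2) := by
    set g := T (∑ m ∈ F, b m • latticeDelta m) with hg
    have hgn (n : Fin d → ℤ) : g n = ∑ m ∈ F, b m * latticeEntry n m T := by
      rw [hg, map_sum, lp.coeFn_sum, Finset.sum_apply]
      refine Finset.sum_congr rfl fun m _ => ?_
      rw [map_smul, lp.coeFn_smul, Pi.smul_apply, smul_eq_mul, latticeEntry_apply]
    refine lp.norm_le_of_forall_sum_le (by norm_num) (by positivity) fun s => ?_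
    have h2 : (2 : ENNReal).toReal = (2 : ℕ) := by norm_num
    simp only [h2, Real.rpow_natCast]
    -- Duality: `g = T b` is tested against its own conjugate on `s`. The union appears because the
    -- hypothesis has one finite set for both variables.
    have h3 := h (s ∪ F) (fun n => if n ∈ s then star (g n) else 0)
      (fun m => if m ∈ F then b m else 0)
    have h4 : ∑ n ∈ s ∪ F, ∑ m ∈ s ∪ F, (if n ∈ s then star (g n) else 0) *
        (if m ∈ F then b m else 0) * latticeEntry n m T = ((∑ n ∈ s, ‖g n‖ ^ 2 : ℝ) : ℂ) := by
      rw [Complex.ofReal_sum, ← Finset.sum_subset (Finset.subset_union_left (s₂ := F))]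
      · refine Finset.sum_congr rfl fun n hn => ?_
        rw [← Finset.sum_subset (Finset.subset_union_right (s₁ := s))]
        · rw [if_pos hn]
          calc _ = star (g n) * ∑ m ∈ F, b m * latticeEntry n m T := by
                rw [Finset.mul_sum]
                refine Finset.sum_congr rfl fun m hm => ?_
                rw [if_pos hm, mul_assoc]
            _ = _ := by
                rw [← hgn, Complex.star_def, Complex.conj_mul']
                push_cast
                rfl
        · intro m _ hm
          rw [if_neg hm]
          simp
      · intro n _ hn
        simp [hn]
    have h5 : ∑ n ∈ s ∪ F, ‖(if n ∈ s then star (g n) else 0 : ℂ)‖ ^ 2 = ∑ n ∈ s, ‖g n‖ ^ 2 := by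
      rw [← Finset.sum_subset (Finset.subset_union_left (s₂ := F))]
      · refine Finset.sum_congr rfl fun n hn => ?_
        rw [if_pos hn, norm_star]
      · intro n _ hn
        simp [hn]
    have h6 : ∑ m ∈ s ∪ F, ‖(if m ∈ F then b m else 0 : ℂ)‖ ^ 2 = ∑ m ∈ F, ‖b m‖ ^ 2 := by
      rw [← Finset.sum_subset (Finset.subset_union_right (s₁ := s))]
      · refine Finset.sum_congr rfl fun n hn => ?_
        rw [if_pos hn]
      · intro n _ hn
        simp [hn]
    have hS : 0 ≤ ∑ n ∈ s, ‖g n‖ ^ 2 := by positivity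
    rw [h4, h5, h6, Complex.norm_real, Real.norm_of_nonneg hS] at h3
    have h7 : √(∑ n ∈ s, ‖g n‖ ^ 2) ≤ C * √(∑ m ∈ F, ‖b m‖ ^ 2) := by
      rcases hS.eq_or_lt with h0 | h0
      · rw [← h0, Real.sqrt_zero]
        positivity
      · have h8 := Real.sqrt_pos.2 h0
        refine le_of_mul_le_mul_right ?_ h8
        rw [Real.mul_self_sqrt hS]
        linarith
    calc _ = √(∑ n ∈ s, ‖g n‖ ^ 2) ^ 2 := (Real.sq_sqrt hS).symm
      _ ≤ _ := by gcongr
  refine T.opNorm_le_bound hC fun f => ?_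
  have hsum : HasSum (fun m => f m • latticeDelta m) f := by
    convert lp.hasSum_single (by norm_num) f using 2 with m
    rw [latticeDelta, ← lp.single_smul, smul_eq_mul, mul_one]
  have hlim := (T.continuous.tendsto _).comp hsum
  refine le_of_tendsto hlim.norm (Eventually.of_forall fun F => (hfin F _).trans ?_)
  gcongr
  rw [Real.sqrt_le_left (norm_nonneg _)]
  have h2 : (2 : ENNReal).toReal = (2 : ℕ) := by norm_num
  have := lp.sum_rpow_le_norm_rpow (by norm_num) f F
  simpa only [h2, Real.rpow_natCast] using this

end LatticeResolvent

/-! ### Stein interpolation of weighted time integrals. -/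

section SteinInterpolation

variable {ι : Type*}

/-- The Hilbert-Schmidt endpoint: Cauchy-Schwarz in each variable, with only a sup bound on the
kernel. -/
theorem norm_sum_sum_mul_le (F : Finset ι) (a b x y : ι → ℂ) (G : ι → ι → ℂ) {C : ℝ}
    (hC : 0 ≤ C) (hG : ∀ n m, ‖G n m‖ ≤ C) :
    ‖∑ n ∈ F, ∑ m ∈ F, a n * b m * (x n * y m * G n m)‖ ≤
      C * (√(∑ n ∈ F, ‖a n‖ ^ 2) * √(∑ n ∈ F, ‖x n‖ ^ 2)) *
        (√(∑ m ∈ F, ‖b m‖ ^ 2) * √(∑ m ∈ F, ‖y m‖ ^ 2)) := by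
  have h1 : ‖∑ n ∈ F, ∑ m ∈ F, a n * b m * (x n * y m * G n m)‖ ≤
      ∑ n ∈ F, ∑ m ∈ F, C * ((‖a n‖ * ‖x n‖) * (‖b m‖ * ‖y m‖)) := by
    refine norm_sum_le_of_le _ fun n _ => norm_sum_le_of_le _ fun m _ => ?_
    rw [norm_mul, norm_mul, norm_mul, norm_mul]
    calc _ = ‖G n m‖ * ((‖a n‖ * ‖x n‖) * (‖b m‖ * ‖y m‖)) := by ring
      _ ≤ _ := by
        gcongr
        exact hG n m
  refine h1.trans ?_
  have h2 : ∑ n ∈ F, ∑ m ∈ F, C * ((‖a n‖ * ‖x n‖) * (‖b m‖ * ‖y m‖)) =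
      C * (∑ n ∈ F, ‖a n‖ * ‖x n‖) * ∑ m ∈ F, ‖b m‖ * ‖y m‖ := by
    rw [mul_assoc, Finset.sum_mul_sum, Finset.mul_sum]
    refine Finset.sum_congr rfl fun n _ => ?_
    rw [Finset.mul_sum]
  rw [h2]
  gcongr
  · exact Real.sum_mul_le_sqrt_mul_sqrt _ _ _
  · exact Real.sum_mul_le_sqrt_mul_sqrt _ _ _

/-- The analytic family `u |u|^{κζ-1}`. -/
noncomputable def analyticWeight (κ : ℝ) (u ζ : ℂ) : ℂ :=
  u * (‖u‖ : ℂ) ^ ((κ : ℂ) * ζ - 1)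

/-- Equality can fail at `u = 0`: the right side is `1` when `Re ζ = 0`. -/
theorem norm_analyticWeight_le {κ : ℝ} (u ζ : ℂ) :
    ‖analyticWeight κ u ζ‖ ≤ ‖u‖ ^ (κ * ζ.re) := by
  rcases eq_or_ne u 0 with rfl | hu
  · simp only [analyticWeight, zero_mul, norm_zero]
    exact Real.rpow_nonneg le_rfl _
  · have hp : 0 < ‖u‖ := norm_pos_iff.2 hu
    rw [analyticWeight, norm_mul, Complex.norm_cpow_eq_rpow_re_of_pos hp]
    simp only [Complex.sub_re, Complex.re_ofReal_mul, Complex.one_re]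
    rw [Real.rpow_sub_one hp.ne', mul_div_cancel₀ _ hp.ne']

theorem analyticWeight_eq {κ : ℝ} (hκ : κ ≠ 0) (u : ℂ) :
    analyticWeight κ u ((1 / κ : ℝ) : ℂ) = u := by
  have h : (κ : ℂ) * ((1 / κ : ℝ) : ℂ) - 1 = 0 := by
    rw [← Complex.ofReal_mul, mul_one_div_cancel hκ]
    simp
  rw [analyticWeight, h, Complex.cpow_zero, mul_one]

theorem differentiable_analyticWeight (κ : ℝ) (u : ℂ) :
    Differentiable ℂ (analyticWeight κ u) := by
  rcases eq_or_ne u 0 with rfl | hu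
  · have : analyticWeight κ 0 = fun _ => 0 := by
      funext ζ
      simp [analyticWeight]
    rw [this]
    exact differentiable_const 0
  · have hp : (‖u‖ : ℂ) ≠ 0 := by simpa using hu
    intro ζ
    unfold analyticWeight
    refine DifferentiableAt.const_mul (DifferentiableAt.const_cpow ?_ (Or.inl hp)) _
    fun_prop

/-- `∫_1^∞ t^w f(t) dt` is entire in `w` for exponentially decaying `f`. -/
theorem differentiable_integral_cpow_mul {f : ℝ → ℂ} (hf : Continuous f) {M δ : ℝ} (hδ : 0 < δ)
    (hb : ∀ t, 1 < t → ‖f t‖ ≤ M * Real.exp (-δ * t)) :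
    Differentiable ℂ fun w : ℂ => ∫ t in Ioi (1 : ℝ), (t : ℂ) ^ w * f t := by
  -- The Mellin transform carries `t^{s-1}`, whence the shift to `w + 1`.
  have heq : (fun w : ℂ => ∫ t in Ioi (1 : ℝ), (t : ℂ) ^ w * f t) =
      fun w => mellin ((Ioi 1).indicator f) (w + 1) := by
    funext w
    rw [mellin, ← integral_indicator measurableSet_Ioi, ← integral_indicator measurableSet_Ioi]
    congr 1
    funext t
    by_cases ht : t ∈ Ioi (1 : ℝ)
    · rw [indicator_of_mem ht, indicator_of_mem (mem_Ioi.2 (zero_lt_one.trans ht)),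
        indicator_of_mem ht, add_sub_cancel_right, smul_eq_mul]
    · rw [indicator_of_notMem ht]
      by_cases h0 : t ∈ Ioi (0 : ℝ)
      · rw [indicator_of_mem h0, indicator_of_notMem ht, smul_zero]
      · rw [indicator_of_notMem h0]
  rw [heq]
  intro w
  refine DifferentiableAt.comp w (g := mellin ((Ioi 1).indicator f)) ?_ (by fun_prop)
  refine mellin_differentiableAt_of_isBigO_rpow_exp (a := δ) (b := w.re) hδ ?_ ?_ ?_ (by simp)
  · exact (hf.locallyIntegrable.indicator measurableSet_Ioi).locallyIntegrableOn _
  · refine Asymptotics.IsBigO.of_bound M ?_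
    filter_upwards [eventually_gt_atTop 1] with t ht
    rw [indicator_of_mem (mem_Ioi.2 ht), Real.norm_of_nonneg (Real.exp_pos _).le]
    exact hb t ht
  · refine Asymptotics.IsBigO.of_bound 0 ?_
    filter_upwards [mem_nhdsWithin_of_mem_nhds (Iio_mem_nhds zero_lt_one)] with t ht
    rw [indicator_of_notMem (notMem_Ioi.2 (le_of_lt ht))]
    simp

/-- Stein interpolation between a contraction bound and a Hilbert-Schmidt type bound for the
weighted time integral of a family of kernels. -/
theorem norm_bilinear_integral_le {K : ι → ι → ℝ → ℂ} (hKc : ∀ n m, Continuous (K n m))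
    (hK1 : ∀ n m t, ‖K n m t‖ ≤ 1)
    (hKop : ∀ t, 1 < t → ∀ (F : Finset ι) (a b : ι → ℂ),
      ‖∑ n ∈ F, ∑ m ∈ F, a n * b m * K n m t‖ ≤
        √(∑ n ∈ F, ‖a n‖ ^ 2) * √(∑ m ∈ F, ‖b m‖ ^ 2))
    {γ γ' ε q B M M' δ Nu Nv : ℝ} (hB : 0 ≤ B)
    (hKB : ∀ n m, IntegrableOn (fun t => t ^ γ' * ‖K n m t‖) (Ioi 1) ∧
      ∫ t in Ioi (1 : ℝ), t ^ γ' * ‖K n m t‖ ≤ B)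
    (hq : 2 ≤ q) (hε : 0 < ε) (hγ' : -(1 + ε) ≤ γ')
    (hγ : γ = 2 / q * γ' - (1 - 2 / q) * (1 + ε))
    {φ : ℝ → ℂ} (hφ : Continuous φ) (hM : 0 ≤ M) (hφM : ∀ t, 1 < t → ‖φ t‖ ≤ M * t ^ γ)
    (hδ : 0 < δ) (hφδ : ∀ t, 1 < t → ‖φ t‖ ≤ M' * Real.exp (-δ * t))
    (F : Finset ι) (a b u v : ι → ℂ) (hNu : 0 ≤ Nu) (hNv : 0 ≤ Nv)
    (hu : ∑ n ∈ F, ‖u n‖ ^ q ≤ Nu ^ q) (hv : ∑ n ∈ F, ‖v n‖ ^ q ≤ Nv ^ q) :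
    ‖∑ n ∈ F, ∑ m ∈ F, a n * b m * (u n * v m * ∫ t in Ioi (1 : ℝ), φ t * K n m t)‖ ≤
      M * (B ^ (2 / q) * (1 / ε) ^ (1 - 2 / q)) * Nu * Nv *
        (√(∑ n ∈ F, ‖a n‖ ^ 2) * √(∑ m ∈ F, ‖b m‖ ^ 2)) := by
  have hq0 : 0 < q := by linarith
  have hθ0 : 0 < 2 / q := by positivity
  have hθ1 : 2 / q ≤ 1 := (div_le_one hq0).2 hq
  set S := √(∑ n ∈ F, ‖a n‖ ^ 2) * √(∑ m ∈ F, ‖b m‖ ^ 2) with hS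
  have hS0 : 0 ≤ S := by positivity
  -- The affine exponent with `t^{Re w} t^γ` equal to `t^{-1-ε}` on `Re ζ = 0` and to `t^{γ'}` on
  -- `Re ζ = 1`; by `hγ` it vanishes at `ζ = 2/q`.
  set w : ℂ → ℂ := fun ζ => ((-1 - ε - γ : ℝ) : ℂ) + ((γ' + 1 + ε : ℝ) : ℂ) * ζ with hw
  have hwre (ζ : ℂ) : (w ζ).re = -1 - ε - γ + (γ' + 1 + ε) * ζ.re := by
    simp only [hw, Complex.add_re, Complex.re_ofReal_mul, Complex.ofReal_re]
  set G : ι → ι → ℂ → ℂ := fun n m ζ => ∫ t in Ioi (1 : ℝ), (t : ℂ) ^ w ζ * (φ t * K n m t) with hG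
  -- The exponential decay of `φ` serves only here, so `M'` and `δ` do not enter the bound.
  have hGd (n m : ι) : Differentiable ℂ (G n m) := by
    have h1 := differentiable_integral_cpow_mul (hφ.mul (hKc n m)) (M := M') hδ fun t ht => by
      rw [Pi.mul_apply, norm_mul]
      exact (mul_le_of_le_one_right (norm_nonneg _) (hK1 n m t)).trans (hφδ t ht)
    exact h1.comp (g := fun w : ℂ => ∫ t in Ioi (1 : ℝ), (t : ℂ) ^ w * (φ * K n m) t)
      (f := w) (by fun_prop)
  have hGB (n m : ι) {ζ : ℂ} (hζ : ζ.re ≤ 1) : ‖G n m ζ‖ ≤ M * B := by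
    refine (norm_integral_le_of_norm_le ((hKB n m).1.const_mul M) ?_).trans ?_
    · refine (ae_restrict_iff' measurableSet_Ioi).2 (ae_of_all _ fun t ht => ?_)
      have ht0 : 0 < t := zero_lt_one.trans ht
      rw [norm_mul, norm_mul, Complex.norm_cpow_eq_rpow_re_of_pos ht0]
      calc _ ≤ t ^ (γ' - γ) * (M * t ^ γ * ‖K n m t‖) := by
            gcongr
            · exact (le_of_lt ht)
            · rw [hwre]
              nlinarith
            · exact hφM t ht
        _ = M * ((t ^ (γ' - γ) * t ^ γ) * ‖K n m t‖) := by ring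
        _ = _ := by rw [← Real.rpow_add ht0, sub_add_cancel]
    · rw [integral_const_mul]
      exact mul_le_mul_of_nonneg_left (hKB n m).2 hM
  set f : ℂ → ℂ := fun ζ => ∑ n ∈ F, ∑ m ∈ F, a n * b m *
    (analyticWeight (q / 2) (u n) ζ * analyticWeight (q / 2) (v m) ζ * G n m ζ) with hf
  have hfd : Differentiable ℂ f := by
    refine Differentiable.fun_sum fun n _ => Differentiable.fun_sum fun m _ => ?_
    have h1 := differentiable_analyticWeight (q / 2) (u n)
    have h2 := differentiable_analyticWeight (q / 2) (v m)
    have h3 := hGd n m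
    fun_prop
  have hfb : BddAbove ((norm ∘ f) '' Complex.HadamardThreeLines.verticalClosedStrip 0 1) := by
    have hW (x : ℂ) {ζ : ℂ} (h0 : 0 ≤ ζ.re) (h1 : ζ.re ≤ 1) :
        ‖analyticWeight (q / 2) x ζ‖ ≤ (1 + ‖x‖) ^ (q / 2) := by
      refine (norm_analyticWeight_le x ζ).trans ?_
      calc ‖x‖ ^ (q / 2 * ζ.re) ≤ (1 + ‖x‖) ^ (q / 2 * ζ.re) := by
            refine Real.rpow_le_rpow (norm_nonneg _) (by linarith) (by positivity)
        _ ≤ _ := by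
            refine Real.rpow_le_rpow_of_exponent_le (by linarith [norm_nonneg x]) ?_
            exact mul_le_of_le_one_right (by positivity) h1
    refine ⟨∑ n ∈ F, ∑ m ∈ F, ‖a n‖ * ‖b m‖ * ((1 + ‖u n‖) ^ (q / 2) * (1 + ‖v m‖) ^ (q / 2) *
      (M * B)), ?_⟩
    rintro _ ⟨ζ, hζ, rfl⟩
    refine norm_sum_le_of_le _ fun n _ => norm_sum_le_of_le _ fun m _ => ?_
    rw [norm_mul, norm_mul, norm_mul, norm_mul]
    gcongr
    · exact hW _ hζ.1 hζ.2
    · exact hW _ hζ.1 hζ.2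
    · exact hGB n m hζ.2
  -- On this line the weights have modulus at most one, and the contraction bound is integrated
  -- against `t^{-1-ε}`.
  have h0 : ∀ ζ ∈ Complex.re ⁻¹' {(0 : ℝ)}, ‖f ζ‖ ≤ (M * S) * (1 / ε) := by
    intro ζ hζ
    have hζ0 : ζ.re = 0 := hζ
    have hW (x : ℂ) : ‖analyticWeight (q / 2) x ζ‖ ≤ 1 := by
      refine (norm_analyticWeight_le x ζ).trans ?_
      rw [hζ0, mul_zero, Real.rpow_zero]
    have hpt (t : ℝ) (ht : 1 < t) : ‖(t : ℂ) ^ w ζ * φ t‖ ≤ M * t ^ (-1 - ε) := by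
      have ht0 : 0 < t := zero_lt_one.trans ht
      rw [norm_mul, Complex.norm_cpow_eq_rpow_re_of_pos ht0, hwre, hζ0, mul_zero, add_zero]
      calc _ ≤ t ^ (-1 - ε - γ) * (M * t ^ γ) := by
            gcongr
            exact hφM t ht
        _ = M * (t ^ (-1 - ε - γ) * t ^ γ) := by ring
        _ = _ := by rw [← Real.rpow_add ht0, sub_add_cancel]
    have hrpow : IntegrableOn (fun t : ℝ => t ^ (-1 - ε)) (Ioi 1) :=
      integrableOn_Ioi_rpow_of_lt (by linarith) zero_lt_one
    have hint (n m : ι) : IntegrableOn (fun t : ℝ => (t : ℂ) ^ w ζ * (φ t * K n m t)) (Ioi 1) := by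
      refine (hrpow.const_mul M).mono' ?_ ?_
      · refine ContinuousOn.aestronglyMeasurable (ContinuousOn.mul ?_
          (hφ.mul (hKc n m)).continuousOn) measurableSet_Ioi
        refine ContinuousOn.cpow_const (by fun_prop) fun t ht => ?_
        exact Complex.ofReal_mem_slitPlane.2 (zero_lt_one.trans ht)
      · refine (ae_restrict_iff' measurableSet_Ioi).2 (ae_of_all _ fun t ht => ?_)
        rw [← mul_assoc, norm_mul]
        exact (mul_le_of_le_one_right (norm_nonneg _) (hK1 n m t)).trans (hpt t ht)
    have hsum : f ζ = ∫ t in Ioi (1 : ℝ), (t : ℂ) ^ w ζ * φ t * ∑ n ∈ F, ∑ m ∈ F,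
        (a n * analyticWeight (q / 2) (u n) ζ) * (b m * analyticWeight (q / 2) (v m) ζ) *
          K n m t := by
      simp only [Finset.mul_sum]
      rw [integral_finsetSum]
      · refine Finset.sum_congr rfl fun n _ => ?_
        rw [integral_finsetSum]
        · refine Finset.sum_congr rfl fun m _ => ?_
          rw [hG]
          simp only
          rw [← integral_const_mul, ← integral_const_mul]
          refine integral_congr_ae (ae_of_all _ fun t => ?_)
          simp only
          ring
        · intro m _
          refine ((hint n m).const_mul (a n * analyticWeight (q / 2) (u n) ζ *
            (b m * analyticWeight (q / 2) (v m) ζ))).congr (ae_of_all _ fun t => ?_)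
          simp only
          ring
      · intro n _
        refine integrable_finsetSum _ fun m _ => ?_
        refine ((hint n m).const_mul (a n * analyticWeight (q / 2) (u n) ζ *
          (b m * analyticWeight (q / 2) (v m) ζ))).congr (ae_of_all _ fun t => ?_)
        simp only
        ring
    have hsq (c x : ι → ℂ) : √(∑ n ∈ F, ‖c n * analyticWeight (q / 2) (x n) ζ‖ ^ 2) ≤
        √(∑ n ∈ F, ‖c n‖ ^ 2) := by
      refine Real.sqrt_le_sqrt (Finset.sum_le_sum fun n _ => ?_)
      rw [norm_mul]
      gcongr
      exact mul_le_of_le_one_right (norm_nonneg _) (hW _)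
    rw [hsum]
    refine (norm_integral_le_of_norm_le (hrpow.const_mul (M * S)) ?_).trans (le_of_eq ?_)
    · refine (ae_restrict_iff' measurableSet_Ioi).2 (ae_of_all _ fun t ht => ?_)
      rw [norm_mul]
      calc _ ≤ M * t ^ (-1 - ε) * S := by
            gcongr
            · exact mul_nonneg hM (Real.rpow_nonneg (zero_lt_one.trans ht).le _)
            · exact hpt t ht
            · refine (hKop t ht F _ _).trans ?_
              rw [hS]
              gcongr ?_ * ?_
              · exact hsq a u
              · exact hsq b v
        _ = _ := by ring
    · rw [integral_const_mul, integral_Ioi_rpow_of_lt (by linarith) zero_lt_one, Real.one_rpow]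
      congr 1
      rw [show -1 - ε + 1 = -ε by ring, neg_div_neg_eq]
  -- On this line the weights are bounded by `|u|^{q/2}` and `|v|^{q/2}`, which are in `ℓ²`.
  have h1 : ∀ ζ ∈ Complex.re ⁻¹' {(1 : ℝ)}, ‖f ζ‖ ≤
      (M * S) * (B * (Nu ^ (q / 2) * Nv ^ (q / 2))) := by
    intro ζ hζ
    have hζ1 : ζ.re = 1 := hζ
    have hW (x : ι → ℂ) {N : ℝ} (hN : 0 ≤ N) (hx : ∑ n ∈ F, ‖x n‖ ^ q ≤ N ^ q) :
        √(∑ n ∈ F, ‖analyticWeight (q / 2) (x n) ζ‖ ^ 2) ≤ N ^ (q / 2) := by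
      rw [Real.sqrt_le_left (by positivity), ← Real.rpow_mul_natCast hN]
      refine le_trans (Finset.sum_le_sum fun n _ => ?_) (hx.trans (le_of_eq ?_))
      · have h2 := norm_analyticWeight_le (κ := q / 2) (x n) ζ
        rw [hζ1, mul_one] at h2
        calc _ ≤ (‖x n‖ ^ (q / 2)) ^ 2 := by gcongr
          _ = _ := by
            rw [← Real.rpow_mul_natCast (norm_nonneg _)]
            congr 1
            push_cast
            ring
      · congr 1
        push_cast
        ring
    refine (norm_sum_sum_mul_le F a b _ _ _ (mul_nonneg hM hB) fun n m =>
      hGB n m hζ1.le).trans ?_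
    calc _ ≤ M * B * (√(∑ n ∈ F, ‖a n‖ ^ 2) * Nu ^ (q / 2)) *
          (√(∑ m ∈ F, ‖b m‖ ^ 2) * Nv ^ (q / 2)) := by
          gcongr
          · exact hW u hNu hu
          · exact hW v hNv hv
      _ = _ := by
          rw [hS]
          ring
  have hfin := Complex.HadamardThreeLines.norm_le_interp_of_mem_verticalClosedStrip₀₁' f
    (z := ((2 / q : ℝ) : ℂ)) ⟨by rw [Complex.ofReal_re]; exact hθ0.le,
      by rw [Complex.ofReal_re]; exact hθ1⟩ hfd.diffContOnCl hfb h0 h1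
  have hw0 : w ((2 / q : ℝ) : ℂ) = 0 := by
    rw [hw]
    simp only
    rw [← Complex.ofReal_mul, ← Complex.ofReal_add, Complex.ofReal_eq_zero, hγ]
    ring
  have hft : f ((2 / q : ℝ) : ℂ) = ∑ n ∈ F, ∑ m ∈ F, a n * b m *
      (u n * v m * ∫ t in Ioi (1 : ℝ), φ t * K n m t) := by
    rw [hf]
    simp only
    refine Finset.sum_congr rfl fun n _ => Finset.sum_congr rfl fun m _ => ?_
    have h2 (x : ℂ) : analyticWeight (q / 2) x ((2 / q : ℝ) : ℂ) = x := by
      have := analyticWeight_eq (κ := q / 2) (by positivity) x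
      rwa [one_div_div] at this
    rw [h2, h2, hG]
    simp only [hw0, Complex.cpow_zero, one_mul]
  rw [hft, Complex.ofReal_re] at hfin
  refine hfin.trans (le_of_eq ?_)
  have hNN (N : ℝ) (hN : 0 ≤ N) : (N ^ (q / 2)) ^ (2 / q) = N := by
    rw [← Real.rpow_mul hN, div_mul_div_cancel₀ two_ne_zero, div_self hq0.ne', Real.rpow_one]
  have hMS : (M * S) ^ (1 - 2 / q) * (M * S) ^ (2 / q) = M * S := by
    rw [← Real.rpow_add_of_nonneg (by positivity) (by linarith) hθ0.le, sub_add_cancel,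
      Real.rpow_one]
  rw [Real.mul_rpow (x := M * S) (by positivity) (by positivity),
    Real.mul_rpow (x := M * S) (by positivity) (by positivity),
    Real.mul_rpow (x := B) hB (by positivity),
    Real.mul_rpow (x := Nu ^ (q / 2)) (by positivity) (by positivity), hNN Nu hNu, hNN Nv hNv]
  linear_combination ((1 / ε) ^ (1 - 2 / q) * B ^ (2 / q) * Nu * Nv) * hMS

end SteinInterpolation

/-! ### Operator bounds from kernel integrals. -/

section LatticeEstimate

variable {d : ℕ}

theorem norm_sum_sum_latticeEntry_le (T : LatticeOp d) (F : Finset (Fin d → ℤ))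
    (a b : (Fin d → ℤ) → ℂ) :
    ‖∑ n ∈ F, ∑ m ∈ F, a n * b m * latticeEntry n m T‖ ≤
      ‖T‖ * (√(∑ n ∈ F, ‖a n‖ ^ 2) * √(∑ m ∈ F, ‖b m‖ ^ 2)) := by
  classical
  have h2 : (2 : ENNReal).toReal = (2 : ℕ) := by norm_num
  set f : LatticeLp d 2 := ∑ m ∈ F, lp.single 2 m (b m) with hf
  have hfn : ‖f‖ = √(∑ m ∈ F, ‖b m‖ ^ 2) := by
    have h := lp.norm_sum_single (p := 2) (by norm_num) b F
    rw [← hf, h2] at h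
    simp only [Real.rpow_natCast] at h
    rw [← h, Real.sqrt_sq (norm_nonneg _)]
  have hT (n : Fin d → ℤ) : ∑ m ∈ F, b m * latticeEntry n m T = T f n := by
    rw [hf, map_sum, lp.coeFn_sum, Finset.sum_apply]
    refine Finset.sum_congr rfl fun m _ => ?_
    have h : lp.single 2 m (b m) = b m • latticeDelta m := by
      rw [latticeDelta, ← lp.single_smul, smul_eq_mul, mul_one]
    rw [h, map_smul, lp.coeFn_smul, Pi.smul_apply, smul_eq_mul, latticeEntry_apply]
  have hsum : ∑ n ∈ F, ∑ m ∈ F, a n * b m * latticeEntry n m T = ∑ n ∈ F, a n * T f n := by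
    refine Finset.sum_congr rfl fun n _ => ?_
    rw [← hT, Finset.mul_sum]
    exact Finset.sum_congr rfl fun m _ => mul_assoc _ _ _
  have hTf : √(∑ n ∈ F, ‖T f n‖ ^ 2) ≤ ‖T‖ * ‖f‖ := by
    refine le_trans ?_ (T.le_opNorm f)
    rw [Real.sqrt_le_left (norm_nonneg _)]
    have h := lp.sum_rpow_le_norm_rpow (by norm_num) (T f) F
    simpa only [h2, Real.rpow_natCast] using h
  rw [hsum]
  calc ‖∑ n ∈ F, a n * T f n‖ ≤ ∑ n ∈ F, ‖a n‖ * ‖T f n‖ :=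
        norm_sum_le_of_le _ fun n _ => (norm_mul _ _).le
    _ ≤ √(∑ n ∈ F, ‖a n‖ ^ 2) * √(∑ n ∈ F, ‖T f n‖ ^ 2) := Real.sum_mul_le_sqrt_mul_sqrt _ _ _
    _ ≤ √(∑ n ∈ F, ‖a n‖ ^ 2) * (‖T‖ * ‖f‖) := by gcongr
    _ = _ := by
      rw [hfn]
      ring

theorem norm_sum_sum_besselKernel_le {t : ℝ} (ht : 0 ≤ t) (F : Finset (Fin d → ℤ))
    (a b : (Fin d → ℤ) → ℂ) :
    ‖∑ n ∈ F, ∑ m ∈ F, a n * b m * besselKernel (n - m) t‖ ≤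
      √(∑ n ∈ F, ‖a n‖ ^ 2) * √(∑ m ∈ F, ‖b m‖ ^ 2) := by
  have h := norm_sum_sum_latticeEntry_le (latticePropagator d t) F a b
  simp only [latticeEntry_latticePropagator _ _ ht] at h
  exact h.trans (mul_le_of_le_one_left (by positivity) (norm_latticePropagator_le t))

theorem norm_sum_sum_integral_Ioc_le {φ : ℝ → ℂ} (hφ : Continuous φ) {M Nu Nv : ℝ}
    (hM : 0 ≤ M) (hφM : ∀ t ∈ Ioc (0 : ℝ) 1, ‖φ t‖ ≤ M) (F : Finset (Fin d → ℤ))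
    (a b u v : (Fin d → ℤ) → ℂ) (hNu : 0 ≤ Nu) (hu : ∀ n, ‖u n‖ ≤ Nu) (hNv : 0 ≤ Nv)
    (hv : ∀ n, ‖v n‖ ≤ Nv) :
    ‖∑ n ∈ F, ∑ m ∈ F, a n * b m *
      (u n * v m * ∫ t in Ioc (0 : ℝ) 1, φ t * besselKernel (n - m) t)‖ ≤
      M * Nu * Nv * (√(∑ n ∈ F, ‖a n‖ ^ 2) * √(∑ m ∈ F, ‖b m‖ ^ 2)) := by
  have hint (c : ℂ) (k : Fin d → ℤ) :
      IntegrableOn (fun t : ℝ => c * (φ t * besselKernel k t)) (Ioc 0 1) :=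
    ((continuous_const.mul (hφ.mul (continuous_besselKernel k))).integrableOn_Icc).mono_set
      Ioc_subset_Icc_self
  have hsum : ∑ n ∈ F, ∑ m ∈ F, a n * b m *
      (u n * v m * ∫ t in Ioc (0 : ℝ) 1, φ t * besselKernel (n - m) t) =
      ∫ t in Ioc (0 : ℝ) 1, φ t * ∑ n ∈ F, ∑ m ∈ F,
        (a n * u n) * (b m * v m) * besselKernel (n - m) t := by
    have h (t : ℝ) : φ t * ∑ n ∈ F, ∑ m ∈ F,
        (a n * u n) * (b m * v m) * besselKernel (n - m) t = ∑ n ∈ F, ∑ m ∈ F,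
        (a n * b m * (u n * v m)) * (φ t * besselKernel (n - m) t) := by
      simp only [Finset.mul_sum]
      refine Finset.sum_congr rfl fun n _ => Finset.sum_congr rfl fun m _ => ?_
      ring
    simp only [h]
    rw [integral_finsetSum _ fun n _ => integrable_finsetSum _ fun m _ => hint _ _]
    refine Finset.sum_congr rfl fun n _ => ?_
    rw [integral_finsetSum _ fun m _ => hint _ _]
    refine Finset.sum_congr rfl fun m _ => ?_
    rw [integral_const_mul, mul_assoc (a n * b m)]
  have hsq (c x : (Fin d → ℤ) → ℂ) {N : ℝ} (hN : 0 ≤ N) (hx : ∀ n, ‖x n‖ ≤ N) :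
      √(∑ n ∈ F, ‖c n * x n‖ ^ 2) ≤ N * √(∑ n ∈ F, ‖c n‖ ^ 2) := by
    rw [Real.sqrt_le_left (by positivity), mul_pow, Real.sq_sqrt (by positivity), Finset.mul_sum]
    refine Finset.sum_le_sum fun n _ => ?_
    rw [norm_mul, mul_pow, mul_comm]
    gcongr
    exact hx n
  rw [hsum]
  refine (norm_setIntegral_le_of_norm_le_const (C := M * Nu * Nv *
    (√(∑ n ∈ F, ‖a n‖ ^ 2) * √(∑ m ∈ F, ‖b m‖ ^ 2))) (by simp) fun t ht => ?_).trans (by simp)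
  rw [norm_mul]
  calc _ ≤ M * ((Nu * √(∑ n ∈ F, ‖a n‖ ^ 2)) * (Nv * √(∑ m ∈ F, ‖b m‖ ^ 2))) := by
        gcongr
        · exact hφM t ht
        · refine (norm_sum_sum_besselKernel_le ht.1.le F _ _).trans ?_
          gcongr
          · exact hsq a u hNu hu
          · exact hsq b v hNv hv
    _ = _ := by ring

/-- Bound for an operator whose matrix entries are weighted time averages of the propagator. -/
theorem norm_le_of_latticeEntry_eq_integral {q : ℝ} (hq : 2 ≤ q)
    (u v : LatticeLp d (ENNReal.ofReal q)) {T : LatticeOp d} {φ : ℝ → ℂ} (hφ : Continuous φ)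
    (hT : ∀ n m, latticeEntry n m T =
      Complex.I * (u n * v m * ∫ t in Ioi (0 : ℝ), φ t * besselKernel (n - m) t))
    {γ γ' ε B M M' δ : ℝ} (hB : 0 ≤ B)
    (hKB : ∀ k : Fin d → ℤ, IntegrableOn (fun t => t ^ γ' * ‖besselKernel k t‖) (Ioi 1) ∧
      ∫ t in Ioi (1 : ℝ), t ^ γ' * ‖besselKernel k t‖ ≤ B)
    (hε : 0 < ε) (hγ' : -(1 + ε) ≤ γ') (hγ0 : 0 ≤ γ)
    (hγ : γ = 2 / q * γ' - (1 - 2 / q) * (1 + ε))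
    (hM : 0 ≤ M) (hφM : ∀ t, 0 < t → ‖φ t‖ ≤ M * t ^ γ)
    (hδ : 0 < δ) (hφδ : ∀ t, 0 < t → ‖φ t‖ ≤ M' * Real.exp (-δ * t)) :
    ‖T‖ ≤ M * (1 + B ^ (2 / q) * (1 / ε) ^ (1 - 2 / q)) * ‖u‖ * ‖v‖ := by
  have hq0 : 0 < q := by linarith
  have hp : (ENNReal.ofReal q).toReal = q := ENNReal.toReal_ofReal hq0.le
  have hp0 : ENNReal.ofReal q ≠ 0 := (ENNReal.ofReal_pos.2 hq0).ne'
  have hn (x : LatticeLp d (ENNReal.ofReal q)) : 0 ≤ ‖x‖ := lp.norm_nonneg' x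
  have hsum (x : LatticeLp d (ENNReal.ofReal q)) (F : Finset (Fin d → ℤ)) :
      ∑ n ∈ F, ‖x n‖ ^ q ≤ ‖x‖ ^ q := by
    have h := lp.sum_rpow_le_norm_rpow (by rwa [hp]) x F
    rwa [hp] at h
  have hint (k : Fin d → ℤ) : IntegrableOn (fun t => φ t * besselKernel k t) (Ioi 0) := by
    refine ((integrableOn_exp_mul_Ioi (neg_neg_of_pos hδ) 0).const_mul M').mono'
      (hφ.mul (continuous_besselKernel k)).aestronglyMeasurable ?_
    refine (ae_restrict_iff' measurableSet_Ioi).2 (ae_of_all _ fun t ht => ?_)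
    rw [norm_mul]
    exact (mul_le_of_le_one_right (norm_nonneg _) (norm_besselKernel_le_one k t)).trans (hφδ t ht)
  have hsplit (k : Fin d → ℤ) : ∫ t in Ioi (0 : ℝ), φ t * besselKernel k t =
      (∫ t in Ioc (0 : ℝ) 1, φ t * besselKernel k t) +
        ∫ t in Ioi (1 : ℝ), φ t * besselKernel k t := by
    rw [← Ioc_union_Ioi_eq_Ioi zero_le_one]
    exact setIntegral_union (Ioc_disjoint_Ioi le_rfl) measurableSet_Ioi
      ((hint k).mono_set Ioc_subset_Ioi_self) ((hint k).mono_set (Ioi_subset_Ioi zero_le_one))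
  refine norm_le_of_latticeEntry_bilinear ?_ fun F a b => ?_
  · have := hn u
    have := hn v
    positivity
  -- For short times `t^γ ≤ 1`, as `γ ≥ 0`, and sup norms are bounded by `ℓ^q` norms; this is the
  -- summand `1` in the constant.
  have h1 := norm_sum_sum_integral_Ioc_le hφ hM (fun t ht => (hφM t ht.1).trans
    (mul_le_of_le_one_right hM (Real.rpow_le_one ht.1.le ht.2 hγ0))) F a b u v (hn u)
    (lp.norm_apply_le_norm hp0 u) (hn v) (lp.norm_apply_le_norm hp0 v)
  have h2 := norm_bilinear_integral_le (K := fun n m : Fin d → ℤ => besselKernel (n - m))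
    (fun n m => continuous_besselKernel _) (fun n m t => norm_besselKernel_le_one _ t)
    (fun t ht => norm_sum_sum_besselKernel_le (zero_le_one.trans ht.le)) hB (fun n m => hKB (n - m))
    hq hε hγ' hγ hφ hM (fun t ht => hφM t (zero_lt_one.trans ht)) hδ
    (fun t ht => hφδ t (zero_lt_one.trans ht)) F a b u v (hn u) (hn v) (hsum u F) (hsum v F)
  have h3 : ∑ n ∈ F, ∑ m ∈ F, a n * b m * latticeEntry n m T = Complex.I *
      ((∑ n ∈ F, ∑ m ∈ F, a n * b m *
        (u n * v m * ∫ t in Ioc (0 : ℝ) 1, φ t * besselKernel (n - m) t)) +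
      ∑ n ∈ F, ∑ m ∈ F, a n * b m *
        (u n * v m * ∫ t in Ioi (1 : ℝ), φ t * besselKernel (n - m) t)) := by
    rw [← Finset.sum_add_distrib, Finset.mul_sum]
    refine Finset.sum_congr rfl fun n _ => ?_
    rw [← Finset.sum_add_distrib, Finset.mul_sum]
    refine Finset.sum_congr rfl fun m _ => ?_
    rw [hT, hsplit]
    ring
  rw [h3, norm_mul, Complex.norm_I, one_mul]
  calc _ ≤ _ := (norm_add_le _ _).trans (add_le_add h1 h2)
    _ = _ := by ring

/-- Geometric interpolation between the bounds `2` and `t|z - z'|`; Bernoulli's inequality gives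
`2^{1-γ} ≤ 2 - γ`. -/
theorem norm_exp_I_mul_sub_le {z z' : ℂ} (hz : 0 ≤ z.im) (hz' : 0 ≤ z'.im) {γ : ℝ}
    (hγ0 : 0 ≤ γ) (hγ1 : γ ≤ 1) {t : ℝ} (ht : 0 < t) :
    ‖Complex.exp (Complex.I * z * t) - Complex.exp (Complex.I * z' * t)‖ ≤
      ‖z - z'‖ ^ γ * (2 - γ) * t ^ γ := by
  set y := ‖Complex.exp (Complex.I * z * t) - Complex.exp (Complex.I * z' * t)‖ with hy
  have hy0 : 0 ≤ y := norm_nonneg _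
  have h2 : y ≤ 2 := by
    refine (norm_sub_le _ _).trans ?_
    linarith [norm_exp_I_mul_le_one hz ht.le, norm_exp_I_mul_le_one hz' ht.le]
  have h1 : y ≤ t * ‖z - z'‖ := by
    have hre (w : ℂ) (hw : 0 ≤ w.im) : (Complex.I * w * t).re ≤ 0 := by
      simp only [Complex.mul_re, Complex.I_re, Complex.I_im, Complex.ofReal_im]
      simp only [zero_mul, one_mul, zero_sub, mul_zero, sub_zero, Complex.ofReal_re]
      nlinarith [mul_nonneg hw ht.le]
    have h := (convex_halfSpace_re_le (0 : ℝ)).norm_image_sub_le_of_norm_hasDerivWithin_le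
      (f := Complex.exp) (f' := Complex.exp) (C := 1)
      (fun x _ => (Complex.hasDerivAt_exp x).hasDerivWithinAt)
      (fun x hx => by
        rw [Complex.norm_exp]
        exact Real.exp_le_one_iff.2 hx) (hre z' hz') (hre z hz)
    refine h.trans (le_of_eq ?_)
    rw [one_mul, ← sub_mul, ← mul_sub, norm_mul, norm_mul, Complex.norm_I, one_mul,
      Complex.norm_real, Real.norm_of_nonneg ht.le, mul_comm]
  have hB : (2 : ℝ) ^ (1 - γ) ≤ 2 - γ := by
    have h := rpow_one_add_le_one_add_mul_self (s := 1) (p := 1 - γ) (by norm_num) (by linarith)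
      (by linarith)
    norm_num at h
    linarith
  calc y = y ^ (1 - γ) * y ^ γ := by
        rw [← Real.rpow_add_of_nonneg hy0 (by linarith) hγ0, sub_add_cancel, Real.rpow_one]
    _ ≤ 2 ^ (1 - γ) * (t * ‖z - z'‖) ^ γ := by
        gcongr
    _ ≤ (2 - γ) * (t * ‖z - z'‖) ^ γ := by gcongr
    _ = _ := by
        rw [Real.mul_rpow ht.le (norm_nonneg _)]
        ring

theorem continuous_exp_I_mul (z : ℂ) : Continuous fun t : ℝ => Complex.exp (Complex.I * z * t) := by
  fun_prop

theorem latticeEntry_weightedResolvent_eq_integral {p : ENNReal} (u v : LatticeLp d p) {z : ℂ}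
    (hz : 0 < z.im) (n m : Fin d → ℤ) :
    latticeEntry n m (weightedResolvent u v z) = Complex.I * (u n * v m *
      ∫ t in Ioi (0 : ℝ), Complex.exp (Complex.I * z * t) * besselKernel (n - m) t) := by
  rw [latticeEntry_weightedResolvent, latticeEntry_inverse hz]
  ring

variable {q : ℝ} {γ γ' ε B : ℝ}

theorem norm_weightedResolvent_le_of_integral_le (hq : 2 ≤ q)
    (u v : LatticeLp d (ENNReal.ofReal q)) (hB : 0 ≤ B)
    (hKB : ∀ k : Fin d → ℤ, IntegrableOn (fun t => t ^ γ' * ‖besselKernel k t‖) (Ioi 1) ∧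
      ∫ t in Ioi (1 : ℝ), t ^ γ' * ‖besselKernel k t‖ ≤ B)
    (hε : 0 < ε) (hγ' : -(1 + ε) ≤ γ') (hγ : 0 = 2 / q * γ' - (1 - 2 / q) * (1 + ε))
    {z : ℂ} (hz : 0 < z.im) :
    ‖weightedResolvent u v z‖ ≤ (1 + B ^ (2 / q) * (1 / ε) ^ (1 - 2 / q)) * ‖u‖ * ‖v‖ := by
  have h := norm_le_of_latticeEntry_eq_integral hq u v (continuous_exp_I_mul z)
    (latticeEntry_weightedResolvent_eq_integral u v hz) hB hKB hε hγ' le_rfl hγ zero_le_one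
    (fun t ht => by
      rw [Real.rpow_zero, mul_one]
      exact norm_exp_I_mul_le_one hz.le ht.le) (M' := 1) hz
    (fun t _ => by rw [norm_exp_I_mul, one_mul])
  rwa [one_mul] at h

theorem norm_weightedResolvent_sub_le_of_integral_le (hq : 2 ≤ q)
    (u v : LatticeLp d (ENNReal.ofReal q)) (hB : 0 ≤ B)
    (hKB : ∀ k : Fin d → ℤ, IntegrableOn (fun t => t ^ γ' * ‖besselKernel k t‖) (Ioi 1) ∧
      ∫ t in Ioi (1 : ℝ), t ^ γ' * ‖besselKernel k t‖ ≤ B)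
    (hε : 0 < ε) (hγ' : -(1 + ε) ≤ γ') (hγ0 : 0 ≤ γ) (hγ1 : γ ≤ 1)
    (hγ : γ = 2 / q * γ' - (1 - 2 / q) * (1 + ε))
    {z z' : ℂ} (hz : 0 < z.im) (hz' : 0 < z'.im) :
    ‖weightedResolvent u v z - weightedResolvent u v z'‖ ≤ ‖z - z'‖ ^ γ *
      ((2 - γ) * (1 + B ^ (2 / q) * (1 / ε) ^ (1 - 2 / q))) * ‖u‖ * ‖v‖ := by
  have hM : 0 ≤ ‖z - z'‖ ^ γ * (2 - γ) := mul_nonneg (by positivity) (by linarith)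
  have h := norm_le_of_latticeEntry_eq_integral hq u v
    ((continuous_exp_I_mul z).sub (continuous_exp_I_mul z'))
    (T := weightedResolvent u v z - weightedResolvent u v z') (fun n m => by
      rw [map_sub, latticeEntry_weightedResolvent_eq_integral u v hz,
        latticeEntry_weightedResolvent_eq_integral u v hz', ← mul_sub, ← mul_sub,
        ← integral_sub (integrableOn_exp_mul_besselKernel hz _)
          (integrableOn_exp_mul_besselKernel hz' _)]
      simp only [Pi.sub_apply, sub_mul]) hB hKB hε hγ' hγ0 hγ hM
    (fun t ht => norm_exp_I_mul_sub_le hz.le hz'.le hγ0 hγ1 ht) (M' := 2)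
    (lt_min hz hz') (fun t ht => by
      refine (norm_sub_le _ _).trans ?_
      rw [norm_exp_I_mul, norm_exp_I_mul, two_mul]
      gcongr
      · exact min_le_left _ _
      · exact min_le_right _ _)
  rwa [mul_assoc (‖z - z'‖ ^ γ)] at h

end LatticeEstimate

/-! ### Time integrals of the Bessel kernel. -/

section KernelIntegral

variable {d : ℕ}

/-- Integrals of the kernel over `(1, ∞)` are controlled by any average of dominating functions. -/
theorem integral_besselKernel_le_of_le_sum {ι : Type*} {s : Finset ι} {k : Fin d → ℤ}
    {γ' c A : ℝ} {g : ι → ℝ → ℝ} (hg : ∀ i ∈ s, IntegrableOn (g i) (Ioi 1) ∧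
      ∫ t in Ioi (1 : ℝ), g i t ≤ A) (hc : 0 ≤ c)
    (h : ∀ t, 1 < t → t ^ γ' * ‖besselKernel k t‖ ≤ c * ∑ i ∈ s, g i t) :
    IntegrableOn (fun t => t ^ γ' * ‖besselKernel k t‖) (Ioi 1) ∧
      ∫ t in Ioi (1 : ℝ), t ^ γ' * ‖besselKernel k t‖ ≤ c * (s.card * A) := by
  have hG : IntegrableOn (fun t => c * ∑ i ∈ s, g i t) (Ioi 1) :=
    (integrable_finsetSum s fun i hi => (hg i hi).1).const_mul c
  have hint : IntegrableOn (fun t => t ^ γ' * ‖besselKernel k t‖) (Ioi 1) := by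
    refine Integrable.mono' hG ?_ ?_
    · refine ContinuousOn.aestronglyMeasurable (ContinuousOn.mul ?_
        (continuous_besselKernel k).norm.continuousOn) measurableSet_Ioi
      exact ContinuousOn.rpow_const continuousOn_id fun t ht => Or.inl (zero_lt_one.trans ht).ne'
    · refine (ae_restrict_iff' measurableSet_Ioi).2 (ae_of_all _ fun t ht => ?_)
      rw [Real.norm_of_nonneg (mul_nonneg (Real.rpow_nonneg (zero_lt_one.trans ht).le _)
        (norm_nonneg _))]
      exact h t ht
  refine ⟨hint, (setIntegral_mono_on hint hG measurableSet_Ioi h).trans ?_⟩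
  rw [integral_const_mul, integral_finsetSum s fun i hi => (hg i hi).1, ← nsmul_eq_mul]
  gcongr
  exact Finset.sum_le_card_nsmul _ _ _ fun i hi => (hg i hi).2

theorem mul_mul_le_sum_pow_three {a b c : ℝ} (ha : 0 ≤ a) (hb : 0 ≤ b) (hc : 0 ≤ c) :
    a * b * c ≤ 1 / 3 * (a ^ 3 + b ^ 3 + c ^ 3) := by
  nlinarith [mul_nonneg (add_nonneg (add_nonneg ha hb) hc)
    (add_nonneg (add_nonneg (sq_nonneg (a - b)) (sq_nonneg (b - c))) (sq_nonneg (a - c)))]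

theorem mul_mul_mul_le_sum_pow_four (a b c e : ℝ) :
    a * b * c * e ≤ 1 / 4 * (a ^ 4 + b ^ 4 + c ^ 4 + e ^ 4) := by
  nlinarith [sq_nonneg (a * b - c * e), sq_nonneg (a ^ 2 - b ^ 2), sq_nonneg (c ^ 2 - e ^ 2)]

theorem integral_besselKernel_three_le (k : Fin 3 → ℤ) {γ' : ℝ} (hγ' : γ' < 1 / 2) :
    IntegrableOn (fun t => t ^ γ' * ‖besselKernel k t‖) (Ioi 1) ∧
      ∫ t in Ioi (1 : ℝ), t ^ γ' * ‖besselKernel k t‖ ≤ 93 / 50 + 7 / 4 / (1 - 2 * γ') := by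
  have h := integral_besselKernel_le_of_le_sum (s := Finset.univ) (k := k) (γ' := γ') (c := 1 / 3)
    (g := fun j t => t ^ γ' * |besselJ (k j) t| ^ 3) (A := 93 / 50 + 7 / 4 / (1 - 2 * γ'))
    (fun j _ => by
      have := integral_besselJ_pow_three_le (k j).natAbs hγ'
      simpa only [abs_besselJ_natAbs] using this) (by norm_num) fun t ht => by
    rw [norm_besselKernel, Fin.prod_univ_three, Fin.sum_univ_three, ← mul_add, ← mul_add,
      mul_left_comm (1 / 3 : ℝ)]
    exact mul_le_mul_of_nonneg_left (mul_mul_le_sum_pow_three (abs_nonneg _) (abs_nonneg _)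
      (abs_nonneg _)) (Real.rpow_nonneg (zero_lt_one.trans ht).le _)
  refine ⟨h.1, h.2.trans (le_of_eq ?_)⟩
  rw [Finset.card_univ, Fintype.card_fin]
  push_cast
  ring

theorem abs_besselJ_le_mul_rpow (n : ℤ) {t : ℝ} (ht : 1 ≤ t) :
    |besselJ n t| ≤ 17 / 10 * t ^ (-(1 / 3) : ℝ) := by
  have ht0 : 0 < t := zero_lt_one.trans_le ht
  have h := abs_besselJ_pow_three_mul_le n.natAbs ht
  rw [abs_besselJ_natAbs] at h
  refine le_of_pow_le_pow_left₀ (n := 3) (by norm_num) (by positivity) ?_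
  rw [mul_pow, ← Real.rpow_mul_natCast ht0.le]
  norm_num [Real.rpow_neg_one]
  rw [← div_eq_mul_inv, le_div_iff₀ ht0]
  linarith

/-- Four factors go into the fourth-power integral. The other `e` factors are each at most `min(1,
1.7 t^{-1/3})`, so any real number `μ ≤ e` of them may be used: the decay `t^{-μ/3}` is bought at
the price `1.7^μ`. -/
theorem integral_besselKernel_four_add_le {e : ℕ} (k : Fin (4 + e) → ℤ) {γ' γ₀ μ : ℝ}
    (hγ₀ : 0 ≤ γ₀) (hγ₁ : γ₀ < 1) (hμ₀ : 0 ≤ μ) (hμ : μ ≤ e) (h : γ' - μ / 3 ≤ γ₀) :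
    IntegrableOn (fun t => t ^ γ' * ‖besselKernel k t‖) (Ioi 1) ∧
      ∫ t in Ioi (1 : ℝ), t ^ γ' * ‖besselKernel k t‖ ≤
        (17 / 10) ^ μ * (11 / 20 + γ₀ + 83 / 100 / (1 - γ₀)) := by
  have h := integral_besselKernel_le_of_le_sum (s := (Finset.univ : Finset (Fin 4))) (k := k)
    (γ' := γ') (c := (17 / 10) ^ μ * (1 / 4))
    (g := fun j t => t ^ γ₀ * |besselJ (k (Fin.castAdd e j)) t| ^ 4)
    (A := 11 / 20 + γ₀ + 83 / 100 / (1 - γ₀))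
    (fun j _ => by
      have := integral_besselJ_pow_four_le (k (Fin.castAdd e j)).natAbs hγ₀ hγ₁
      simpa only [abs_besselJ_natAbs] using this) (by positivity) fun t ht => by
    have ht0 : 0 < t := zero_lt_one.trans ht
    set y := 17 / 10 * t ^ (-(1 / 3) : ℝ) with hy
    have hy0 : 0 < y := by positivity
    have hm0 : 0 < min 1 y := lt_min zero_lt_one hy0
    have hprod : ∏ j : Fin e, |besselJ (k (Fin.natAdd 4 j)) t| ≤ y ^ μ := by
      calc ∏ j : Fin e, |besselJ (k (Fin.natAdd 4 j)) t| ≤ ∏ _j : Fin e, min 1 y :=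
            Finset.prod_le_prod (fun _ _ => abs_nonneg _) fun j _ =>
              le_min (abs_besselJ_le_one _ _) (abs_besselJ_le_mul_rpow _ ht.le)
        _ = (min 1 y) ^ (e : ℝ) := by simp
        _ ≤ (min 1 y) ^ μ := Real.rpow_le_rpow_of_exponent_ge hm0 (min_le_left _ _) hμ
        _ ≤ y ^ μ := Real.rpow_le_rpow hm0.le (min_le_right _ _) hμ₀
    have hyμ : t ^ γ' * y ^ μ ≤ (17 / 10) ^ μ * t ^ γ₀ := by
      rw [hy, Real.mul_rpow (by norm_num) (by positivity), ← Real.rpow_mul ht0.le, mul_left_comm,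
        ← Real.rpow_add ht0]
      gcongr
      · exact ht.le
      · linarith
    rw [norm_besselKernel, Fin.prod_univ_add, Fin.prod_univ_four, Fin.sum_univ_four, ← mul_add,
      ← mul_add, ← mul_add]
    have h4 := mul_mul_mul_le_sum_pow_four |besselJ (k (Fin.castAdd e 0)) t|
      |besselJ (k (Fin.castAdd e 1)) t| |besselJ (k (Fin.castAdd e 2)) t|
      |besselJ (k (Fin.castAdd e 3)) t|
    set Q := |besselJ (k (Fin.castAdd e 0)) t| * |besselJ (k (Fin.castAdd e 1)) t| *
      |besselJ (k (Fin.castAdd e 2)) t| * |besselJ (k (Fin.castAdd e 3)) t| with hQ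
    have hQ0 : 0 ≤ Q := by positivity
    calc t ^ γ' * (Q * ∏ j : Fin e, |besselJ (k (Fin.natAdd 4 j)) t|)
        ≤ t ^ γ' * (Q * y ^ μ) := by gcongr
      _ = (t ^ γ' * y ^ μ) * Q := by ring
      _ ≤ ((17 / 10) ^ μ * t ^ γ₀) * Q := by gcongr
      _ ≤ ((17 / 10) ^ μ * t ^ γ₀) * _ := mul_le_mul_of_nonneg_left h4 (by positivity)
      _ = _ := by ring
  refine ⟨h.1, h.2.trans (le_of_eq ?_)⟩
  rw [Finset.card_univ, Fintype.card_fin]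
  push_cast
  ring

end KernelIntegral

/-! ### Numerical inequalities for the constants `C` and `Γ`. -/

section ResolventConstants

/-- Separates the variables: the factor `P`, which depends on `q`, is absorbed by `Γ`, and an
inequality `h` independent of `q` remains. -/
theorem two_sub_mul_one_add_le {γ X C P G A : ℝ} (hγ1 : γ ≤ 1) (hP : 1 ≤ P)
    (hG : P ≤ G) (hC : 0 ≤ C) (hA : A ≤ P * X) (h : (2 - γ) * (1 + X) ≤ 1 + C) :
    (2 - γ) * (1 + A) ≤ 1 + C * G := by
  have h1 : (2 - γ) * A ≤ (2 - γ) * (P * X) := mul_le_mul_of_nonneg_left hA (by linarith)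
  have h2 : P * ((2 - γ) * (1 + X)) ≤ P * (1 + C) := mul_le_mul_of_nonneg_left h (by linarith)
  have h3 : C * P ≤ C * G := mul_le_mul_of_nonneg_left hG hC
  have h4 : 0 ≤ (P - 1) * (1 - γ) := mul_nonneg (by linarith) (by linarith)
  linarith

/-- With `s = 1 - 2/q` the exponent in `Γ` is `3s` and its base is at least `3`. The left side is
`(1/ε)^s` for `ε = 1/2`. -/
theorem resolventGamma_three_ge {s γ : ℝ} (hs : 0 ≤ s) (h : 6 * s + 2 * γ < 1) (hs1 : s < 1) :
    (2 : ℝ) ^ s ≤ resolventGamma (2 / (1 - s)) 3 γ := by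
  have h1 : 0 < 1 - s := by linarith
  rcases hs.eq_or_lt with rfl | hs0
  · simp [resolventGamma]
  have hq : 2 / (1 - s) ≠ 2 := by
    rw [Ne, div_eq_iff h1.ne']
    intro h'
    linarith
  rw [resolventGamma, if_neg hq, if_pos rfl]
  have hb : 12 * (2 / (1 - s) - 2) / (12 - (5 + 2 * γ) * (2 / (1 - s))) =
      12 * s / (1 - 6 * s - 2 * γ) := by
    have h2 : 2 / (1 - s) - 2 = 2 * s / (1 - s) := by
      field_simp
      ring
    have h3 : 12 - (5 + 2 * γ) * (2 / (1 - s)) = 2 * (1 - 6 * s - 2 * γ) / (1 - s) := by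
      field_simp
      ring
    have h4 : 1 - 6 * s - 2 * γ ≠ 0 := by linarith
    rw [h2, h3]
    field_simp
  have he : 3 * (2 / (1 - s) - 2) / (2 / (1 - s)) = 3 * s := by
    field_simp
    ring
  rw [hb, he]
  have h5 : 0 ≤ 12 * s / (1 - 6 * s - 2 * γ) := div_nonneg (by linarith) (by linarith)
  calc (2 : ℝ) ^ s ≤ 2 ^ (3 * s) := Real.rpow_le_rpow_of_exponent_le (by norm_num) (by linarith)
    _ ≤ _ := Real.rpow_le_rpow (by norm_num) (by linarith) (by linarith)

theorem resolventGamma_five_ge {d : ℕ} (hd : 5 ≤ d) {s γ : ℝ} (hs : 0 ≤ s)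
    (h : d * s + γ < (d - 1) / 3) (hs1 : s < 1) :
    (17 / 10 : ℝ) ^ (d * s) ≤ resolventGamma (2 / (1 - s)) d γ := by
  have h1 : 0 < 1 - s := by linarith
  have hd0 : (5 : ℝ) ≤ d := by exact_mod_cast hd
  rcases hs.eq_or_lt with rfl | hs0
  · simp [resolventGamma, show d ≠ 4 by lia]
  have hq : 2 / (1 - s) ≠ 2 := by
    rw [Ne, div_eq_iff h1.ne']
    intro h'
    linarith
  rw [resolventGamma, if_neg hq, if_neg (by lia), if_neg (by lia)]
  have hb : 0 ≤ 6 * d * (2 / (1 - s) - 2) / (6 * d - (2 * d + 1 + 3 * γ) * (2 / (1 - s))) := by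
    have h2 : 2 / (1 - s) - 2 = 2 * s / (1 - s) := by
      field_simp
      ring
    have h3 : 6 * d - (2 * d + 1 + 3 * γ) * (2 / (1 - s)) =
        6 * ((d - 1) / 3 - d * s - γ) / (1 - s) := by
      field_simp
      ring
    rw [h2, h3]
    have h4 : 0 ≤ (d - 1) / 3 - d * s - γ := by linarith
    positivity
  have he : d * (2 / (1 - s) - 2) / (2 / (1 - s)) = d * s := by
    field_simp
    ring
  rw [he]
  exact Real.rpow_le_rpow (by norm_num) (by linarith) (by positivity)

/-- The two exponents in `Γ` are `1 + 1/(4s)` and `4s`, with product `1 + 4s`. Hence `Γ` keeps at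
least the first power of the large quantity `Z` even as `s → 0`. -/
theorem resolventGamma_four_ge {s γ : ℝ} (hs : 0 < s) (hγ : 0 ≤ γ) (h : 4 * s + γ < 1) :
    4 / (1 - 4 * s - γ) ≤ resolventGamma (2 / (1 - s)) 4 γ := by
  have h1 : 0 < 1 - s := by linarith
  have hg : 0 < 1 - 4 * s - γ := by linarith
  have hq : 2 / (1 - s) ≠ 2 := by
    rw [Ne, div_eq_iff h1.ne']
    intro h'
    linarith
  rw [resolventGamma, if_neg hq, if_neg (by norm_num), if_pos rfl]
  have hb : (5 * (2 / (1 - s)) - 2) / (8 - (3 + γ) * (2 / (1 - s))) =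
      (4 + s) / (1 - 4 * s - γ) := by
    have h2 : 5 * (2 / (1 - s)) - 2 = 2 * (4 + s) / (1 - s) := by
      field_simp
      ring
    have h3 : 8 - (3 + γ) * (2 / (1 - s)) = 2 * (1 - 4 * s - γ) / (1 - s) := by
      field_simp
      ring
    rw [h2, h3]
    field_simp
  have he : 4 * (2 / (1 - s) - 2) / (2 / (1 - s)) = 4 * s := by
    field_simp
    ring
  have he2 : 2 / (1 - s) / (4 * (2 / (1 - s) - 2)) = 1 / (4 * s) := by
    have h2 : 2 / (1 - s) - 2 = 2 * s / (1 - s) := by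
      field_simp
      ring
    rw [h2]
    field_simp
  rw [hb, he, he2]
  set Z := (4 + s) / (1 - 4 * s - γ) with hZ
  have hZ4 : 4 / (1 - 4 * s - γ) ≤ Z := by
    rw [hZ]
    gcongr
    linarith
  have hZ1 : 1 ≤ Z := by
    refine le_trans ?_ hZ4
    rw [le_div_iff₀ hg]
    linarith
  have hZ0 : 0 < Z := by linarith
  calc 4 / (1 - 4 * s - γ) ≤ Z := hZ4
    _ = Z ^ (1 : ℝ) := (Real.rpow_one Z).symm
    _ ≤ Z ^ ((1 + 1 / (4 * s)) * (4 * s)) := by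
        refine Real.rpow_le_rpow_of_exponent_le hZ1 ?_
        have : (1 + 1 / (4 * s)) * (4 * s) = 4 * s + 1 := by
          field_simp
        linarith
    _ = (Z ^ (1 + 1 / (4 * s))) ^ (4 * s) := Real.rpow_mul hZ0.le _ _
    _ ≤ _ := by
        refine Real.rpow_le_rpow (by positivity) ?_ (by linarith)
        linarith [Real.rpow_pos_of_pos hZ0 (1 + 1 / (4 * s))]

/-- From `d = 10` on the ratio `2^{1/4} > 1.189` beats that of the linear side; `7`, `8`, `9` are
checked separately. -/
theorem le_two_rpow_quarter (d : ℕ) (hd : 7 ≤ d) :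
    13 / 14 * ((d : ℝ) - 4) ≤ (2 : ℝ) ^ ((d : ℝ) / 4) := by
  set x : ℝ := 2 ^ (1 / 4 : ℝ) with hx
  have hx0 : 0 < x := by positivity
  have hx4 : x ^ 4 = 2 := by
    rw [hx, ← Real.rpow_mul_natCast (by norm_num)]
    norm_num
  have hx1 : 1189 / 1000 ≤ x := by
    refine le_of_pow_le_pow_left₀ (n := 4) (by norm_num) hx0.le ?_
    rw [hx4]
    norm_num
  have hpow (n : ℕ) : (2 : ℝ) ^ ((n : ℝ) / 4) = x ^ n := by
    rw [hx, ← Real.rpow_mul_natCast (by norm_num)]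
    congr 1
    ring
  rw [hpow]
  have h7 : 13 / 14 * ((7 : ℕ) - 4 : ℝ) ≤ x ^ 7 := by
    have : x ^ 7 = x ^ 4 * x ^ 3 := by ring
    have h3 : (1189 / 1000 : ℝ) ^ 3 ≤ x ^ 3 := by gcongr
    rw [this, hx4]
    norm_num at h3 ⊢
    linarith
  have h8 : 13 / 14 * ((8 : ℕ) - 4 : ℝ) ≤ x ^ 8 := by
    have : x ^ 8 = x ^ 4 * x ^ 4 := by ring
    rw [this, hx4]
    norm_num
  have h9 : 13 / 14 * ((9 : ℕ) - 4 : ℝ) ≤ x ^ 9 := by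
    have : x ^ 9 = x ^ 4 * x ^ 4 * x := by ring
    rw [this, hx4]
    norm_num
    linarith
  have h10 : ∀ n : ℕ, 10 ≤ n → 13 / 14 * ((n : ℝ) - 4) ≤ x ^ n := by
    intro n hn
    induction n, hn using Nat.le_induction with
    | base =>
      have : x ^ 10 = x ^ 4 * x ^ 4 * x ^ 2 := by ring
      have h2 : (1189 / 1000 : ℝ) ^ 2 ≤ x ^ 2 := by gcongr
      rw [this, hx4]
      norm_num at h2 ⊢
      linarith
    | succ n hn ih =>
      have hn' : (10 : ℝ) ≤ n := by exact_mod_cast hn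
      rw [pow_succ]
      calc (13 / 14 * (((n + 1 : ℕ) : ℝ) - 4) : ℝ) ≤ 13 / 14 * ((n : ℝ) - 4) * (1189 / 1000) := by
            push_cast
            linarith
        _ ≤ x ^ n * x := by gcongr
  rcases Nat.lt_or_ge d 10 with h | h
  · interval_cases d
    · exact h7
    · exact h8
    · exact h9
  · exact h10 d h

theorem resolventC_ge_of_seven_le {d : ℕ} (hd : 7 ≤ d) (γ : ℝ) : 13 ≤ resolventC d γ := by
  have hd' : (7 : ℝ) ≤ d := by exact_mod_cast hd
  rw [resolventC, if_neg (by lia), if_neg (by lia), le_div_iff₀ (by linarith)]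
  linarith [le_two_rpow_quarter d hd]

theorem resolventC_five_ge (γ : ℝ) : 19 ≤ resolventC 5 γ := by
  have h : (2 : ℝ) ≤ 2 ^ ((5 : ℝ) / 4) := by
    calc (2 : ℝ) = 2 ^ (1 : ℝ) := (Real.rpow_one 2).symm
      _ ≤ _ := Real.rpow_le_rpow_of_exponent_le (by norm_num) (by norm_num)
  rw [resolventC, if_neg (by norm_num), if_neg (by norm_num), le_div_iff₀ (by norm_num)]
  push_cast
  linarith

theorem resolventC_six_ge (γ : ℝ) : 19 ≤ resolventC 6 γ := by
  have h : (14 / 5 : ℝ) ≤ 2 ^ ((6 : ℝ) / 4) := by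
    refine le_of_pow_le_pow_left₀ (n := 2) (by norm_num) (by positivity) ?_
    rw [← Real.rpow_mul_natCast (by norm_num)]
    norm_num
  rw [resolventC, if_neg (by norm_num), if_neg (by norm_num), le_div_iff₀ (by norm_num)]
  push_cast
  linarith

/-- The numerical inequality behind the constants in dimension at least five. -/
theorem two_sub_mul_le_of_gap {γ c N : ℝ} (hγ0 : 0 ≤ γ) (hγ1 : γ ≤ 1)
    (h : (c = 1 / 9 ∧ N = 20) ∨ (c = 1 / 7 ∧ N = 14)) :
    (2 - γ) * (1 + 17 / 10 * (11 / 20 + (1 - (c + (1 - γ) / 3)) +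
      83 / 100 / (1 - (1 - (c + (1 - γ) / 3))))) ≤ N := by
  obtain ⟨δ, rfl⟩ : ∃ δ, γ = 1 - δ := ⟨1 - γ, by ring⟩
  have hδ0 : 0 ≤ δ := by linarith
  have hδ1 : δ ≤ 1 := by linarith
  have hc : 0 < c := by rcases h with ⟨rfl, -⟩ | ⟨rfl, -⟩ <;> norm_num
  have hD : 0 < c + δ / 3 := by positivity
  rw [show (1 : ℝ) - (1 - δ) = δ by ring, sub_sub_cancel]
  have h1 : (2 - (1 - δ)) * (1 + 17 / 10 * (11 / 20 + (1 - (c + δ / 3)) +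
      83 / 100 / (c + δ / 3))) = (1 + δ) * ((c + δ / 3) * (1 + 17 / 10 * (31 / 20 - (c + δ / 3))) +
      1411 / 1000) / (c + δ / 3) := by
    field_simp
    ring
  rw [h1, div_le_iff₀ hD]
  rcases h with ⟨rfl, rfl⟩ | ⟨rfl, rfl⟩ <;>
  nlinarith [mul_nonneg hδ0 hδ0, mul_nonneg hδ0 (sub_nonneg.2 hδ1),
    mul_nonneg (mul_nonneg hδ0 hδ0) hδ0]

/-- This and its analogues say `γ' - μ/3 ≤ γ₀` for `γ' = (γ + 2s)/(1 - s)`, with `γ₀ = 1 - (c +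
(1-γ)/3)` as in `two_sub_mul_le_of_gap`. Here `c = 1/9` and `μ = 1`. -/
theorem exponent_gap_five {s γ : ℝ} (hs : 0 ≤ s) (hγ1 : γ ≤ 1)
    (h : 5 * s + γ ≤ 4 / 3) : γ + 2 * s ≤ (1 - s) * (8 / 9 + γ / 3) := by
  nlinarith [mul_nonneg hs (sub_nonneg.2 hγ1)]

theorem exponent_gap_six {s γ : ℝ} (hs : 0 ≤ s) (hγ1 : γ ≤ 1)
    (h : 6 * s + γ ≤ 5 / 3) (hs1 : 6 * s ≤ 1) :
    γ + 2 * s ≤ (1 - s) * (8 / 9 + 2 * s + γ / 3) := by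
  nlinarith [mul_nonneg hs (sub_nonneg.2 hγ1), mul_nonneg hs (sub_nonneg.2 hs1)]

theorem exponent_gap_six' {s γ : ℝ} (hγ1 : γ ≤ 1)
    (h : 6 * s + γ ≤ 5 / 3) (hs1 : 1 ≤ 6 * s) :
    γ + 2 * s ≤ (1 - s) * (11 / 9 + γ / 3) := by
  nlinarith [mul_nonneg (sub_nonneg.2 hs1) (sub_nonneg.2 hγ1)]

theorem exponent_gap_seven {d s γ : ℝ} (hd : 7 ≤ d) (hs : 0 ≤ s) (hγ1 : γ ≤ 1)
    (h : d * s + γ ≤ (d - 1) / 3) :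
    γ + 2 * s ≤ (1 - s) * (6 / 7 + d * s / 3 + γ / 3) := by
  set r := d * s with hr
  have hr0 : 0 ≤ r := by positivity
  have hd0 : 0 < d := by linarith
  have hcrit : 0 < 14 * d ^ 2 - 193 * d + 692 := by nlinarith [sq_nonneg (d - 193 / 28)]
  suffices hE : 0 ≤ d * ((1 - s) * (6 / 7 + r / 3 + γ / 3) - γ - 2 * s) by
    linarith [nonneg_of_mul_nonneg_right hE hd0]
  have hexp : d * ((1 - s) * (6 / 7 + r / 3 + γ / 3) - γ - 2 * s) =
      (d - r) * (6 / 7 + r / 3 + γ / 3) - d * γ - 2 * r := by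
    rw [hr]
    ring
  rw [hexp]
  -- The expression decreases in `γ`, so the largest admissible `γ` is the worst: `1` up to `r =
  -- (d-4)/3`, and `(d-1)/3 - r` beyond.
  rcases le_total r ((d - 4) / 3) with h1 | h1
  · have h2 : 0 ≤ (1 - γ) * (d - (d - r) / 3) := mul_nonneg (by linarith) (by linarith)
    have h3 : 0 ≤ r * ((d - 4) / 3 - r) := mul_nonneg hr0 (by linarith)
    have h4 : 0 ≤ (d - 4) * (4 * d / 21 + r * (d / 3 - (d - 4) / 9 - 67 / 21)) := by
      have h5 : 0 ≤ ((d - 4) - 3 * r) * (4 * d / 21) := mul_nonneg (by linarith) (by linarith)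
      have h6 : 0 ≤ 3 * r * ((14 * d ^ 2 - 193 * d + 692) / 189) := by positivity
      linarith
    have h7 : 0 ≤ 4 * d / 21 + r * (d / 3 - (d - 4) / 9 - 67 / 21) :=
      nonneg_of_mul_nonneg_right h4 (by linarith)
    linarith
  · have h2 : 0 ≤ ((d - 1) / 3 - r - γ) * (d - (d - r) / 3) :=
      mul_nonneg (by linarith) (by nlinarith)
    have h3 : 0 ≤ (r - (d - 4) / 3) * (d - 20 / 7 - (d - 1) / 9) :=
      mul_nonneg (by linarith) (by linarith)
    linarith

end ResolventConstants

/-! ### Admissible interpolation data in each dimension. -/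

section HolderConstant

theorem rpow_one_sub_mul_rpow_le {B s e : ℝ} (hB : 1 ≤ B) (hs : 0 ≤ s) (he : 0 < e) :
    B ^ (1 - s) * (1 / e) ^ s ≤ (1 / e) ^ s * B := by
  rw [mul_comm]
  gcongr
  calc B ^ (1 - s) ≤ B ^ (1 : ℝ) := Real.rpow_le_rpow_of_exponent_le hB (by linarith)
    _ = B := Real.rpow_one B

/-- The data of an admissible interpolation: an upper bound `B` for the kernel integrals with
weight `t^γ'` and the decay exponent `1 + ε` at the other end, such that the resulting bound is at
most `1 + C`. -/
def IsHolderConstant (d : ℕ) (s γ C : ℝ) : Prop :=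
  ∃ γ' ε B : ℝ, 0 ≤ B ∧ (∀ k : Fin d → ℤ,
      IntegrableOn (fun t => t ^ γ' * ‖besselKernel k t‖) (Ioi 1) ∧
        ∫ t in Ioi (1 : ℝ), t ^ γ' * ‖besselKernel k t‖ ≤ B) ∧
    0 < ε ∧ -(1 + ε) ≤ γ' ∧ γ = (1 - s) * γ' - s * (1 + ε) ∧
    (2 - γ) * (1 + B ^ (1 - s) * (1 / ε) ^ s) ≤ 1 + C

/-- The choice is `ε = 1/2`, which determines `γ'`. The hypothesis leaves room: `1 - 2γ'` stays
above a third of `1 - 2γ`, so `B` is bounded in terms of `γ` alone. -/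
theorem isHolderConstant_three {s γ : ℝ} (hs : 0 ≤ s) (hγ0 : 0 ≤ γ) (h : 6 * s + 2 * γ < 1) :
    IsHolderConstant 3 s γ (resolventC 3 γ * resolventGamma (2 / (1 - s)) 3 γ) := by
  have h1 : 0 < 1 - s := by linarith
  have hL : 0 < 1 - 2 * γ := by linarith
  set γ' := (γ + 3 / 2 * s) / (1 - s) with hγ'
  have hγ'0 : 0 ≤ γ' := by positivity
  have hgap : (1 - 2 * γ) / 3 ≤ 1 - 2 * γ' := by
    rw [hγ', le_sub_iff_add_le, ← le_sub_iff_add_le', ← mul_div_assoc, div_le_iff₀ h1]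
    nlinarith [mul_nonneg hs hγ0]
  have hlt : 0 < 1 - 2 * γ' := by linarith
  have hB1 : 1 ≤ 93 / 50 + 7 / 4 / (1 - 2 * γ') := by
    have : 0 ≤ 7 / 4 / (1 - 2 * γ') := by positivity
    linarith
  have hBle : 93 / 50 + 7 / 4 / (1 - 2 * γ') ≤ 93 / 50 + 21 / 4 / (1 - 2 * γ) := by
    have : 7 / 4 / (1 - 2 * γ') ≤ 7 / 4 / ((1 - 2 * γ) / 3) := by gcongr
    refine (add_le_add_right this _).trans (le_of_eq ?_)
    field_simp
    norm_num
  have hC : resolventC 3 γ = 8 / (1 - 2 * γ) + 8 := by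
    rw [resolventC, if_pos rfl]
  refine ⟨γ', 1 / 2, 93 / 50 + 7 / 4 / (1 - 2 * γ'), by linarith,
    fun k => integral_besselKernel_three_le k (by linarith), by norm_num, by linarith, ?_, ?_⟩
  · rw [hγ']
    field_simp
    ring
  · refine two_sub_mul_one_add_le (P := 2 ^ s) (X := 93 / 50 + 7 / 4 / (1 - 2 * γ')) (by linarith)
      (Real.one_le_rpow (by norm_num) hs) (resolventGamma_three_ge hs h (by linarith)) ?_ ?_ ?_
    · rw [hC]
      positivity
    · refine (rpow_one_sub_mul_rpow_le hB1 hs (by norm_num)).trans (le_of_eq ?_)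
      norm_num
    · calc _ ≤ (2 - γ) * (1 + (93 / 50 + 21 / 4 / (1 - 2 * γ))) := by
            gcongr
            linarith
        _ ≤ _ := by
          rw [hC, ← sub_nonneg]
          have : 1 + (8 / (1 - 2 * γ) + 8) - (2 - γ) * (1 + (93 / 50 + 21 / 4 / (1 - 2 * γ))) =
            (17 + 9 * (1 - 2 * γ) - (2 - γ) * (143 / 50 * (1 - 2 * γ) + 21 / 4) - 9) /
              (1 - 2 * γ) := by
            field_simp
            ring
          rw [this]
          refine div_nonneg ?_ hL.le
          nlinarith [mul_nonneg hγ0 hL.le]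

/-- The choice is `ε = 1`. At `s = 0` the special value of `Γ` enters. For `s > 0` both `B` and `Γ`
are compared with the reciprocal of the gap `g = 1 - 4s - γ`. -/
theorem isHolderConstant_four {s γ : ℝ} (hs : 0 ≤ s) (hγ0 : 0 ≤ γ) (h : 4 * s + γ < 1) :
    IsHolderConstant 4 s γ (resolventC 4 γ * resolventGamma (2 / (1 - s)) 4 γ) := by
  have h1 : 0 < 1 - s := by linarith
  have hx : 0 < 1 - γ := by linarith
  set γ' := (γ + 2 * s) / (1 - s) with hγ'
  have hγ'0 : 0 ≤ γ' := by positivity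
  have hgap : 1 - γ' = (1 - 3 * s - γ) / (1 - s) := by
    rw [hγ']
    field_simp
    ring
  have hlt : 0 < 1 - γ' := by
    rw [hgap]
    exact div_pos (by linarith) h1
  have hC : resolventC 4 γ = 4 / (1 - γ) := by
    rw [resolventC, if_neg (by norm_num), if_pos rfl]
  refine ⟨γ', 1, 11 / 20 + γ' + 83 / 100 / (1 - γ'), by positivity, fun k => ?_, one_pos,
    by linarith, ?_, ?_⟩
  · have := integral_besselKernel_four_add_le (e := 0) k (γ' := γ') (μ := 0) hγ'0 (by linarith)
      le_rfl (by norm_num) (by norm_num)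
    rwa [Real.rpow_zero, one_mul] at this
  · rw [hγ']
    field_simp
    ring
  · rcases hs.eq_or_lt with rfl | hs0
    · have hγγ : γ' = γ := by simp [hγ']
      have hG : resolventGamma (2 / (1 - 0)) 4 γ = (1 - γ)⁻¹ := by
        rw [sub_zero, div_one, resolventGamma, if_pos rfl, if_pos rfl]
      rw [hγγ, hC, hG, sub_zero, Real.rpow_one, Real.rpow_zero, mul_one, ← sub_nonneg]
      have : 1 + 4 / (1 - γ) * (1 - γ)⁻¹ - (2 - γ) * (1 + (11 / 20 + γ + 83 / 100 / (1 - γ))) =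
          ((1 - γ) ^ 2 + 4 - (2 - γ) * ((31 / 20 + γ) * (1 - γ) ^ 2 + 83 / 100 * (1 - γ))) /
            (1 - γ) ^ 2 := by
        field_simp
        ring
      rw [this]
      refine div_nonneg ?_ (by positivity)
      obtain ⟨x, rfl⟩ : ∃ x, γ = 1 - x := ⟨1 - γ, by ring⟩
      have hx0 : 0 < x := by linarith
      have hx1 : x ≤ 1 := by linarith
      nlinarith [mul_nonneg hx0.le (sub_nonneg.2 hx1), mul_nonneg (mul_nonneg hx0.le hx0.le)
        (sub_nonneg.2 hx1), sq_nonneg (x ^ 2 - x)]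
    · set g := 1 - 4 * s - γ with hg
      have hg0 : 0 < g := by linarith
      have hB1 : 1 ≤ 11 / 20 + γ' + 83 / 100 / (1 - γ') := by
        have : 83 / 100 ≤ 83 / 100 / (1 - γ') := by
          rw [le_div_iff₀ hlt]
          linarith
        linarith
      have hBle : 11 / 20 + γ' + 83 / 100 / (1 - γ') ≤ 31 / 20 + 83 / 100 / g := by
        have h2 : g ≤ 1 - γ' := by
          rw [hgap, le_div_iff₀ h1]
          nlinarith
        have : 83 / 100 / (1 - γ') ≤ 83 / 100 / g := by gcongr
        linarith
      have hA := rpow_one_sub_mul_rpow_le hB1 hs0.le (one_pos)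
      rw [div_one, Real.one_rpow, one_mul, mul_one] at hA
      rw [div_one, Real.one_rpow, mul_one]
      have hCG : 16 / g ≤ resolventC 4 γ * resolventGamma (2 / (1 - s)) 4 γ := by
        have h4 : 4 ≤ resolventC 4 γ := by
          rw [hC, le_div_iff₀ hx]
          linarith
        calc 16 / g = 4 * (4 / g) := by ring
          _ ≤ _ := by
            gcongr
            exact resolventGamma_four_ge hs0 hγ0 h
      have h1g : 1 ≤ 1 / g := by
        rw [le_div_iff₀ hg0]
        linarith
      calc _ ≤ (2 - γ) * (1 + (31 / 20 + 83 / 100 / g)) := by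
            gcongr
            · linarith
            · exact hA.trans hBle
        _ ≤ 2 * (1 + (31 / 20 + 83 / 100 / g)) := by
            gcongr
            linarith
        _ ≤ 1 + 16 / g := by
            have h3 : 83 / 100 / g = 83 / 100 * (1 / g) := by ring
            have h4 : 16 / g = 16 * (1 / g) := by ring
            rw [h3, h4]
            linarith
        _ ≤ _ := by linarith

/-- Again `ε = 1`. Of the price `1.7^μ`, with `μ ≤ 1 + ds`, the part `1.7^{ds}` is absorbed by `Γ`
and the remaining factor `1.7` goes into `X`. -/
theorem isHolderConstant_of_gap {e : ℕ} (he : 1 ≤ e) {s γ c N μ : ℝ} (hs : 0 ≤ s) (hs1 : s < 1)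
    (hγ0 : 0 ≤ γ) (hγ1 : γ ≤ 1)
    (h : ((4 + e : ℕ) : ℝ) * s + γ < (((4 + e : ℕ) : ℝ) - 1) / 3) (hμ0 : 0 ≤ μ) (hμe : μ ≤ e)
    (hμ1 : μ ≤ 1 + ((4 + e : ℕ) : ℝ) * s)
    (hcN : (c = 1 / 9 ∧ N = 20) ∨ (c = 1 / 7 ∧ N = 14)) (hC : N ≤ 1 + resolventC (4 + e) γ)
    (hgap : γ + 2 * s ≤ (1 - s) * (1 - (c + (1 - γ) / 3) + μ / 3)) :
    IsHolderConstant (4 + e) s γ (resolventC (4 + e) γ * resolventGamma (2 / (1 - s)) (4 + e) γ) := by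
  have h1 : 0 < 1 - s := by linarith
  have hc : 0 < c ∧ c ≤ 1 / 7 := by rcases hcN with ⟨rfl, -⟩ | ⟨rfl, -⟩ <;> norm_num
  have hN : 1 ≤ N := by rcases hcN with ⟨-, rfl⟩ | ⟨-, rfl⟩ <;> norm_num
  set γ₀ := 1 - (c + (1 - γ) / 3) with hγ₀
  have hγ₀0 : 0 ≤ γ₀ := by linarith [hc.2]
  have hγ₀1 : γ₀ < 1 := by linarith [hc.1]
  set γ' := (γ + 2 * s) / (1 - s) with hγ'
  have hγ'0 : 0 ≤ γ' := by positivity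
  set X := 17 / 10 * (11 / 20 + γ₀ + 83 / 100 / (1 - γ₀)) with hX
  set r := ((4 + e : ℕ) : ℝ) * s with hr
  have hr0 : 0 ≤ r := by positivity
  have hX1 : 1 ≤ X := by
    have : 83 / 100 ≤ 83 / 100 / (1 - γ₀) := by
      rw [le_div_iff₀ (by linarith)]
      linarith
    rw [hX]
    linarith
  have hP1 : 1 ≤ (17 / 10 : ℝ) ^ r := Real.one_le_rpow (by norm_num) hr0
  have hB1 : 1 ≤ (17 / 10 : ℝ) ^ r * X := one_le_mul_of_one_le_of_one_le hP1 hX1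
  refine ⟨γ', 1, (17 / 10) ^ r * X, by linarith, fun k => ?_, one_pos, by linarith, ?_, ?_⟩
  · have hk := integral_besselKernel_four_add_le k (γ' := γ') hγ₀0 hγ₀1 hμ0 hμe (by
      rw [sub_le_iff_le_add, hγ', div_le_iff₀' h1]
      exact hgap)
    refine ⟨hk.1, hk.2.trans ?_⟩
    have h2 : (17 / 10 : ℝ) ^ μ ≤ 17 / 10 * (17 / 10) ^ r := by
      rw [← Real.rpow_one_add' (by norm_num) (by linarith)]
      exact Real.rpow_le_rpow_of_exponent_le (by norm_num) hμ1
    have h3 : 0 ≤ 83 / 100 / (1 - γ₀) := div_nonneg (by norm_num) (by linarith)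
    calc _ ≤ 17 / 10 * (17 / 10) ^ r * (11 / 20 + γ₀ + 83 / 100 / (1 - γ₀)) := by gcongr
      _ = _ := by
        rw [hX]
        ring
  · rw [hγ']
    field_simp
    ring
  · refine two_sub_mul_one_add_le (P := (17 / 10) ^ r) (X := X) hγ1 hP1
      (resolventGamma_five_ge (by lia) hs h hs1) (by linarith) ?_ ?_
    · refine (rpow_one_sub_mul_rpow_le hB1 hs one_pos).trans (le_of_eq ?_)
      rw [div_one, Real.one_rpow, one_mul]
    · exact (two_sub_mul_le_of_gap hγ0 hγ1 hcN).trans hC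

theorem isHolderConstant_of_five_le {d : ℕ} (hd : 5 ≤ d) {s γ : ℝ} (hs : 0 ≤ s) (hγ0 : 0 ≤ γ)
    (hγ1 : γ ≤ 1) (h : d * s + γ < (d - 1) / 3) :
    IsHolderConstant d s γ (resolventC d γ * resolventGamma (2 / (1 - s)) d γ) := by
  have hd' : (5 : ℝ) ≤ d := by exact_mod_cast hd
  have hs1 : s < 1 := by
    by_contra! hc
    nlinarith
  obtain ⟨e, rfl⟩ : ∃ e, d = 4 + e := ⟨d - 4, by lia⟩
  rcases Nat.lt_or_ge e 3 with he | he
  · obtain rfl | rfl : e = 1 ∨ e = 2 := by lia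
    · refine isHolderConstant_of_gap (μ := 1) le_rfl hs hs1 hγ0 hγ1 h zero_le_one (by norm_num)
        (le_add_of_nonneg_right (by positivity)) (Or.inl ⟨rfl, rfl⟩) (by linarith [resolventC_five_ge γ]) ?_
      push_cast at h
      have := exponent_gap_five hs hγ1 (by linarith)
      linarith
    · push_cast at h
      -- Only two extra factors are available in dimension six, so `μ = 1 + 6s` must be capped at
      -- `2`.
      rcases le_total (6 * s) 1 with h6 | h6
      · refine isHolderConstant_of_gap (μ := 1 + 6 * s) (by norm_num) hs hs1 hγ0 hγ1
          (by push_cast; linarith) (by positivity) (by push_cast; linarith) (by norm_num)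
          (Or.inl ⟨rfl, rfl⟩) (by linarith [resolventC_six_ge γ]) ?_
        have := exponent_gap_six hs hγ1 (by linarith) h6
        linarith
      · refine isHolderConstant_of_gap (μ := 2) (by norm_num) hs hs1 hγ0 hγ1
          (by push_cast; linarith) (by positivity) (by norm_num) (by norm_num; linarith)
          (Or.inl ⟨rfl, rfl⟩) (by linarith [resolventC_six_ge γ]) ?_
        have := exponent_gap_six' hγ1 (by linarith) h6
        linarith
  · have he' : (3 : ℝ) ≤ e := by exact_mod_cast he
    refine isHolderConstant_of_gap (μ := 1 + ((4 + e : ℕ) : ℝ) * s) (by lia) hs hs1 hγ0 hγ1 h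
      (by positivity) ?_ le_rfl (Or.inr ⟨rfl, rfl⟩)
      (by linarith [resolventC_ge_of_seven_le (d := 4 + e) (by lia) γ]) ?_
    · push_cast at h ⊢
      linarith
    · have := exponent_gap_seven (d := ((4 + e : ℕ) : ℝ)) (by push_cast; linarith) hs hγ1 h.le
      linarith

/-- In the variable `s = 1 - 2/q` the bound on `γ` becomes linear: `γ < 1/2 - 3s` for `d = 3` and `γ
< (d-1)/3 - ds` for `d ≥ 4`. -/
theorem isHolderConstant_resolvent {d : ℕ} (hd : 3 ≤ d) {q : ℝ} (hq : 2 ≤ q) {γ : ℝ}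
    (hγ0 : 0 ≤ γ) (hγ1 : γ ≤ 1) (hγ : γ < resolventHolderBound d q) :
    IsHolderConstant d (1 - 2 / q) γ (resolventC d γ * resolventGamma q d γ) := by
  have hq0 : 0 < q := by linarith
  set s := 1 - 2 / q with hs
  have hs0 : 0 ≤ s := sub_nonneg.2 ((div_le_one hq0).2 hq)
  have hqs : q = 2 / (1 - s) := by
    rw [hs, sub_sub_cancel, div_div_cancel₀ two_ne_zero]
  have hinv : 1 / q = (1 - s) / 2 := by
    rw [hs]
    ring
  have hdiv (a : ℝ) : a / q = a * ((1 - s) / 2) := by rw [← hinv, mul_one_div]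
  rw [hqs]
  obtain rfl | hd4 : d = 3 ∨ 4 ≤ d := by lia
  · rw [resolventHolderBound, if_pos rfl, hdiv] at hγ
    exact isHolderConstant_three hs0 hγ0 (by linarith)
  rw [resolventHolderBound, if_neg (by lia), hdiv] at hγ
  obtain rfl | hd5 : d = 4 ∨ 5 ≤ d := by lia
  · push_cast at hγ
    exact isHolderConstant_four hs0 hγ0 (by linarith)
  · exact isHolderConstant_of_five_le hd5 hs0 hγ0 hγ1 (by linarith)

end HolderConstant

/-! ### Boundary values on the two half-planes. -/

section LimitingAbsorption

variable {d : ℕ} {q : ℝ}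

theorem resolventHolderBound_pos (hd : 3 ≤ d) (hq2 : 2 ≤ q)
    (hq : q < resolventCriticalExponent d) : 0 < resolventHolderBound d q := by
  have hq0 : 0 < q := by linarith
  rw [resolventCriticalExponent] at hq
  rw [resolventHolderBound]
  split_ifs at hq ⊢ with h
  · rw [sub_pos, lt_div_iff₀ hq0]
    linarith
  · rw [lt_div_iff₀ (by positivity)] at hq
    rw [sub_pos, lt_div_iff₀ hq0]
    linarith

theorem one_lt_resolventHolderBound (hd : 5 ≤ d) (hq2 : 2 ≤ q)
    (hq : q < 6 * d / (2 * d + 4)) : 1 < resolventHolderBound d q := by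
  have hq0 : 0 < q := by linarith
  rw [resolventHolderBound, if_neg (by lia), lt_sub_iff_add_lt, lt_div_iff₀ hq0]
  rw [lt_div_iff₀ (by positivity)] at hq
  linarith

theorem norm_star_lattice (hq2 : 2 ≤ q) (u : LatticeLp d (ENNReal.ofReal q)) :
    ‖star u‖ = ‖u‖ := by
  have : Fact (1 ≤ ENNReal.ofReal q) := ⟨ENNReal.one_le_ofReal.2 (by linarith)⟩
  exact norm_star u

theorem norm_weightedResolvent_le_of_im_pos (hd : 3 ≤ d) (hq2 : 2 ≤ q)
    (hq : q < resolventCriticalExponent d) (u v : LatticeLp d (ENNReal.ofReal q)) {z : ℂ}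
    (hz : 0 < z.im) : ‖weightedResolvent u v z‖ ≤
      (1 + resolventC d 0 * resolventGamma q d 0) * ‖u‖ * ‖v‖ := by
  obtain ⟨γ', ε, B, hB, hKB, hε, hγ', hγ, h⟩ := isHolderConstant_resolvent hd hq2 le_rfl
    zero_le_one (resolventHolderBound_pos hd hq2 hq)
  rw [sub_sub_cancel] at hγ h
  have hb := norm_weightedResolvent_le_of_integral_le hq2 u v hB hKB hε hγ' hγ hz
  refine hb.trans ?_
  have hs : 0 ≤ 1 - 2 / q := sub_nonneg.2 ((div_le_one (by linarith)).2 hq2)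
  have h0 : 0 ≤ B ^ (2 / q) * (1 / ε) ^ (1 - 2 / q) := by positivity
  have hu := lp.norm_nonneg' u
  have hv := lp.norm_nonneg' v
  refine mul_le_mul_of_nonneg_right (mul_le_mul_of_nonneg_right ?_ hu) hv
  linarith

theorem norm_weightedResolvent_sub_le_of_im_pos (hd : 3 ≤ d) (hq2 : 2 ≤ q)
    (u v : LatticeLp d (ENNReal.ofReal q)) {γ : ℝ} (hγ0 : 0 ≤ γ) (hγ1 : γ ≤ 1)
    (hγq : γ < resolventHolderBound d q) {z z' : ℂ} (hz : 0 < z.im) (hz' : 0 < z'.im) :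
    ‖weightedResolvent u v z - weightedResolvent u v z'‖ ≤
      ‖z - z'‖ ^ γ * (1 + resolventC d γ * resolventGamma q d γ) * ‖u‖ * ‖v‖ := by
  obtain ⟨γ', ε, B, hB, hKB, hε, hγ', hγ, h⟩ := isHolderConstant_resolvent hd hq2 hγ0 hγ1 hγq
  rw [sub_sub_cancel] at hγ h
  have hb := norm_weightedResolvent_sub_le_of_integral_le hq2 u v hB hKB hε hγ' hγ0 hγ1 hγ hz hz'
  have hu := lp.norm_nonneg' u
  have hv := lp.norm_nonneg' v
  refine hb.trans ?_
  gcongr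

theorem continuousAt_weightedResolvent {p : ENNReal} (u v : LatticeLp d p) {z : ℂ}
    (hz : z ∉ latticeCut d) : ContinuousAt (weightedResolvent u v) z :=
  (analyticOnNhd_weightedResolvent u v z hz).continuousAt

/-- The points `z + i / (n + 1)` approach `z` from the upper half-plane. -/
noncomputable def upperApprox (z : ℂ) (n : ℕ) : ℂ := z + ((1 / ((n : ℝ) + 1) : ℝ) : ℂ) * Complex.I

theorem upperApprox_im_pos {z : ℂ} (hz : 0 ≤ z.im) (n : ℕ) : 0 < (upperApprox z n).im := by
  rw [upperApprox, Complex.add_im, Complex.im_ofReal_mul, Complex.I_im, mul_one]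
  positivity

theorem tendsto_upperApprox (z : ℂ) : Tendsto (upperApprox z) atTop (𝓝 z) := by
  have h : Tendsto (fun n : ℕ => ((1 / ((n : ℝ) + 1) : ℝ) : ℂ)) atTop (𝓝 ((0 : ℝ) : ℂ)) :=
    (Complex.continuous_ofReal.tendsto _).comp tendsto_one_div_add_atTop_nhds_zero_nat
  have h2 := (h.mul_const Complex.I).const_add z
  rw [Complex.ofReal_zero, zero_mul, add_zero] at h2
  exact h2

/-- Real points off the cut are reached from above by continuity, and the lower half-plane by the
adjoint symmetry. -/
theorem norm_weightedResolvent_le (hd : 3 ≤ d) (hq2 : 2 ≤ q)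
    (hq : q < resolventCriticalExponent d) (u v : LatticeLp d (ENNReal.ofReal q)) {z : ℂ}
    (hz : z ∉ latticeCut d) : ‖weightedResolvent u v z‖ ≤
      (1 + resolventC d 0 * resolventGamma q d 0) * ‖u‖ * ‖v‖ := by
  rcases lt_or_ge z.im 0 with h | h
  · have hb := norm_weightedResolvent_le_of_im_pos hd hq2 hq (star v) (star u) (z := star z)
      (by simpa using h)
    rw [← star_weightedResolvent, norm_star (weightedResolvent u v z),
      norm_star_lattice hq2, norm_star_lattice hq2] at hb
    linarith
  · exact le_of_tendsto ((continuousAt_weightedResolvent u v hz).tendsto.comp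
      (tendsto_upperApprox z)).norm (Eventually.of_forall fun n =>
        norm_weightedResolvent_le_of_im_pos hd hq2 hq u v (upperApprox_im_pos h n))

/-- The limiting absorption principle in the closed upper half-plane. -/
theorem exists_extension_upper (hd : 3 ≤ d) (hq2 : 2 ≤ q)
    (hq : q < resolventCriticalExponent d) (u v : LatticeLp d (ENNReal.ofReal q)) :
    ∃ Y : ℂ → LatticeOp d,
      EqOn Y (weightedResolvent u v) ({z | 0 ≤ z.im} \ latticeCut d) ∧
      ContinuousOn Y {z | 0 ≤ z.im} ∧
      ∀ γ : ℝ, 0 ≤ γ → γ ≤ 1 → γ < resolventHolderBound d q →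
        ∀ z ∈ {z : ℂ | 0 ≤ z.im}, ∀ z' ∈ {z : ℂ | 0 ≤ z.im}, ‖Y z - Y z'‖ ≤
          ‖z - z'‖ ^ γ * (1 + resolventC d γ * resolventGamma q d γ) * ‖u‖ * ‖v‖ := by
  -- Any one positive admissible exponent gives the Cauchy property and the continuity of the limit;
  -- the other exponents pass to the limit afterwards.
  obtain ⟨α, hα0, hα⟩ := exists_between (lt_min one_pos (resolventHolderBound_pos hd hq2 hq))
  have hα1 := (hα.trans_le (min_le_left _ _)).le
  have hαq := hα.trans_le (min_le_right _ _)
  set L := (1 + resolventC d α * resolventGamma q d α) * ‖u‖ * ‖v‖ with hL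
  have hL0 : 0 ≤ L := by
    -- Two points at distance one, so that the right side is `L` itself.
    have h := (norm_nonneg _).trans (norm_weightedResolvent_sub_le_of_im_pos hd hq2 u v hα0.le hα1
      hαq (z := 2 * Complex.I) (z' := Complex.I) (by norm_num) (by norm_num))
    rwa [two_mul, add_sub_cancel_right, Complex.norm_I, Real.one_rpow, one_mul] at h
  have hpow : Tendsto (fun x : ℝ => x ^ α * L) (𝓝 0) (𝓝 0) := by
    have h := ((Real.continuousAt_rpow_const 0 α (Or.inr hα0.le)).tendsto).mul_const L
    rwa [Real.zero_rpow hα0.ne', zero_mul] at h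
  have hlim (z : ℂ) (hz : 0 ≤ z.im) :
      ∃ T, Tendsto (fun n => weightedResolvent u v (upperApprox z n)) atTop (𝓝 T) := by
    refine cauchySeq_tendsto_of_complete (cauchySeq_of_le_tendsto_0'
      (fun n : ℕ => (1 / ((n : ℝ) + 1)) ^ α * L) (fun n m hnm => ?_)
      (hpow.comp tendsto_one_div_add_atTop_nhds_zero_nat))
    have h := norm_weightedResolvent_sub_le_of_im_pos hd hq2 u v hα0.le hα1 hαq
      (upperApprox_im_pos hz n) (upperApprox_im_pos hz m)
    rw [dist_eq_norm]
    have hd : ‖upperApprox z n - upperApprox z m‖ ≤ 1 / ((n : ℝ) + 1) := by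
      have hnm' : 1 / ((m : ℝ) + 1) ≤ 1 / ((n : ℝ) + 1) := by gcongr
      have hm : 0 ≤ 1 / ((m : ℝ) + 1) := by positivity
      rw [upperApprox, upperApprox, add_sub_add_left_eq_sub, ← sub_mul, norm_mul, Complex.norm_I,
        mul_one, ← Complex.ofReal_sub, Complex.norm_real, Real.norm_of_nonneg (by linarith)]
      linarith
    calc _ ≤ ‖upperApprox z n - upperApprox z m‖ ^ α * L := by
          rw [hL]
          linarith
      _ ≤ _ := by gcongr
  choose! Y hY using hlim
  have hest : ∀ γ : ℝ, 0 ≤ γ → γ ≤ 1 → γ < resolventHolderBound d q →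
        ∀ z ∈ {z : ℂ | 0 ≤ z.im}, ∀ z' ∈ {z : ℂ | 0 ≤ z.im}, ‖Y z - Y z'‖ ≤
          ‖z - z'‖ ^ γ * (1 + resolventC d γ * resolventGamma q d γ) * ‖u‖ * ‖v‖ := by
    intro γ hγ0 hγ1 hγq z hz z' hz'
    -- Both points are shifted by the same amount, so the estimate passes to the limit with its
    -- right side unchanged.
    have hdist (n : ℕ) : upperApprox z n - upperApprox z' n = z - z' :=
      add_sub_add_right_eq_sub _ _ _
    refine le_of_tendsto ((hY z hz).sub (hY z' hz')).norm (Eventually.of_forall fun n => ?_)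
    have h := norm_weightedResolvent_sub_le_of_im_pos hd hq2 u v hγ0 hγ1 hγq
      (upperApprox_im_pos hz n) (upperApprox_im_pos hz' n)
    rwa [hdist] at h
  refine ⟨Y, fun z hz => ?_, fun z hz => ?_, hest⟩
  · exact tendsto_nhds_unique (hY z hz.1)
      ((continuousAt_weightedResolvent u v hz.2).tendsto.comp (tendsto_upperApprox z))
  · rw [ContinuousWithinAt, tendsto_iff_norm_sub_tendsto_zero]
    have h1 : Tendsto (fun w : ℂ => ‖w - z‖) (𝓝[{z | 0 ≤ z.im}] z) (𝓝 0) :=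
      tendsto_iff_norm_sub_tendsto_zero.1 (tendsto_id.mono_left nhdsWithin_le_nhds)
    refine squeeze_zero' (Eventually.of_forall fun _ => norm_nonneg _) ?_ (hpow.comp h1)
    filter_upwards [self_mem_nhdsWithin] with w hw
    refine (hest α hα0.le hα1 hαq w hw z hz).trans (le_of_eq ?_)
    rw [hL, Function.comp_apply]
    ring

theorem exists_extension_lower (hd : 3 ≤ d) (hq2 : 2 ≤ q)
    (hq : q < resolventCriticalExponent d) (u v : LatticeLp d (ENNReal.ofReal q)) :
    ∃ Y : ℂ → LatticeOp d,
      EqOn Y (weightedResolvent u v) ({z | z.im ≤ 0} \ latticeCut d) ∧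
      ContinuousOn Y {z | z.im ≤ 0} ∧
      ∀ γ : ℝ, 0 ≤ γ → γ ≤ 1 → γ < resolventHolderBound d q →
        ∀ z ∈ {z : ℂ | z.im ≤ 0}, ∀ z' ∈ {z : ℂ | z.im ≤ 0}, ‖Y z - Y z'‖ ≤
          ‖z - z'‖ ^ γ * (1 + resolventC d γ * resolventGamma q d γ) * ‖u‖ * ‖v‖ := by
  obtain ⟨Y, hY, hc, he⟩ := exists_extension_upper hd hq2 hq (star v) (star u)
  have hmem {z : ℂ} (hz : z ∈ {z : ℂ | z.im ≤ 0}) : star z ∈ {z : ℂ | 0 ≤ z.im} := by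
    simpa using hz
  refine ⟨fun z => star (Y (star z)), fun z hz => ?_, ?_, fun γ hγ0 hγ1 hγ z hz z' hz' => ?_⟩
  · have hcut : star z ∉ latticeCut d := by
      rintro ⟨x, hx, hxz⟩
      refine hz.2 ⟨x, hx, ?_⟩
      rw [← star_star z, ← hxz]
      exact (Complex.conj_ofReal x).symm
    simp only
    rw [hY ⟨hmem hz.1, hcut⟩, star_weightedResolvent, star_star, star_star, star_star]
  · exact continuous_star.comp_continuousOn (hc.comp continuous_star.continuousOn fun z hz => hmem hz)
  · have h := he γ hγ0 hγ1 hγ _ (hmem hz) _ (hmem hz')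
    rw [← star_sub, norm_star, norm_star_lattice hq2, norm_star_lattice hq2] at h
    rw [← star_sub, norm_star]
    linarith

end LimitingAbsorption

theorem theorem1p3 (d : ℕ) (hd : 3 ≤ d) (q : ℝ) (hq2 : 2 ≤ q)
    (hq : q < resolventCriticalExponent d) (u v : LatticeLp d (ENNReal.ofReal q)) :
    -- the resolvent exists, and the weighted resolvent is analytic, off `[-d, d]`
    (∀ z ∉ latticeCut d, IsUnit (latticeLaplacian d - z • ContinuousLinearMap.id ℂ _)) ∧
    AnalyticOnNhd ℂ (weightedResolvent u v) (latticeCut d)ᶜ ∧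
    -- (a) the uniform bound
    (∀ z ∉ latticeCut d,
      ‖weightedResolvent u v z‖ ≤
        (1 + resolventC d 0 * resolventGamma q d 0) * ‖u‖ * ‖v‖) ∧
    -- (b) in the closed upper and in the closed lower half-plane
    (∀ H : Set ℂ, (H = {z | 0 ≤ z.im} ∨ H = {z | z.im ≤ 0}) →
      -- the Hölder estimate off `[-d, d]`
      (∀ γ : ℝ, 0 ≤ γ → γ ≤ 1 → γ < resolventHolderBound d q →
        ∀ z ∈ H \ latticeCut d, ∀ z' ∈ H \ latticeCut d,
          ‖weightedResolvent u v z - weightedResolvent u v z'‖ ≤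
            ‖z - z'‖ ^ γ * (1 + resolventC d γ * resolventGamma q d γ) * ‖u‖ * ‖v‖) ∧
      -- the continuous extension to the whole closed half-plane, with the same estimate
      ∃ Y : ℂ → LatticeOp d,
        Set.EqOn Y (weightedResolvent u v) (H \ latticeCut d) ∧
        ContinuousOn Y H ∧
        (∀ γ : ℝ, 0 ≤ γ → γ ≤ 1 → γ < resolventHolderBound d q →
          ∀ z ∈ H, ∀ z' ∈ H,
            ‖Y z - Y z'‖ ≤
              ‖z - z'‖ ^ γ * (1 + resolventC d γ * resolventGamma q d γ) * ‖u‖ * ‖v‖) ∧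
        -- Lipschitz continuity
        (5 ≤ d → q < 6 * d / (2 * d + 4) →
          ∀ z ∈ H, ∀ z' ∈ H,
            ‖Y z - Y z'‖ ≤
              ‖z - z'‖ * ((1 + resolventC d 1 * resolventGamma q d 1) * ‖u‖ * ‖v‖))) := by
  refine ⟨fun z hz => isUnit_latticeLaplacian_sub hz, analyticOnNhd_weightedResolvent u v,
    fun z hz => norm_weightedResolvent_le hd hq2 hq u v hz, fun H hH => ?_⟩
  obtain ⟨Y, hY, hc, he⟩ : ∃ Y : ℂ → LatticeOp d,
      EqOn Y (weightedResolvent u v) (H \ latticeCut d) ∧ ContinuousOn Y H ∧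
      ∀ γ : ℝ, 0 ≤ γ → γ ≤ 1 → γ < resolventHolderBound d q → ∀ z ∈ H, ∀ z' ∈ H, ‖Y z - Y z'‖ ≤
        ‖z - z'‖ ^ γ * (1 + resolventC d γ * resolventGamma q d γ) * ‖u‖ * ‖v‖ := by
    rcases hH with rfl | rfl
    · exact exists_extension_upper hd hq2 hq u v
    · exact exists_extension_lower hd hq2 hq u v
  refine ⟨fun γ hγ0 hγ1 hγ z hz z' hz' => ?_, Y, hY, hc, he, fun hd5 hq5 z hz z' hz' => ?_⟩
  · rw [← hY hz, ← hY hz']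
    exact he γ hγ0 hγ1 hγ z hz.1 z' hz'.1
  · have h := he 1 zero_le_one le_rfl (one_lt_resolventHolderBound hd5 hq2 hq5) z hz z' hz'
    rw [Real.rpow_one] at h
    linarith
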